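/- Let $U$ be a finite nonempty ground set with $n=|U|$, let $f:2^{U}\to\mathbb{R}_{\ge 0}$ be submodular and not identically zero, let $k\ge 1$, $0<\varepsilon<1$, and let $O$ maximize $f$ among the subsets of $U$ of size at most $k$. Write $\Delta(x\mid S)=f(S\cup\{x\})-f(S)$. *ParallelInterpolatedGreedy* with parameters $(f,k,\ell,\varepsilon)$ is the following randomized algorithm with a value oracle for $f$. Put $\varepsilon'=\varepsilon/2$, $m=\lfloor k/\ell\rfloor$, $M=\max_{x\in U}f(\{x\})$, $\tau_{\min}=\varepsilon'M/k$, $G=\emptyset$. Repeat $\ell$ times: run the subroutine $\mathrm{PIG}(G)$ below, which returns sets $A_1',\dots,A_\ell'$, choose $l\in\{1,\dots,\ell\}$ uniformly at random, and replace $G$ by $G\cup A_l'$. Return $G$. $\mathrm{PIG}(G)$: set $A_j=A_j'=\emptyset$, $V_j=U$, $\tau_j=\max_{x}\Delta(x\mid G)$ for $j\in I=\{1,\dots,\ell\}$, and $m_0=m$. While $I\ne\emptyset$ and $m_0>0$: 1. For all $j\in I$ in parallel, *update* $(V_j,\tau_j)$: replace $V_j$ by $\{x\in V_j\setminus\bigcup_lA_l:\Delta(x\mid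 G\cup A_j)\ge\tau_j\}$ and, while $V_j=\emptyset$ and $\tau_j\ge\tau_{\min}$, replace $\tau_j$ by $(1-\varepsilon')\tau_j$ and $V_j$ by $\{x\in U\setminus\bigcup_lA_l:\Delta(x\mid G\cup A_j)\ge\tau_j\}$. Remove from $I$ the indices with $\tau_j<\tau_{\min}$; stop if $I=\emptyset$. 2. If $|V_i|<2\ell$ for some $i\in I$: for $j\in I$ in sequence, update $(V_j,\tau_j)$ if $V_j=\emptyset$; if then $\tau_j<\tau_{\min}$ remove $j$ from $I$, otherwise add a uniformly random $x\in V_j$ to $A_j$ and $A_j'$ and delete it from all $V_l$. Decrease $m_0$ by $1$. 3. Otherwise choose pairwise disjoint sets $\mathcal V_j\subseteq V_j$, $j\in I$, one after the other in order of increasing $|V_j|$, where $\mathcal V_j$ is a uniformly random set of $\lfloor |V_j|/|I|\rfloor$ elements of $V_j$ not yet chosen. Let $s=\min\{m_0,\min_{j\in I}|\mathcal V_j|\}$. For all $j\in I$ in parallel, order $\mathcal V_j$ uniformly at random as $v_1,v_2,\dots$; for $i\le s$ call $v_i$ *true* if its marginal gain over $G\cup A_j\cup\{v_1,\dots,v_{i-1}\}$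 is at least $\tau_j$, *false* if it is negative, and *none* otherwise; let $i_j^*$ be the largest $i\le s$ such that at least $(1-\varepsilon')i$ of $v_1,\dots,v_i$ are true. Let $i^*=\min_{j\in I}i_j^*$. For each $j\in I$ let $S_j$ consist of $i^*$ elements among the first $i_j^*$ elements of $\mathcal V_j$, taken in order, first the true, then the none, then the false ones; add $S_j$ to $A_j$ and the elements of $S_j$ that are not false to $A_j'$. Decrease $m_0$ by $i^*$. Return $A_1',\dots,A_\ell'$. Oracle queries are grouped into adaptive rounds: queries of the same round do not depend on each other's answers. **Theorem.** For every $c>0$ there is a constant $C>0$ such that the following holds for all $U,f,k,\varepsilon$ as above and every integer $\ell$ with $$\frac{4}{e\varepsilon}<\ell\le\frac{c}{\varepsilon}\qquad\text{and}\qquad k\ge\frac{(2-\varepsilon)^2\ell^2}{e\varepsilon\ell-4}.$$ The set $G$ returned by ParallelInterpolatedGreedy satisfies $|G|\le k$ and $\mathbb{E}[f(G)]\ge\left(\frac1e-\varepsilon\right)f(O)$. With probability at least $1-\frac{C}{\varepsilon n}$ the algorithm uses at most $C\varepsilon^{-5}\log n\,\log k$ adaptive rounds and at most $C\varepsilon^{-6}\,n\log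 n\,\log k$ oracle queries. -/

import Mathlib

noncomputable section

open scoped Classical

/-! ### Set functions -/

/-- `f (A ∪ B) + f (A ∩ B) ≤ f A + f B` for all `A`, `B`. -/
def IsSubmodular {U : Type} (f : Finset U → ℝ) : Prop :=
  ∀ A B : Finset U, f (A ∪ B) + f (A ∩ B) ≤ f A + f B

/-- `O` maximizes `f` among the sets of size at most `k`. -/
def IsOptimal {U : Type} (f : Finset U → ℝ) (k : ℕ) (O : Finset U) : Prop :=
  O.card ≤ k ∧ ∀ S : Finset U, S.card ≤ k → f S ≤ f O

/-! ### Randomized algorithms with a value oracle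

An algorithm sees the set function only through `round`: it submits a finite collection of sets,
which are evaluated in parallel, and goes on with the answers. Such a step is one adaptive round
and costs as many queries as sets were submitted. -/

/-- Randomized algorithms with output in `α` and access to a value oracle on subsets of `U`. -/
inductive OracleAlg (U α : Type) : Type 1
  /-- stop with output `a` -/
  | ret (a : α) : OracleAlg U α
  /-- query all the sets in `Q` in one adaptive round and continue with the answers -/
  | round (Q : Finset (Finset U)) (next : (Finset U → ℝ) → OracleAlg U α) : OracleAlg U α
  /-- draw a uniformly random element of `s` and continue with it -/
  | sample (β : Type) (s : Finset β) (hs : s.Nonempty) (next : β → OracleAlg U α) : OracleAlg U α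

namespace OracleAlg

variable {U α β : Type}

/-- Sequential composition. -/
def andThen : OracleAlg U α → (α → OracleAlg U β) → OracleAlg U β
  | ret a, g => g a
  | round Q next, g => round Q fun ans => (next ans).andThen g
  | sample γ s hs next, g => sample γ s hs fun b => (next b).andThen g

instance : Monad (OracleAlg U) where
  pure := ret
  bind := andThen

/-- Query all the sets in `Q` in one adaptive round. -/
def ask (Q : Finset (Finset U)) : OracleAlg U (Finset U → ℝ) :=
  round Q ret

/-- A uniformly random element of `s`; `d` is returned only if `s` is empty. -/
def pick (s : Finset β) (d : β) : OracleAlg U β :=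
  if hs : s.Nonempty then sample β s hs ret else ret d

/-- The output of an execution, with the numbers of adaptive rounds and of oracle queries. -/
structure Outcome (α : Type) where
  output : α
  rounds : ℕ
  queries : ℕ

/-- The joint law of output, number of rounds and number of queries, when the oracle is `f`.
Nothing is revealed about sets that were not queried in the round. -/
def run (f : Finset U → ℝ) : OracleAlg U α → PMF (Outcome α)
  | ret a => PMF.pure ⟨a, 0, 0⟩
  | round Q next =>
      (run f (next fun S => if S ∈ Q then f S else 0)).map
        fun o => ⟨o.output, o.rounds + 1, o.queries + Q.card⟩
  | sample _ s hs next => (PMF.uniformOfFinset s hs).bind fun b => run f (next b)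

/-- The expectation of `f` at the set that the algorithm returns. -/
def expectedValue [Fintype U] (f : Finset U → ℝ) (a : OracleAlg U (Finset U)) : ℝ :=
  ∑ G : Finset U, (((a.run f).map Outcome.output) G).toReal * f G

/-- The probability that the outcome of the execution lies in `E`. -/
def prob (f : Finset U → ℝ) (a : OracleAlg U α) (E : Set (Outcome α)) : ℝ :=
  ((a.run f).toOuterMeasure E).toReal

end OracleAlg

open OracleAlg

/-! ### The algorithms

The solutions are indexed by `Fin ℓ`. An oracle for `f_G : S ↦ f (G ∪ S)` is realized by
querying `f` at `G ∪ S`. -/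

section Algorithms

variable {U : Type} {ℓ : ℕ}

/-- The sets needed for the marginal gains over `B` of the elements of `X`. -/
def gainQueries (B X : Finset U) : Finset (Finset U) :=
  insert B (X.image fun x => insert x B)

/-- The elements of `X` whose marginal gain over `B` is at least `τ`. -/
def keep (ans : Finset U → ℝ) (B X : Finset U) (τ : ℝ) : Finset U :=
  X.filter fun x => τ ≤ ans (insert x B) - ans B

/-- The union of all solutions. -/
def used (A : Fin ℓ → Finset U) : Finset U :=
  Finset.univ.biUnion A

/-- The number of times that `τ` has to be multiplied by `1 - ε` to get below `τmin`. -/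
def stepsBelow (τmin ε τ : ℝ) : ℕ :=
  sInf {i : ℕ | (1 - ε) ^ i * τ < τmin}

/-- The while loops of `Update` for the indices in `J`, run in parallel. A loop goes on as long as
its candidate set is empty and its threshold has not dropped below `τmin`; each pass lowers the
threshold and recomputes the candidates among all elements outside the solutions. The first
argument bounds the number of passes. -/
def lowerLoop [Fintype U] (G : Finset U) (τmin ε : ℝ) (J : Finset (Fin ℓ))
    (A : Fin ℓ → Finset U) :
    ℕ → (Fin ℓ → Finset U) × (Fin ℓ → ℝ) → OracleAlg U ((Fin ℓ → Finset U) × (Fin ℓ → ℝ))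
  | 0, p => pure p
  | n + 1, (V, τ) =>
      let E := J.filter fun j => V j = ∅ ∧ τmin ≤ τ j
      if E = ∅ then pure (V, τ)
      else do
        let ans ← ask (E.biUnion fun j => gainQueries (G ∪ A j) (Finset.univ \ used A))
        let τ' : Fin ℓ → ℝ := fun j => if j ∈ E then (1 - ε) * τ j else τ j
        let V' : Fin ℓ → Finset U := fun j =>
          if j ∈ E then keep ans (G ∪ A j) (Finset.univ \ used A) (τ' j) else V j
        lowerLoop G τmin ε J A n (V', τ')

/-- `Update`, run in parallel for the indices in `J`, with the oracles `f_{G ∪ A_j}` restricted to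
the elements outside the solutions: filter the candidates with the current threshold, then lower
the threshold while there is no candidate. For `τmin > 0` the bound on the number of passes never
cuts a loop short. -/
def update [Fintype U] (G : Finset U) (τmin ε : ℝ) (J : Finset (Fin ℓ))
    (A V : Fin ℓ → Finset U) (τ : Fin ℓ → ℝ) :
    OracleAlg U ((Fin ℓ → Finset U) × (Fin ℓ → ℝ)) := do
  let ans ← ask (J.biUnion fun j => gainQueries (G ∪ A j) (V j \ used A))
  let V' : Fin ℓ → Finset U := fun j =>
    if j ∈ J then keep ans (G ∪ A j) (V j \ used A) (τ j) else V j
  lowerLoop G τmin ε J A (J.sup fun j => stepsBelow τmin ε (τ j)) (V', τ)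

/-- The variables of `ParallelInterlaceGreedy`: active indices, solutions `A_j` and `A_j'`,
candidate sets and thresholds. -/
structure PIGState (U : Type) (ℓ : ℕ) where
  I : Finset (Fin ℓ)
  A : Fin ℓ → Finset U
  A' : Fin ℓ → Finset U
  V : Fin ℓ → Finset U
  τ : Fin ℓ → ℝ

/-- One element is added to each of the listed solutions, in sequence. -/
def addOneEach [Fintype U] (G : Finset U) (τmin ε : ℝ) :
    List (Fin ℓ) → PIGState U ℓ → OracleAlg U (PIGState U ℓ)
  | [], st => pure st
  | j :: js, st => do
      let (V, τ) ←
        if st.V j = ∅ then update G τmin ε {j} st.A st.V st.τ else pure (st.V, st.τ)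
      if τ j < τmin then
        addOneEach G τmin ε js { st with I := st.I.erase j, V := V, τ := τ }
      else if hV : (V j).Nonempty then
        OracleAlg.sample U (V j) hV fun x =>
          addOneEach G τmin ε js
            { I := st.I
              A := Function.update st.A j (insert x (st.A j))
              A' := Function.update st.A' j (insert x (st.A' j))
              V := fun l => (V l).erase x
              τ := τ }
      else
        -- not reached: after `update`, an empty candidate set comes with `τ j < τmin`
        addOneEach G τmin ε js { st with V := V, τ := τ }

/-- The loop of `Distribute`: `N` is the number of input sets, `J` the indices still to be served,
`D` the disjoint sets chosen so far. -/
def distributeLoop (N : ℕ) (V : Fin ℓ → Finset U) :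
    ℕ → Finset (Fin ℓ) → (Fin ℓ → Finset U) → OracleAlg U (Fin ℓ → Finset U)
  | 0, _, D => pure D
  | n + 1, J, D =>
      if hJ : J.Nonempty then do
        let j := (J.exists_min_image (fun j => (V j).card) hJ).choose
        let S ← pick (Finset.powersetCard ((V j).card / N) (V j \ used D)) ∅
        distributeLoop N V n (J.erase j) (Function.update D j S)
      else pure D

/-- `Distribute`, with input sets `V j`, `j ∈ I`. -/
def distribute (I : Finset (Fin ℓ)) (V : Fin ℓ → Finset U) : OracleAlg U (Fin ℓ → Finset U) :=
  distributeLoop I.card V I.card I fun _ => ∅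

/-- Independent uniformly random orderings of the sets `D j`, for the listed `j`. -/
def permuteAll (D : Fin ℓ → Finset U) : List (Fin ℓ) → OracleAlg U (Fin ℓ → List U)
  | [] => pure fun _ => []
  | j :: js => do
      let L ← permuteAll D js
      let p ← pick (D j).toList.permutations.toFinset []
      pure (Function.update L j p)

/-- The entries of the array `B` in `Prefix-Selection`. -/
inductive Mark
  | good
  | neutral
  | bad

/-- The elements of a list together with their entries in `B`: the entry of `v` is determined by
its marginal gain over `T` and the elements that precede it. -/
def markList (ans : Finset U → ℝ) (τ : ℝ) : Finset U → List U → List (U × Mark)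
  | _, [] => []
  | T, v :: vs =>
      (v, if τ ≤ ans (insert v T) - ans T then Mark.good
          else if ans (insert v T) - ans T < 0 then Mark.bad
          else Mark.neutral) :: markList ans τ (insert v T) vs

/-- The number of `good` entries. -/
def goodCount (b : List (U × Mark)) : ℕ :=
  b.countP fun p => decide (p.2 = Mark.good)

/-- `i* = max {i ≤ s : #good among the first i is at least (1 - ε) i}`. -/
def prefixLength (ε : ℝ) (s : ℕ) (b : List (U × Mark)) : ℕ :=
  ((Finset.range (s + 1)).filter fun i : ℕ => (1 - ε) * i ≤ goodCount (b.take i)).sup id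

/-- Select `i` entries of `b` in three passes: first `good`, then `neutral`, then `bad` ones. -/
def threePass (i : ℕ) (b : List (U × Mark)) : List (U × Mark) :=
  (b.filter (fun p => decide (p.2 = Mark.good)) ++
    b.filter (fun p => decide (p.2 = Mark.neutral)) ++
    b.filter (fun p => decide (p.2 = Mark.bad))).take i

/-- Equally many elements are added to each active solution. Returns the new state and the number
of elements. The calls of `Prefix-Selection` for all active indices share one adaptive round. -/
def addBlock (G : Finset U) (ε : ℝ) (m₀ : ℕ) (st : PIGState U ℓ) (hI : st.I.Nonempty) :
    OracleAlg U (PIGState U ℓ × ℕ) := do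
  let D ← distribute st.I st.V
  let s := min m₀ (st.I.inf' hI fun j => (D j).card)
  let L ← permuteAll D (st.I.sort (· ≤ ·))
  let ans ← ask (st.I.biUnion fun j =>
    (Finset.range (s + 1)).image fun i => (G ∪ st.A j) ∪ ((L j).take i).toFinset)
  let b : Fin ℓ → List (U × Mark) := fun j =>
    markList ans (st.τ j) (G ∪ st.A j) ((L j).take s)
  let len : Fin ℓ → ℕ := fun j => prefixLength ε s (b j)
  let i := st.I.inf' hI len
  let sel : Fin ℓ → List (U × Mark) := fun j => threePass i ((b j).take (len j))
  let S : Fin ℓ → Finset U := fun j => ((sel j).map Prod.fst).toFinset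
  let S' : Fin ℓ → Finset U := fun j =>
    (((sel j).filter fun p => decide (p.2 ≠ Mark.bad)).map Prod.fst).toFinset
  pure
    ({ st with
        A := fun j => if j ∈ st.I then st.A j ∪ S j else st.A j
        A' := fun j => if j ∈ st.I then st.A' j ∪ S' j else st.A' j }, i)

/-- The while loop of `ParallelInterlaceGreedy`, with remaining capacity `m₀`. The first argument
bounds the number of passes; each pass lowers `m₀` by at least one, so that `m₀` is a sufficient
bound. -/
def pigLoop [Fintype U] (G : Finset U) (τmin ε : ℝ) :
    ℕ → ℕ → PIGState U ℓ → OracleAlg U (Fin ℓ → Finset U)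
  | 0, _, st => pure st.A'
  | n + 1, m₀, st =>
      if st.I = ∅ ∨ m₀ = 0 then pure st.A'
      else do
        let (V, τ) ← update G τmin ε st.I st.A st.V st.τ
        let st₁ : PIGState U ℓ :=
          { st with I := st.I.filter fun j => τmin ≤ τ j, V := V, τ := τ }
        if hI : st₁.I.Nonempty then
          if ∃ i ∈ st₁.I, (V i).card < 2 * ℓ then do
            let st₂ ← addOneEach G τmin ε (st₁.I.sort (· ≤ ·)) st₁
            pigLoop G τmin ε n (m₀ - 1) st₂
          else do
            let (st₂, i) ← addBlock G ε m₀ st₁ hI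
            pigLoop G τmin ε n (m₀ - i) st₂
        else pure st₁.A'

/-- `ParallelInterlaceGreedy (f_G, m, ℓ, τmin, ε)`; returns the family `A_l'`, `l ∈ Fin ℓ`. -/
def parallelInterlaceGreedy [Fintype U] [Nonempty U] (G : Finset U) (m ℓ : ℕ) (τmin ε : ℝ) :
    OracleAlg U (Fin ℓ → Finset U) := do
  let ans ← ask (gainQueries G Finset.univ)
  let M : ℝ := Finset.univ.sup' Finset.univ_nonempty fun x : U => ans (insert x G) - ans G
  pigLoop G τmin ε m m
    { I := Finset.univ
      A := fun _ => ∅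
      A' := fun _ => ∅
      V := fun _ => Finset.univ
      τ := fun _ => M }

/-- `i` passes of the for loop of `ParallelInterpolatedGreedy`, starting from `G`. -/
def pitgLoop [Fintype U] [Nonempty U] (m ℓ : ℕ) (τmin ε : ℝ) :
    ℕ → Finset U → OracleAlg U (Finset U)
  | 0, G => pure G
  | i + 1, G => do
      let A' ← parallelInterlaceGreedy G m ℓ τmin ε
      if hl : (Finset.univ : Finset (Fin ℓ)).Nonempty then
        OracleAlg.sample (Fin ℓ) Finset.univ hl fun l =>
          pitgLoop m ℓ τmin ε i (G ∪ A' l)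
      else pure G

/-- `ParallelInterpolatedGreedy` with size constraint `k`, `ℓ` solutions and error `ε`. -/
def parallelInterpolatedGreedy (U : Type) [Fintype U] [Nonempty U] (k ℓ : ℕ) (ε : ℝ) :
    OracleAlg U (Finset U) := do
  let ans ← ask (Finset.univ.image fun x : U => ({x} : Finset U))
  let M : ℝ := Finset.univ.sup' Finset.univ_nonempty fun x : U => ans {x}
  pitgLoop (k / ℓ) ℓ (ε / 2 * M / k) (ε / 2) ℓ ∅

end Algorithms

end

/-! The size and value bounds hold pass by pass; only the round and query bounds use the random
orderings.

Approximation. One call of the interlaced subroutine grows `ℓ` disjoint solutions at equal speed. An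
element that no solution uses has gain at most `price` (essentially the previous threshold) over
every solution, while an element taken by solution `l` contributes on average at least `(1 - ε) ^ 2`
times the price of `l`; here `ε` is the halved error. So what `A l` could still gain from the
optimal elements that went to `A h` is paid for by the elements of `A l` itself, up to a shift by
one element, because the solutions are served in turn and thresholds may fall in between. This is
the pair invariant `PairInv`, preserved by every kind of pass (`PairInv.pass`). Summing over all
pairs, and adding the optimal elements left unused, gives `LoopInv.outcome` for every execution: the
total gain of the `ℓ` solutions is, up to lower-order losses, at least `f (G ∪ O)` minus `f G`. By
disjointness a uniformly chosen solution keeps on average at least `(1 - 1/ℓ) * f (G ∪ O)` of the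
value of the union with `O`. Both facts iterate to a recurrence (`pitgLoop_value`) whose solution
after `ℓ` steps is about `1/e`. The conditions on `k` and `ℓ` make the losses (rounding of `k/ℓ`,
the shift by one, the share of elements that are not good, the smallest threshold) at most `ε`,
which the polynomial inequalities of `final_tradeoff` verify.

Complexity. A potential sums over the active solutions the number of threshold steps left, times
about `log n`, plus `1 + log` of the number of candidates. Lowering a threshold drops it by at least
one, which pays for the round. Adding single elements drops it by `1/(2ℓ)`, since some candidate set
has fewer than `2ℓ` elements. Adding a block drops it by `ε/(24ℓ)`, or ends the loop, unless some
random ordering has a prefix with too many misses although few candidates are spoiled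
(`BlockReady.progress`); a supermartingale argument bounds the probability of that by one half, for
all solutions together (`ex_blockViol_le`). Hence `exp (rounds/20)` has expectation at most `exp
(1/20 + μ * potential)` in one call, with `μ` of order `ε⁻²` (`roundMoment_pigLoop_le`). The initial
potential is of order `ε⁻² log n log k`, there are `ℓ = O(ε⁻¹)` calls, and Markov's inequality gives
the bound on the rounds. No round has more than `ℓ(n+1)` queries.

If all singletons have value zero, then `f` vanishes off the empty set, the smallest threshold is
zero, and the algorithm stops at once; this case is treated separately. -/

noncomputable section

open scoped Classical

open OracleAlg

/-! ### Sure bounds, expectations and query counts of oracle algorithms. -/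

namespace OracleAlg

variable {U α β : Type}

/-- Every execution with oracle `f` satisfies `P output rounds queries`. -/
def All (f : Finset U → ℝ) : OracleAlg U α → (α → ℕ → ℕ → Prop) → Prop
  | ret a, P => P a 0 0
  | round Q next, P =>
      All f (next fun S => if S ∈ Q then f S else 0) fun a r q => P a (r + 1) (q + Q.card)
  | sample _ s _ next, P => ∀ b ∈ s, All f (next b) P

/-- The expectation of `φ output rounds queries` when the oracle is `f`. -/
def Ex (f : Finset U → ℝ) : OracleAlg U α → (α → ℕ → ℕ → ℝ) → ℝ
  | ret a, φ => φ a 0 0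
  | round Q next, φ =>
      Ex f (next fun S => if S ∈ Q then f S else 0) fun a r q => φ a (r + 1) (q + Q.card)
  | sample _ s _ next, φ => (∑ b ∈ s, Ex f (next b) φ) / s.card

/-- No round submits more than `B` sets. -/
def QueriesLE (B : ℕ) : OracleAlg U α → Prop
  | ret _ => True
  | round Q next => Q.card ≤ B ∧ ∀ ans, QueriesLE B (next ans)
  | sample _ s _ next => ∀ b ∈ s, QueriesLE B (next b)

variable {f : Finset U → ℝ}

theorem all_bind (a : OracleAlg U α) (g : α → OracleAlg U β) (P : β → ℕ → ℕ → Prop) :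
    All f (a >>= g) P ↔
      All f a fun x r q => All f (g x) fun y r' q' => P y (r' + r) (q' + q) := by
  change All f (a.andThen g) P ↔ _
  induction a generalizing P with
  | ret a => rfl
  | round Q next ih =>
    have h := ih (fun S => if S ∈ Q then f S else 0) fun a r q => P a (r + 1) (q + Q.card)
    simp only [Nat.add_assoc] at h
    exact h
  | sample γ s hs next ih => exact forall₂_congr fun b _ => ih b P

theorem ex_bind (a : OracleAlg U α) (g : α → OracleAlg U β) (φ : β → ℕ → ℕ → ℝ) :
    Ex f (a >>= g) φ =
      Ex f a fun x r q => Ex f (g x) fun y r' q' => φ y (r' + r) (q' + q) := by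
  change Ex f (a.andThen g) φ = _
  induction a generalizing φ with
  | ret a => rfl
  | round Q next ih =>
    have h := ih (fun S => if S ∈ Q then f S else 0) fun a r q => φ a (r + 1) (q + Q.card)
    simp only [Nat.add_assoc] at h
    exact h
  | sample γ s hs next ih =>
    change (∑ b ∈ s, Ex f ((next b).andThen g) φ) / _ = (∑ b ∈ s, Ex f (next b) _) / _
    congr 1
    exact Finset.sum_congr rfl fun b _ => ih b φ

theorem QueriesLE.bind {B : ℕ} {a : OracleAlg U α} {g : α → OracleAlg U β}
    (ha : QueriesLE B a) (hg : ∀ x, QueriesLE B (g x)) : QueriesLE B (a >>= g) := by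
  change QueriesLE B (a.andThen g)
  induction a with
  | ret a => exact hg a
  | round Q next ih => exact ⟨ha.1, fun ans => ih ans (ha.2 ans)⟩
  | sample γ s hs next ih => exact fun b hb => ih b (ha b hb)

@[simp] theorem all_pure (a : α) (P : α → ℕ → ℕ → Prop) :
    All f (pure a : OracleAlg U α) P ↔ P a 0 0 := Iff.rfl

@[simp] theorem ex_pure (a : α) (φ : α → ℕ → ℕ → ℝ) :
    Ex f (pure a : OracleAlg U α) φ = φ a 0 0 := rfl

theorem queriesLE_pure (B : ℕ) (a : α) : QueriesLE B (pure a : OracleAlg U α) := trivial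

theorem all_ask_bind (Q : Finset (Finset U)) (g : (Finset U → ℝ) → OracleAlg U β)
    (P : β → ℕ → ℕ → Prop) :
    All f (ask Q >>= g) P ↔
      All f (g fun S => if S ∈ Q then f S else 0) fun y r q => P y (r + 1) (q + Q.card) := by
  rw [all_bind]
  change All f (g _) _ ↔ _
  simp only [Nat.zero_add]

theorem ex_ask_bind (Q : Finset (Finset U)) (g : (Finset U → ℝ) → OracleAlg U β)
    (φ : β → ℕ → ℕ → ℝ) :
    Ex f (ask Q >>= g) φ =
      Ex f (g fun S => if S ∈ Q then f S else 0) fun y r q => φ y (r + 1) (q + Q.card) := by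
  rw [ex_bind]
  change Ex f (g _) _ = _
  simp only [Nat.zero_add]

theorem queriesLE_ask {B : ℕ} {Q : Finset (Finset U)} (h : Q.card ≤ B) :
    QueriesLE B (ask Q) := ⟨h, fun _ => trivial⟩

theorem queriesLE_pick (B : ℕ) (s : Finset β) (d : β) :
    QueriesLE B (pick s d : OracleAlg U β) := by
  unfold pick
  split
  · exact fun b _ => trivial
  · trivial

theorem all_pick {s : Finset β} (hs : s.Nonempty) (d : β) (P : β → ℕ → ℕ → Prop) :
    All f (pick s d) P ↔ ∀ b ∈ s, P b 0 0 := by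
  unfold pick
  rw [dif_pos hs]
  rfl

theorem ex_pick {s : Finset β} (hs : s.Nonempty) (d : β) (φ : β → ℕ → ℕ → ℝ) :
    Ex f (pick s d) φ = (∑ b ∈ s, φ b 0 0) / s.card := by
  unfold pick
  rw [dif_pos hs]
  rfl

theorem All.mono {a : OracleAlg U α} {P Q : α → ℕ → ℕ → Prop} (h : All f a P)
    (hPQ : ∀ x r q, P x r q → Q x r q) : All f a Q := by
  induction a generalizing P Q with
  | ret a => exact hPQ _ _ _ h
  | round S next ih => exact ih _ h fun x r q => hPQ _ _ _
  | sample γ s hs next ih => exact fun b hb => ih b (h b hb) hPQ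

theorem All.and {a : OracleAlg U α} {P Q : α → ℕ → ℕ → Prop} (h : All f a P) (h' : All f a Q) :
    All f a fun x r q => P x r q ∧ Q x r q := by
  induction a generalizing P Q with
  | ret a => exact ⟨h, h'⟩
  | round S next ih => exact ih _ h h'
  | sample γ s hs next ih => exact fun b hb => ih b (h b hb) (h' b hb)

theorem all_of_forall {P : α → ℕ → ℕ → Prop} (h : ∀ x r q, P x r q) (a : OracleAlg U α) :
    All f a P := by
  induction a generalizing P with
  | ret a => exact h _ _ _
  | round S next ih => exact ih _ fun x r q => h _ _ _
  | sample γ s hs next ih => exact fun b _ => ih b h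

/-- Reduces the query bound to the round bound: only the number of rounds needs probability. -/
theorem QueriesLE.all {B : ℕ} {a : OracleAlg U α} (h : QueriesLE B a) :
    All f a fun _ r q => q ≤ r * B := by
  induction a with
  | ret a => exact Nat.zero_le _
  | round Q next ih =>
    refine (ih _ (h.2 _)).mono fun x r q hq => ?_
    have := h.1
    change q + Q.card ≤ (r + 1) * B
    rw [Nat.add_mul, Nat.one_mul]
    exact Nat.add_le_add hq this
  | sample γ s hs next ih => exact fun b hb => ih b (h b hb)

theorem ex_le_ex {a : OracleAlg U α} {φ ψ : α → ℕ → ℕ → ℝ}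
    (h : All f a fun x r q => φ x r q ≤ ψ x r q) : Ex f a φ ≤ Ex f a ψ := by
  induction a generalizing φ ψ with
  | ret a => exact h
  | round S next ih => exact ih _ h
  | sample γ s hs next ih =>
    change (∑ b ∈ s, Ex f (next b) _) / _ ≤ (∑ b ∈ s, Ex f (next b) _) / _
    gcongr with b hb
    exact ih b (h b hb)

theorem ex_const (a : OracleAlg U α) (c : ℝ) : Ex f a (fun _ _ _ => c) = c := by
  induction a with
  | ret a => rfl
  | round S next ih => exact ih _
  | sample γ s hs next ih =>
    change (∑ b ∈ s, Ex f (next b) _) / _ = c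
    have : (s.card : ℝ) ≠ 0 := by exact_mod_cast hs.card_pos.ne'
    rw [Finset.sum_congr rfl fun b _ => ih b, Finset.sum_const, nsmul_eq_mul]
    field_simp

theorem ex_mul_left (a : OracleAlg U α) (c : ℝ) (φ : α → ℕ → ℕ → ℝ) :
    Ex f a (fun x r q => c * φ x r q) = c * Ex f a φ := by
  induction a generalizing φ with
  | ret a => rfl
  | round S next ih => exact ih _ _
  | sample γ s hs next ih =>
    change (∑ b ∈ s, Ex f (next b) _) / _ = c * ((∑ b ∈ s, Ex f (next b) _) / _)
    rw [Finset.sum_congr rfl fun b _ => ih b φ, ← Finset.mul_sum, mul_div_assoc]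

theorem ex_add (a : OracleAlg U α) (φ ψ : α → ℕ → ℕ → ℝ) :
    Ex f a (fun x r q => φ x r q + ψ x r q) = Ex f a φ + Ex f a ψ := by
  induction a generalizing φ ψ with
  | ret a => rfl
  | round S next ih => exact ih _ _ _
  | sample γ s hs next ih =>
    change (∑ b ∈ s, Ex f (next b) _) / _ =
      (∑ b ∈ s, Ex f (next b) _) / _ + (∑ b ∈ s, Ex f (next b) _) / _
    rw [Finset.sum_congr rfl fun b _ => ih b φ ψ, Finset.sum_add_distrib, add_div]

theorem ex_sum {ι : Type} (t : Finset ι) (a : OracleAlg U α) (φ : ι → α → ℕ → ℕ → ℝ) :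
    Ex f a (fun x r q => ∑ i ∈ t, φ i x r q) = ∑ i ∈ t, Ex f a (φ i) := by
  induction t using Finset.induction_on with
  | empty => simpa using ex_const (f := f) a 0
  | insert i t hi ih => simp only [Finset.sum_insert hi, ex_add, ih]

theorem le_ex {a : OracleAlg U α} {φ : α → ℕ → ℕ → ℝ} {c : ℝ}
    (h : All f a fun x r q => c ≤ φ x r q) : c ≤ Ex f a φ := by
  simpa [ex_const] using ex_le_ex (φ := fun _ _ _ => c) h

theorem ex_le {a : OracleAlg U α} {φ : α → ℕ → ℕ → ℝ} {c : ℝ}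
    (h : All f a fun x r q => φ x r q ≤ c) : Ex f a φ ≤ c := by
  simpa [ex_const] using ex_le_ex (ψ := fun _ _ _ => c) h

theorem All.support {a : OracleAlg U α} {P : α → ℕ → ℕ → Prop} (h : All f a P) :
    ∀ o ∈ (a.run f).support, P o.output o.rounds o.queries := by
  induction a generalizing P with
  | ret a =>
    intro o ho
    have : o = ⟨a, 0, 0⟩ := by simpa [run] using ho
    subst this
    exact h
  | round Q next ih =>
    intro o ho
    simp only [run, PMF.support_map, Set.mem_image] at ho
    obtain ⟨o', ho', rfl⟩ := ho
    exact ih _ h o' ho'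
  | sample γ s hs next ih =>
    intro o ho
    simp only [run, PMF.mem_support_bind_iff, PMF.mem_support_uniformOfFinset_iff] at ho
    obtain ⟨b, hb, hob⟩ := ho
    exact ih b (h b hb) o hob

/-- The bridge from the law of an execution to the finite averages of `Ex`: at a sample node the
infinite sum is supported on `s`, where the weights are `1 / s.card`. -/
theorem prob_eq_ex (a : OracleAlg U α) (E : Set (Outcome α)) :
    a.prob f E = Ex f a fun x r q => if (⟨x, r, q⟩ : Outcome α) ∈ E then 1 else 0 := by
  unfold prob
  induction a generalizing E with
  | ret a =>
    simp only [run, PMF.toOuterMeasure_pure_apply, Ex]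
    split <;> simp
  | round Q next ih =>
    simp only [run, PMF.toOuterMeasure_map_apply, Ex]
    rw [ih]
    rfl
  | sample γ s hs next ih =>
    simp only [run, PMF.toOuterMeasure_bind_apply, Ex]
    rw [tsum_eq_sum (s := s) (fun b hb => by
      rw [PMF.uniformOfFinset_apply_of_notMem hs hb, zero_mul])]
    rw [ENNReal.toReal_sum, Finset.sum_div]
    · refine Finset.sum_congr rfl fun b hb => ?_
      rw [ENNReal.toReal_mul, ih b E, PMF.uniformOfFinset_apply_of_mem hs hb, ENNReal.toReal_inv,
        ENNReal.toReal_natCast, div_eq_inv_mul]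
    · intro b hb
      refine ENNReal.mul_ne_top (PMF.apply_ne_top _ _) ?_
      exact ne_top_of_le_ne_top ENNReal.one_ne_top
        (by
          rw [← ((PMF.toOuterMeasure_apply_eq_one_iff (run f (next b)) Set.univ).2
            (Set.subset_univ _))]
          exact MeasureTheory.measure_mono (Set.subset_univ _))

theorem expectedValue_eq_ex [Fintype U] (a : OracleAlg U (Finset U)) :
    a.expectedValue f = Ex f a fun G _ _ => f G := by
  unfold expectedValue
  have h : ∀ G : Finset U, (((a.run f).map Outcome.output) G).toReal =
      a.prob f {o | o.output = G} := fun G => by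
    unfold prob
    rw [← PMF.toOuterMeasure_apply_singleton, PMF.toOuterMeasure_map_apply]
    rfl
  simp only [h, prob_eq_ex]
  rw [Finset.sum_congr rfl fun G _ => (mul_comm _ _).trans (ex_mul_left a (f G) _).symm, ← ex_sum]
  congr 1
  funext x r q
  simp

end OracleAlg

/-! ### Marginal gains of submodular functions that need not be monotone. -/

section SetFunctions

variable {U : Type} {f : Finset U → ℝ}

/-- The marginal gain of `x` over `B`. -/
def gain (f : Finset U → ℝ) (x : U) (B : Finset U) : ℝ := f (insert x B) - f B

theorem gain_of_mem {x : U} {B : Finset U} (h : x ∈ B) : gain f x B = 0 := by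
  simp [gain, Finset.insert_eq_of_mem h]

/-- The side condition excludes `x ∈ C \ B`, where the gain over `C` is zero but the gain over `B`
may be negative. -/
theorem IsSubmodular.gain_anti (hf : IsSubmodular f) {x : U} {B C : Finset U} (hBC : B ⊆ C)
    (hx : x ∈ B ∨ x ∉ C) : gain f x C ≤ gain f x B := by
  rcases hx with hx | hx
  · rw [gain_of_mem hx, gain_of_mem (hBC hx)]
  · have h := hf (insert x B) C
    have h1 : insert x B ∪ C = insert x C := by
      rw [Finset.insert_union, Finset.union_eq_right.2 hBC]
    have h2 : insert x B ∩ C = B := by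
      rw [Finset.insert_inter_of_notMem hx, Finset.inter_eq_left.2 hBC]
    rw [h1, h2] at h
    unfold gain
    linarith

/-- A positive gain over `C` forces `x ∉ C`, so positive thresholds make the side condition of
`gain_anti` automatic. -/
theorem IsSubmodular.le_gain_of_le (hf : IsSubmodular f) {x : U} {B C : Finset U} (hBC : B ⊆ C)
    {τ : ℝ} (hτ : 0 < τ) (h : τ ≤ gain f x C) : τ ≤ gain f x B := by
  refine h.trans (hf.gain_anti hBC (Or.inr fun hx => ?_))
  rw [gain_of_mem hx] at h
  linarith

theorem IsSubmodular.union_sub_le_card_mul (hf : IsSubmodular f) {B C : Finset U} (hBC : B ⊆ C)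
    {θ : ℝ} (hθ : 0 ≤ θ) (N : Finset U) (hN : ∀ x ∈ N, gain f x B ≤ θ) :
    f (C ∪ N) - f C ≤ N.card * θ := by
  induction N using Finset.induction_on with
  | empty => simp
  | insert x N hx ih =>
    have ih := ih fun y hy => hN y (Finset.mem_insert_of_mem hy)
    have h : gain f x (C ∪ N) ≤ θ := by
      by_cases hxC : x ∈ C ∪ N
      · rw [gain_of_mem hxC]; exact hθ
      · exact (hf.gain_anti (hBC.trans Finset.subset_union_left) (Or.inr hxC)).trans
          (hN x (Finset.mem_insert_self _ _))
    rw [Finset.union_insert, Finset.card_insert_of_notMem hx]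
    unfold gain at h
    push_cast
    linarith

theorem IsSubmodular.union_sub_anti (hf : IsSubmodular f) {B C N : Finset U} (hBC : B ⊆ C)
    (hN : N ∩ C ⊆ B) : f (C ∪ N) - f C ≤ f (B ∪ N) - f B := by
  have h := hf (B ∪ N) C
  have h1 : B ∪ N ∪ C = C ∪ N := by
    rw [Finset.union_right_comm, Finset.union_eq_right.2 hBC]
  have h2 : (B ∪ N) ∩ C = B := by
    rw [Finset.union_inter_distrib_right, Finset.inter_eq_left.2 hBC]
    exact Finset.union_eq_left.2 hN
  rw [h1, h2] at h
  linarith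

/-- Pairwise disjoint extensions of `X` lose at most one copy of `f X` in total. -/
theorem IsSubmodular.sum_union_disjoint (hf : IsSubmodular f) (hf0 : ∀ S, 0 ≤ f S)
    {ι : Type} (X : Finset U) (A : ι → Finset U) (s : Finset ι)
    (hA : ∀ i ∈ s, ∀ j ∈ s, i ≠ j → Disjoint (A i) (A j)) :
    ((s.card : ℝ) - 1) * f X ≤ ∑ i ∈ s, f (X ∪ A i) := by
  -- The induction keeps the value of the whole union on the left. A new extension and the previous
  -- union meet exactly in `X` by disjointness, so submodularity contributes one copy of `f X`;
  -- nonnegativity discards the union at the end.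
  have key : (s.card : ℝ) * f X + f (X ∪ s.biUnion A) ≤ ∑ i ∈ s, f (X ∪ A i) + f X := by
    induction s using Finset.induction_on with
    | empty => simp
    | insert i s hi ih =>
      have ih := ih fun a ha b hb =>
        hA a (Finset.mem_insert_of_mem ha) b (Finset.mem_insert_of_mem hb)
      have h := hf (X ∪ A i) (X ∪ s.biUnion A)
      have hd : Disjoint (A i) (s.biUnion A) := by
        rw [Finset.disjoint_biUnion_right]
        intro j hj
        exact hA i (Finset.mem_insert_self _ _) j (Finset.mem_insert_of_mem hj)
          (by rintro rfl; exact hi hj)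
      have h1 : (X ∪ A i) ∪ (X ∪ s.biUnion A) = X ∪ (insert i s).biUnion A := by
        rw [Finset.biUnion_insert]
        ext; simp only [Finset.mem_union]; tauto
      have h2 : (X ∪ A i) ∩ (X ∪ s.biUnion A) = X := by
        rw [← Finset.union_inter_distrib_left, Finset.disjoint_iff_inter_eq_empty.1 hd,
          Finset.union_empty]
      rw [h1, h2] at h
      rw [Finset.sum_insert hi, Finset.card_insert_of_notMem hi]
      push_cast
      linarith
  have := hf0 (X ∪ s.biUnion A)
  linarith

end SetFunctions

/-! ### Counting threshold steps, and the logarithmic potential of a candidate set. -/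

section Thresholds

theorem stepsBelow_of_lt {τmin ε τ : ℝ} (h : τ < τmin) : stepsBelow τmin ε τ = 0 := by
  unfold stepsBelow
  exact Nat.sInf_eq_zero.2 (Or.inl (by simpa using h))

theorem exists_stepsBelow {τmin ε : ℝ} (hm : 0 < τmin) (h0 : 0 < ε) (τ : ℝ) :
    ∃ i : ℕ, (1 - ε) ^ i * τ < τmin := by
  rcases le_or_gt τ 0 with h | h
  · exact ⟨0, by simp; linarith⟩
  · obtain ⟨i, hi⟩ := exists_pow_lt_of_lt_one (div_pos hm h) (by linarith : 1 - ε < 1)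
    exact ⟨i, (lt_div_iff₀ h).1 hi⟩

theorem stepsBelow_succ {τmin ε τ : ℝ} (hm : 0 < τmin) (h0 : 0 < ε)
    (h : τmin ≤ τ) : stepsBelow τmin ε τ = stepsBelow τmin ε ((1 - ε) * τ) + 1 := by
  unfold stepsBelow
  have hne : {i : ℕ | (1 - ε) ^ i * τ < τmin}.Nonempty := exists_stepsBelow hm h0 τ
  have hpos : 1 ≤ sInf {i : ℕ | (1 - ε) ^ i * τ < τmin} := by
    rw [Nat.one_le_iff_ne_zero]
    intro h0
    rcases Nat.sInf_eq_zero.1 h0 with h' | h'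
    · simp at h'; linarith
    · exact hne.ne_empty h'
  rw [← Nat.sInf_add (p := fun i => (1 - ε) ^ i * τ < τmin) hpos]
  congr 2
  ext i
  simp only [Set.mem_ofPred_eq, pow_succ, mul_assoc]

theorem stepsBelow_eq_zero {τmin ε τ : ℝ} (hm : 0 < τmin) (h0 : 0 < ε)
    (h : stepsBelow τmin ε τ = 0) : τ < τmin := by
  by_contra hc
  rw [stepsBelow_succ hm h0 (not_lt.1 hc)] at h
  omega

/-- The potential of a candidate set of size `N`. -/
def pot (N : ℕ) : ℝ := if N = 0 then 0 else 1 + Real.log N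

theorem pot_nonneg (N : ℕ) : 0 ≤ pot N := by
  unfold pot
  split
  · exact le_rfl
  · have := Real.log_natCast_nonneg N
    linarith

theorem one_le_pot {N : ℕ} (h : 0 < N) : 1 ≤ pot N := by
  unfold pot
  rw [if_neg h.ne']
  have := Real.log_natCast_nonneg N
  linarith

/-- This is `log t ≤ t - 1` at `t = N'/N`. The summand `1` in `pot` is what makes it true for `N' =
0`. -/
theorem pot_add_le {N N' : ℕ} {d : ℝ} (hN : 0 < N) (h : N' + d ≤ N) :
    pot N' + d / N ≤ pot N := by
  have hNr : (0 : ℝ) < N := by exact_mod_cast hN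
  have hd : d / N ≤ 1 - N' / N := by
    rw [div_le_iff₀ hNr, sub_mul, div_mul_cancel₀ _ hNr.ne']
    linarith
  rcases Nat.eq_zero_or_pos N' with rfl | hN'
  · have := one_le_pot hN
    have h0 : pot 0 = 0 := by simp [pot]
    rw [h0]
    simp at hd
    linarith
  · have hNr' : (0 : ℝ) < N' := by exact_mod_cast hN'
    unfold pot
    rw [if_neg hN.ne', if_neg hN'.ne']
    have := Real.log_le_sub_one_of_pos (div_pos hNr' hNr)
    rw [Real.log_div hNr'.ne' hNr.ne'] at this
    linarith

theorem pot_mono {N N' : ℕ} (h : N' ≤ N) : pot N' ≤ pot N := by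
  rcases Nat.eq_zero_or_pos N with rfl | hN
  · rw [Nat.le_zero.1 h]
  · have := pot_add_le (N' := N') (d := 0) hN (by simpa using h)
    simpa using this

end Thresholds

/-! ### The update procedure pays for its rounds with potential. -/

section Update

variable {U : Type} {ℓ : ℕ} {f : Finset U → ℝ}

theorem keep_restrict (Q : Finset (Finset U)) {B X : Finset U} (h : gainQueries B X ⊆ Q) (τ : ℝ) :
    keep (fun S => if S ∈ Q then f S else 0) B X τ = keep f B X τ := by
  unfold keep
  refine Finset.filter_congr fun x hx => ?_
  beta_reduce
  rw [if_pos (h (Finset.mem_insert_self _ _)),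
    if_pos (h (Finset.mem_insert_of_mem (Finset.mem_image_of_mem _ hx)))]

theorem mem_used {A : Fin ℓ → Finset U} {x : U} : x ∈ used A ↔ ∃ j, x ∈ A j := by
  simp [used]

theorem subset_used (A : Fin ℓ → Finset U) (j : Fin ℓ) : A j ⊆ used A := fun _ hx =>
  mem_used.2 ⟨j, hx⟩

theorem used_mono {A B : Fin ℓ → Finset U} (h : ∀ j, A j ⊆ B j) : used A ⊆ used B := fun x hx => by
  obtain ⟨j, hj⟩ := mem_used.1 hx
  exact mem_used.2 ⟨j, h j hj⟩

variable [Fintype U]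

/-- The unused elements whose marginal gain over `G ∪ A j` is at least `τ`. -/
def cand (f : Finset U → ℝ) (G : Finset U) (A : Fin ℓ → Finset U) (j : Fin ℓ) (τ : ℝ) :
    Finset U :=
  keep f (G ∪ A j) (Finset.univ \ used A) τ

theorem mem_cand {G : Finset U} {A : Fin ℓ → Finset U} {j : Fin ℓ} {τ : ℝ} {x : U} :
    x ∈ cand f G A j τ ↔ x ∉ used A ∧ τ ≤ gain f x (G ∪ A j) := by
  simp [cand, keep, gain]

theorem card_biUnion_gainQueries_le (J : Finset (Fin ℓ)) (B X : Fin ℓ → Finset U) :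
    (J.biUnion fun j => gainQueries (B j) (X j)).card ≤ ℓ * (Fintype.card U + 1) := by
  refine (Finset.card_biUnion_le_card_mul J _ (Fintype.card U + 1) fun j _ => ?_).trans ?_
  · refine (Finset.card_insert_le _ _).trans ?_
    have := (Finset.card_image_le (s := X j) (f := fun x => insert x (B j))).trans
      (Finset.card_le_univ (X j))
    omega
  · exact Nat.mul_le_mul_right _ ((Finset.card_le_univ J).trans_eq (Fintype.card_fin ℓ))

/-- The contribution of a solution to the potential that bounds the number of rounds. -/
def weight (f : Finset U → ℝ) (G : Finset U) (τmin ε : ℝ) (A : Fin ℓ → Finset U) (j : Fin ℓ)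
    (τ : ℝ) : ℝ :=
  stepsBelow τmin ε τ * (Real.log (Fintype.card U) + 2) + pot (cand f G A j τ).card

theorem log_card_nonneg : 0 ≤ Real.log (Fintype.card U) := Real.log_natCast_nonneg _

theorem pot_card_le (S : Finset U) : pot S.card ≤ Real.log (Fintype.card U) + 1 := by
  refine (pot_mono (Finset.card_le_univ S)).trans ?_
  have := log_card_nonneg (U := U)
  unfold pot
  split
  · linarith
  · linarith

theorem weight_nonneg (G : Finset U) (τmin ε : ℝ) (A : Fin ℓ → Finset U) (j : Fin ℓ) (τ : ℝ) :
    0 ≤ weight f G τmin ε A j τ := by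
  have := log_card_nonneg (U := U)
  have := pot_nonneg (cand f G A j τ).card
  unfold weight
  positivity

/-- The reason for the factor `log n + 2` in `weight`: a threshold step releases that much,
refilling an empty candidate set costs at most `log n + 1`, and one unit is left for the round. -/
theorem weight_lower {G : Finset U} {τmin ε : ℝ} {A : Fin ℓ → Finset U} {j : Fin ℓ} {τ : ℝ}
    (hm : 0 < τmin) (h0 : 0 < ε) (h : τmin ≤ τ) (hc : cand f G A j τ = ∅) :
    weight f G τmin ε A j ((1 - ε) * τ) + 1 ≤ weight f G τmin ε A j τ := by
  unfold weight
  rw [stepsBelow_succ hm h0 h, hc]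
  have := pot_card_le (cand f G A j ((1 - ε) * τ))
  simp only [Finset.card_empty]
  have h0 : pot 0 = 0 := by simp [pot]
  rw [h0]
  push_cast
  linarith

/-- `τ'` arises from `τ` by the while loop of `Update`. -/
def Lowered (f : Finset U → ℝ) (G : Finset U) (ε : ℝ) (A : Fin ℓ → Finset U) (j : Fin ℓ)
    (τ τ' : ℝ) : Prop :=
  τ' ≤ τ ∧ (τ' = τ ∨ ∀ x ∉ used A, gain f x (G ∪ A j) < τ' / (1 - ε))

/-- A pass takes one round, however many indices it lowers, and `weight_lower` at a single index of
`E` pays for it. The hypothesis `hn` ensures that the bound on the number of passes never stops a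
loop early. -/
theorem lowerLoop_spec {G : Finset U} {τmin ε : ℝ} (hm : 0 < τmin) (h0 : 0 < ε) (h1 : ε < 1)
    (J : Finset (Fin ℓ)) (A : Fin ℓ → Finset U) (n : ℕ) (V : Fin ℓ → Finset U) (τ : Fin ℓ → ℝ)
    (hV : ∀ j ∈ J, V j = cand f G A j (τ j)) 
    (hn : ∀ j ∈ J, V j = ∅ → stepsBelow τmin ε (τ j) ≤ n) :
    All f (lowerLoop G τmin ε J A n (V, τ)) fun p r _ =>
      (∀ j ∉ J, p.1 j = V j ∧ p.2 j = τ j) ∧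
      (∀ j ∈ J, p.1 j = cand f G A j (p.2 j) ∧ (p.1 j ≠ ∅ ∨ p.2 j < τmin) ∧
        Lowered f G ε A j (τ j) (p.2 j) ∧
        weight f G τmin ε A j (p.2 j) ≤ weight f G τmin ε A j (τ j)) ∧
      r + ∑ j ∈ J, weight f G τmin ε A j (p.2 j) ≤ ∑ j ∈ J, weight f G τmin ε A j (τ j) := by
  induction n generalizing V τ with
  | zero =>
    refine ⟨fun j _ => ⟨rfl, rfl⟩, fun j hj => ⟨hV j hj, ?_, ⟨le_rfl, Or.inl rfl⟩, le_rfl⟩,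
      by simp⟩
    rcases eq_or_ne (V j) ∅ with hv | hv
    · exact Or.inr (stepsBelow_eq_zero hm h0 (Nat.le_zero.1 (hn j hj hv)))
    · exact Or.inl hv
  | succ n ih =>
    rw [lowerLoop]
    set E := J.filter fun j => V j = ∅ ∧ τmin ≤ τ j with hE
    by_cases hEe : E = ∅
    · simp only [hEe, if_true]
      refine ⟨fun j _ => ⟨rfl, rfl⟩, fun j hj => ⟨hV j hj, ?_, ⟨le_rfl, Or.inl rfl⟩, le_rfl⟩,
        by simp⟩
      by_contra hc
      push Not at hc
      have : j ∈ E := Finset.mem_filter.2 ⟨hj, hc.1, hc.2⟩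
      rw [hEe] at this
      simp at this
    · simp only [hEe, if_false]
      rw [all_ask_bind]
      set Q := E.biUnion fun j => gainQueries (G ∪ A j) (Finset.univ \ used A)
      have hk : ∀ j ∈ E, ∀ t, keep (fun S => if S ∈ Q then f S else 0) (G ∪ A j)
          (Finset.univ \ used A) t = cand f G A j t := fun j hj t =>
        keep_restrict Q (Finset.subset_biUnion_of_mem
          (fun j => gainQueries (G ∪ A j) (Finset.univ \ used A)) hj) t
      have hEJ : E ⊆ J := Finset.filter_subset _ _
      have hEp : ∀ j ∈ E, cand f G A j (τ j) = ∅ ∧ τmin ≤ τ j := fun j hj => by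
        obtain ⟨hjJ, h2, h3⟩ := Finset.mem_filter.1 hj
        exact ⟨by rw [← hV j hjJ, h2], h3⟩
      set τ' : Fin ℓ → ℝ := fun j => if j ∈ E then (1 - ε) * τ j else τ j with hτ'
      have hw : ∀ j ∈ J, weight f G τmin ε A j (τ' j) + (if j ∈ E then 1 else 0) ≤
          weight f G τmin ε A j (τ j) := fun j _ => by
        by_cases hj : j ∈ E
        · simp only [hτ', hj, if_true]
          exact weight_lower hm h0 (hEp j hj).2 (hEp j hj).1
        · simp only [hτ', hj, if_false]; linarith
      have hlow : ∀ j ∈ J, Lowered f G ε A j (τ j) (τ' j) := fun j _ => by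
        by_cases hj : j ∈ E
        · simp only [hτ', hj, if_true]
          have hp := hEp j hj
          -- Dividing the new threshold by `1 - ε` returns the old one, at which there was no
          -- candidate at all.
          refine ⟨by nlinarith, Or.inr fun x hx => ?_⟩
          rw [mul_div_cancel_left₀ _ (by linarith : (1 - ε) ≠ 0)]
          by_contra hc
          have : x ∈ cand f G A j (τ j) := mem_cand.2 ⟨hx, not_lt.1 hc⟩
          rw [hp.1] at this
          simp at this
        · simp only [hτ', hj, if_false]
          exact ⟨le_rfl, Or.inl rfl⟩
      refine (ih _ τ' ?_ ?_).mono ?_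
      · intro j hj
        by_cases hjE : j ∈ E
        · simp only [hjE, if_true]
          rw [hk j hjE]
          simp only [hτ', hjE, if_true]
        · simp only [hjE, if_false, hτ', hV j hj]
      · intro j hj hv
        by_cases hjE : j ∈ E
        · have := stepsBelow_succ hm h0 (hEp j hjE).2
          have := hn j hj (by rw [hV j hj, (hEp j hjE).1])
          simp only [hτ', hjE, if_true]
          omega
        · simp only [hjE, if_false] at hv
          have : τ j < τmin := by
            by_contra hc
            exact hjE (Finset.mem_filter.2 ⟨hj, hv, not_lt.1 hc⟩)
          simp only [hτ', hjE, if_false, stepsBelow_of_lt this]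
          omega
      · rintro ⟨V₂, τ₂⟩ r q ⟨hout, hin, hsum⟩
        refine ⟨fun j hj => ?_, fun j hj => ?_, ?_⟩
        · have hjE : j ∉ E := fun h => hj (hEJ h)
          obtain ⟨h2, h3⟩ := hout j hj
          refine ⟨by rw [h2, if_neg hjE], by rw [h3]; simp only [hτ', hjE, if_false]⟩
        · obtain ⟨h2, h3, h4, h5⟩ := hin j hj
          refine ⟨h2, h3, ⟨h4.1.trans (hlow j hj).1, ?_⟩, h5.trans ?_⟩
          · rcases h4.2 with h6 | h6
            · rw [h6]; exact (hlow j hj).2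
            · exact Or.inr h6
          · have := hw j hj
            split at this <;> linarith
        · have h6 := Finset.sum_le_sum hw
          rw [Finset.sum_add_distrib] at h6
          have h7 : (1 : ℝ) ≤ ∑ j ∈ J, if j ∈ E then (1 : ℝ) else 0 := by
            obtain ⟨j, hj⟩ := Finset.nonempty_iff_ne_empty.2 hEe
            refine le_trans ?_ (Finset.single_le_sum (f := fun j => if j ∈ E then (1 : ℝ) else 0)
              (fun i _ => by split <;> norm_num) (hEJ hj))
            simp [hj]
          push_cast
          linarith

/-- The additional `1` is the filtering round. The sets `V j` may be outdated; it suffices that they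
contain the current candidates, because gains only shrink as solutions grow. -/
theorem update_spec {G : Finset U} {τmin ε : ℝ} (hm : 0 < τmin) (h0 : 0 < ε) (h1 : ε < 1)
    (J : Finset (Fin ℓ)) (A V : Fin ℓ → Finset U) (τ : Fin ℓ → ℝ)
    (hV : ∀ j ∈ J, cand f G A j (τ j) ⊆ V j) :
    All f (update G τmin ε J A V τ) fun p r _ =>
      (∀ j ∉ J, p.1 j = V j ∧ p.2 j = τ j) ∧
      (∀ j ∈ J, p.1 j = cand f G A j (p.2 j) ∧ (p.1 j ≠ ∅ ∨ p.2 j < τmin) ∧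
        Lowered f G ε A j (τ j) (p.2 j) ∧
        weight f G τmin ε A j (p.2 j) ≤ weight f G τmin ε A j (τ j)) ∧
      r + ∑ j ∈ J, weight f G τmin ε A j (p.2 j) ≤
        1 + ∑ j ∈ J, weight f G τmin ε A j (τ j) := by
  unfold update
  rw [all_ask_bind]
  set Q := J.biUnion fun j => gainQueries (G ∪ A j) (V j \ used A)
  have hk : ∀ j ∈ J, keep (fun S => if S ∈ Q then f S else 0) (G ∪ A j)
      (V j \ used A) (τ j) = cand f G A j (τ j) := fun j hj => by
    rw [keep_restrict Q (Finset.subset_biUnion_of_mem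
      (fun j => gainQueries (G ∪ A j) (V j \ used A)) hj)]
    ext x
    have := @hV j hj x
    rw [mem_cand] at this ⊢
    simp only [keep, Finset.mem_filter, Finset.mem_sdiff, gain] at this ⊢
    tauto
  refine (lowerLoop_spec hm h0 h1 J A _ _ τ ?_ ?_).mono ?_
  · intro j hj
    simp only [hj, if_true]
    exact hk j hj
  · intro j hj _
    exact Finset.le_sup (f := fun j => stepsBelow τmin ε (τ j)) hj
  · rintro ⟨V₂, τ₂⟩ r q ⟨hout, hin, hsum⟩
    refine ⟨fun j hj => ?_, hin, ?_⟩
    · obtain ⟨h2, h3⟩ := hout j hj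
      exact ⟨by rw [h2, if_neg hj], h3⟩
    · push_cast
      linarith

theorem queriesLE_lowerLoop (G : Finset U) (τmin ε : ℝ) (J : Finset (Fin ℓ))
    (A : Fin ℓ → Finset U) (n : ℕ) (p : (Fin ℓ → Finset U) × (Fin ℓ → ℝ)) :
    QueriesLE (ℓ * (Fintype.card U + 1)) (lowerLoop G τmin ε J A n p) := by
  induction n generalizing p with
  | zero => exact queriesLE_pure _ _
  | succ n ih =>
    obtain ⟨V, τ⟩ := p
    rw [lowerLoop]
    dsimp only
    split
    · exact queriesLE_pure _ _
    · refine (queriesLE_ask ?_).bind fun ans => ih _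
      exact card_biUnion_gainQueries_le _ _ _

theorem queriesLE_update (G : Finset U) (τmin ε : ℝ) (J : Finset (Fin ℓ))
    (A V : Fin ℓ → Finset U) (τ : Fin ℓ → ℝ) :
    QueriesLE (ℓ * (Fintype.card U + 1)) (update G τmin ε J A V τ) := by
  unfold update
  refine (queriesLE_ask ?_).bind fun ans => queriesLE_lowerLoop _ _ _ _ _ _ _
  exact card_biUnion_gainQueries_le _ _ _

end Update

/-! ### Invariants of a state of the subroutine. -/

section Invariants

variable {U : Type} {ℓ : ℕ} {f : Finset U → ℝ} [Fintype U]

/-- An upper bound for the marginal gains of the unused elements, in terms of the threshold. -/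
def price (τmin ε τ : ℝ) : ℝ := max τ τmin / (1 - ε)

theorem price_nonneg {τmin ε τ : ℝ} (hm : 0 < τmin) (h1 : ε < 1) : 0 ≤ price τmin ε τ :=
  div_nonneg (hm.le.trans (le_max_right _ _)) (by linarith)

theorem price_mono {τmin ε τ τ' : ℝ} (h1 : ε < 1) (h : τ' ≤ τ) :
    price τmin ε τ' ≤ price τmin ε τ :=
  div_le_div_of_nonneg_right (max_le_max_right _ h) (by linarith)

theorem price_of_le {τmin ε τ : ℝ} (h : τmin ≤ τ) : price τmin ε τ = τ / (1 - ε) := by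
  rw [price, max_eq_left h]

theorem price_of_lt {τmin ε τ : ℝ} (h : τ < τmin) : price τmin ε τ = τmin / (1 - ε) := by
  rw [price, max_eq_right h.le]

/-- The properties of a state that hold throughout an execution. -/
structure PIGInv (f : Finset U → ℝ) (G : Finset U) (τmin ε : ℝ) (st : PIGState U ℓ) : Prop where
  disj : ∀ i j, i ≠ j → Disjoint (st.A i) (st.A j)
  sub : ∀ j, st.A' j ⊆ st.A j
  le : ∀ j, f (G ∪ st.A j) ≤ f (G ∪ st.A' j)
  avail : ∀ j, ∀ x ∉ used st.A, gain f x (G ∪ st.A j) ≤ price τmin ε (st.τ j)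
  vsup : ∀ j, cand f G st.A j (st.τ j) ⊆ st.V j
  inactive : ∀ j ∉ st.I, st.τ j < τmin

theorem cand_anti (hf : IsSubmodular f) {G : Finset U} {A B : Fin ℓ → Finset U}
    (h : ∀ j, A j ⊆ B j) (j : Fin ℓ) (τ : ℝ) : cand f G B j τ ⊆ cand f G A j τ := by
  intro x hx
  rw [mem_cand] at hx ⊢
  have hxA : x ∉ used A := fun hc => hx.1 (used_mono h hc)
  refine ⟨hxA, hx.2.trans (hf.gain_anti (Finset.union_subset_union_right (h j)) ?_)⟩
  by_cases hG : x ∈ G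
  · exact Or.inl (Finset.mem_union_left _ hG)
  · refine Or.inr fun hc => ?_
    rcases Finset.mem_union.1 hc with hc | hc
    · exact hG hc
    · exact hx.1 (subset_used B j hc)

theorem PIGInv.setThresholds {G : Finset U} {τmin ε : ℝ} (h1 : ε < 1)
    {st : PIGState U ℓ} (hst : PIGInv f G τmin ε st) {I : Finset (Fin ℓ)} {V : Fin ℓ → Finset U}
    {τ : Fin ℓ → ℝ} (hV : ∀ j, cand f G st.A j (τ j) ⊆ V j)
    (hτ : ∀ j, Lowered f G ε st.A j (st.τ j) (τ j)) (hI : ∀ j ∉ I, τ j < τmin) :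
    PIGInv f G τmin ε { st with I := I, V := V, τ := τ } where
  disj := hst.disj
  sub := hst.sub
  le := hst.le
  avail j x hx := by
    rcases (hτ j).2 with h | h
    · simp only [h]; exact hst.avail j x hx
    · exact (h x hx).le.trans (div_le_div_of_nonneg_right (le_max_left _ _) (by linarith))
  vsup := hV
  inactive := hI

/-- The gain is positive, so `x` is outside `G ∪ A j`, and over the smaller set `G ∪ A' j` it gains
at least as much; this keeps `A'` at least as valuable as `A`. The remaining clauses survive because
gains of unused elements only fall. -/
theorem PIGInv.insert (hf : IsSubmodular f) {G : Finset U} {τmin ε : ℝ} (hm : 0 < τmin)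
    {st : PIGState U ℓ} (hst : PIGInv f G τmin ε st) (j : Fin ℓ)
    {x : U} (hx : x ∉ used st.A) (hg : τmin ≤ gain f x (G ∪ st.A j)) :
    PIGInv f G τmin ε
      { I := st.I
        A := Function.update st.A j (insert x (st.A j))
        A' := Function.update st.A' j (insert x (st.A' j))
        V := fun l => (st.V l).erase x
        τ := st.τ } := by
  have hsub : ∀ i, st.A i ⊆ Function.update st.A j (Insert.insert x (st.A j)) i := fun i => by
    by_cases h : i = j
    · subst h; simp
    · simp [h]
  have hxn : ∀ i, x ∉ st.A i := fun i hc => hx (subset_used _ i hc)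
  refine ⟨?_, ?_, ?_, ?_, ?_, hst.inactive⟩
  · intro a b hab
    by_cases ha : a = j
    · subst ha
      have hb : b ≠ a := hab.symm
      simp only [Function.update_self, Function.update_of_ne hb, Finset.disjoint_insert_left]
      exact ⟨hxn b, hst.disj a b hab⟩
    · by_cases hb : b = j
      · subst hb
        simp only [Function.update_self, Function.update_of_ne ha, Finset.disjoint_insert_right]
        exact ⟨hxn a, hst.disj a b hab⟩
      · simp only [Function.update_of_ne ha, Function.update_of_ne hb]
        exact hst.disj a b hab
  · intro i
    by_cases hi : i = j
    · subst hi
      simp only [Function.update_self]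
      exact Finset.insert_subset_insert _ (hst.sub i)
    · simp only [Function.update_of_ne hi]
      exact hst.sub i
  · intro i
    by_cases hi : i = j
    · subst hi
      simp only [Function.update_self, Finset.union_insert]
      have hxn : x ∉ G ∪ st.A i := fun hc => by
        rw [gain_of_mem hc] at hg
        linarith
      have h := hf.gain_anti (Finset.union_subset_union_right (s := G) (hst.sub i)) (Or.inr hxn)
      have := hst.le i
      unfold gain at h
      linarith
    · simp only [Function.update_of_ne hi]
      exact hst.le i
  · intro i y hy
    have hyA : y ∉ used st.A := fun hc => hy (used_mono hsub hc)
    refine le_trans ?_ (hst.avail i y hyA)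
    refine hf.gain_anti (Finset.union_subset_union_right (hsub i)) ?_
    by_cases hG : y ∈ G
    · exact Or.inl (Finset.mem_union_left _ hG)
    · refine Or.inr fun hc => ?_
      rcases Finset.mem_union.1 hc with hc | hc
      · exact hG hc
      · exact hy (subset_used _ i hc)
  · intro i y hy
    refine Finset.mem_erase.2 ⟨?_, hst.vsup i (cand_anti hf hsub i _ hy)⟩
    rintro rfl
    refine (mem_cand.1 hy).1 (mem_used.2 ⟨j, ?_⟩)
    simp

end Invariants

/-! ### Adding one element to each solution in sequence. -/

section AddOneEach

variable {U : Type} {ℓ : ℕ} {f : Finset U → ℝ}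

/-- The effect of `addOneEach` on the solutions in `js`. -/
structure Singles (f : Finset U → ℝ) (G : Finset U) (τmin ε : ℝ) (js : List (Fin ℓ))
    (st st₂ : PIGState U ℓ) : Prop where
  out : ∀ j ∉ js, st₂.A j = st.A j ∧ st₂.A' j = st.A' j ∧ st₂.τ j = st.τ j ∧
    (j ∈ st₂.I ↔ j ∈ st.I)
  mem : ∀ j ∈ js,
    (j ∉ st₂.I ∧ st₂.A j = st.A j ∧ st₂.A' j = st.A' j ∧ st₂.τ j < τmin) ∨
    (j ∈ st₂.I ∧ τmin ≤ st₂.τ j ∧ ∃ x ∉ used st.A, st₂.A j = insert x (st.A j) ∧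
      st₂.A' j = insert x (st.A' j) ∧ st₂.τ j ≤ gain f x (G ∪ st.A j) ∧
      ∀ i ∈ js, i ≤ j → gain f x (G ∪ st.A i) ≤ price τmin ε (st₂.τ i))
  τ_le : ∀ j, st₂.τ j ≤ st.τ j

theorem Singles.subset {G : Finset U} {τmin ε : ℝ} {js : List (Fin ℓ)} {st st₂ : PIGState U ℓ}
    (h : Singles f G τmin ε js st st₂) (j : Fin ℓ) : st.A j ⊆ st₂.A j := by
  by_cases hj : j ∈ js
  · rcases h.mem j hj with h | ⟨-, -, x, -, h, -⟩
    · rw [h.2.1]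
    · rw [h]; exact Finset.subset_insert _ _
  · rw [(h.out j hj).1]

variable [Fintype U]

/-- The bound for `weight` after one more element has been taken. -/
def weightPred (f : Finset U → ℝ) (G : Finset U) (τmin ε : ℝ) (A : Fin ℓ → Finset U) (j : Fin ℓ)
    (τ : ℝ) : ℝ :=
  stepsBelow τmin ε τ * (Real.log (Fintype.card U) + 2) + pot ((cand f G A j τ).card - 1)

theorem weightPred_anti (hf : IsSubmodular f) {G : Finset U} {τmin ε : ℝ}
    {A B : Fin ℓ → Finset U} (h : ∀ j, A j ⊆ B j) (j : Fin ℓ) (τ : ℝ) :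
    weightPred f G τmin ε B j τ ≤ weightPred f G τmin ε A j τ := by
  unfold weightPred
  have := pot_mono (Nat.sub_le_sub_right (Finset.card_le_card (cand_anti (G := G) hf h j τ)) 1)
  linarith

theorem weight_le_weightPred (hf : IsSubmodular f) {G : Finset U} {τmin ε : ℝ}
    {A B : Fin ℓ → Finset U} (h : ∀ j, A j ⊆ B j) {j : Fin ℓ} {τ : ℝ} {x : U}
    (hx : x ∈ cand f G A j τ) (hxB : x ∈ used B) :
    weight f G τmin ε B j τ ≤ weightPred f G τmin ε A j τ := by
  unfold weightPred weight
  have : cand f G B j τ ⊆ (cand f G A j τ).erase x := fun y hy =>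
    Finset.mem_erase.2 ⟨by rintro rfl; exact (mem_cand.1 hy).1 hxB, cand_anti hf h j τ hy⟩
  have := pot_mono (Finset.card_le_card this)
  rw [Finset.card_erase_of_mem hx] at this
  linarith

/-- The contribution of solution `j` to the potential of the state. -/
def stWeight (f : Finset U → ℝ) (G : Finset U) (τmin ε : ℝ) (st : PIGState U ℓ) (j : Fin ℓ) : ℝ :=
  if j ∈ st.I then weight f G τmin ε st.A j (st.τ j) else 0

theorem addOneEach_cons (G : Finset U) (τmin ε : ℝ) (j : Fin ℓ) (js : List (Fin ℓ))
    (st : PIGState U ℓ) :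
    addOneEach G τmin ε (j :: js) st =
      (if st.V j = ∅ then update G τmin ε {j} st.A st.V st.τ else pure (st.V, st.τ)) >>= fun p =>
        if p.2 j < τmin then
          addOneEach G τmin ε js { st with I := st.I.erase j, V := p.1, τ := p.2 }
        else if hV : (p.1 j).Nonempty then
          OracleAlg.sample U (p.1 j) hV fun x =>
            addOneEach G τmin ε js
              { I := st.I
                A := Function.update st.A j (insert x (st.A j))
                A' := Function.update st.A' j (insert x (st.A' j))
                V := fun l => (p.1 l).erase x
                τ := p.2 }
        else addOneEach G τmin ε js { st with V := p.1, τ := p.2 } := by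
  rw [addOneEach]
  split <;> rfl

/-- When `j` receives `x`, each index `i ≤ j` of the list already has its final threshold, and `x`
was unused when that threshold was fixed; hence the charge at the new price of `i`. For `i > j` the
threshold may still fall after `x` has gone, so no such claim is made. Each index needs at most one
round beyond those paid for by its weight, since `update` runs only on an empty candidate set. -/
theorem addOneEach_spec (hf : IsSubmodular f) {G : Finset U} {τmin ε : ℝ} (hm : 0 < τmin)
    (h0 : 0 < ε) (h1 : ε < 1) (js : List (Fin ℓ)) (hjs : js.Pairwise (· < ·)) (st : PIGState U ℓ)
    (hst : PIGInv f G τmin ε st) (hI : ∀ j ∈ js, j ∈ st.I)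
    (hV : ∀ j ∈ js, st.V j = cand f G st.A j (st.τ j)) (hτ : ∀ j ∈ js, τmin ≤ st.τ j) :
    All f (addOneEach G τmin ε js st) fun st₂ r _ =>
      PIGInv f G τmin ε st₂ ∧ Singles f G τmin ε js st st₂ ∧
      r + (js.map (stWeight f G τmin ε st₂)).sum ≤
        (js.map fun j => 1 + weightPred f G τmin ε st.A j (st.τ j)).sum ∧
      (js.map (stWeight f G τmin ε st₂)).sum ≤
        (js.map fun j => weightPred f G τmin ε st.A j (st.τ j)).sum := by
  induction js generalizing st with
  | nil =>
    exact ⟨hst, ⟨fun j _ => ⟨rfl, rfl, rfl, Iff.rfl⟩, fun j hj => by simp at hj, fun j => le_rfl⟩,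
      by simp, by simp⟩
  | cons j js ih =>
    obtain ⟨hj, hjs⟩ := List.pairwise_cons.1 hjs
    have hjn : j ∉ js := fun h => lt_irrefl _ (hj j h)
    have hne : ∀ i ∈ js, i ≠ j := fun i hi => (hj i hi).ne'
    rw [addOneEach_cons, all_bind]
    have hup : All f (if st.V j = ∅ then update G τmin ε {j} st.A st.V st.τ
        else pure (st.V, st.τ)) fun p r _ =>
        (∀ i ≠ j, p.1 i = st.V i ∧ p.2 i = st.τ i) ∧
        p.1 j = cand f G st.A j (p.2 j) ∧ (p.1 j ≠ ∅ ∨ p.2 j < τmin) ∧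
        Lowered f G ε st.A j (st.τ j) (p.2 j) ∧
        (r : ℝ) ≤ 1 + weightPred f G τmin ε st.A j (st.τ j) ∧
        r + weightPred f G τmin ε st.A j (p.2 j) ≤
          1 + weightPred f G τmin ε st.A j (st.τ j) ∧
        weightPred f G τmin ε st.A j (p.2 j) ≤ weightPred f G τmin ε st.A j (st.τ j) ∧
        0 ≤ weightPred f G τmin ε st.A j (st.τ j) := by
      have hpred0 : 0 ≤ weightPred f G τmin ε st.A j (st.τ j) := by
        have := log_card_nonneg (U := U)
        have := pot_nonneg ((cand f G st.A j (st.τ j)).card - 1)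
        unfold weightPred
        positivity
      split
      · rename_i hVj
        have hc : cand f G st.A j (st.τ j) = ∅ := by rw [← hV j (by simp), hVj]
        refine (update_spec hm h0 h1 {j} st.A st.V st.τ ?_).mono ?_
        · intro i hi
          exact hst.vsup i
        · rintro ⟨V, τ⟩ r q ⟨h2, h3, h4⟩
          obtain ⟨h5, h6, h7, h7'⟩ := h3 j (by simp)
          simp only [Finset.sum_singleton] at h4
          -- Truncated subtraction: for an empty candidate set the predecessor is again zero.
          have h8 : weightPred f G τmin ε st.A j (st.τ j) =
              weight f G τmin ε st.A j (st.τ j) := by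
            simp [weightPred, weight, hc]
          have h9 : weightPred f G τmin ε st.A j (τ j) ≤ weight f G τmin ε st.A j (τ j) := by
            have := pot_mono (Nat.sub_le (cand f G st.A j (τ j)).card 1)
            unfold weightPred weight
            linarith
          have := weight_nonneg (f := f) G τmin ε st.A j (τ j)
          refine ⟨fun i hi => h2 i (by simpa using hi), h5, h6, h7, ?_, ?_, ?_, hpred0⟩ <;>
          · simp only at *
            linarith
      · rename_i hVj
        refine ⟨fun i _ => ⟨rfl, rfl⟩, hV j (by simp), Or.inl hVj, ⟨le_rfl, Or.inl rfl⟩, ?_, ?_,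
          le_rfl, hpred0⟩
        · push_cast
          linarith
        · simp
    refine hup.mono ?_
    rintro ⟨V, τ⟩ r q ⟨hout, hVj, hne', hlow, hr, hr', hpred, hpred0⟩
    simp only at hout hVj hne' hlow hr hr' hpred
    have hlow' : ∀ i, Lowered f G ε st.A i (st.τ i) (τ i) := fun i => by
      by_cases hi : i = j
      · subst hi; exact hlow
      · rw [(hout i hi).2]; exact ⟨le_rfl, Or.inl rfl⟩
    have hVsup : ∀ i, cand f G st.A i (τ i) ⊆ V i := fun i => by
      by_cases hi : i = j
      · subst hi; rw [hVj]
      · rw [(hout i hi).2, (hout i hi).1]; exact hst.vsup i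
    by_cases hτj : τ j < τmin
    · simp only [hτj, if_true]
      have hinv := hst.setThresholds (I := st.I.erase j) h1 hVsup hlow' (fun i hi => by
        by_cases hij : i = j
        · subst hij; exact hτj
        · rw [(hout i hij).2]
          exact hst.inactive i fun hc => hi (Finset.mem_erase.2 ⟨hij, hc⟩))
      refine (ih hjs _ hinv ?_ ?_ ?_).mono ?_
      · intro i hi
        exact Finset.mem_erase.2 ⟨hne i hi, hI i (List.mem_cons_of_mem _ hi)⟩
      · intro i hi
        simp only
        rw [(hout i (hne i hi)).1, (hout i (hne i hi)).2, hV i (List.mem_cons_of_mem _ hi)]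
      · intro i hi
        simp only
        rw [(hout i (hne i hi)).2]
        exact hτ i (List.mem_cons_of_mem _ hi)
      · rintro st₂ r₂ q₂ ⟨hinv₂, hS, hr₂, hw₂⟩
        obtain ⟨e1, e2, e3, e4⟩ := hS.out j hjn
        have hjI : j ∉ st₂.I := by rw [e4]; simp
        refine ⟨hinv₂, ⟨?_, ?_, fun i => (hS.τ_le i).trans (hlow' i).1⟩, ?_, ?_⟩
        · intro i hi
          rw [List.mem_cons, not_or] at hi
          obtain ⟨a1, a2, a3, a4⟩ := hS.out i hi.2
          refine ⟨a1, a2, by rw [a3]; exact (hout i hi.1).2, ?_⟩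
          rw [a4, Finset.mem_erase]
          exact ⟨fun h => h.2, fun h => ⟨hi.1, h⟩⟩
        · intro i hi
          rcases List.mem_cons.1 hi with rfl | hi
          · exact Or.inl ⟨hjI, e1, e2, by rw [e3]; exact hτj⟩
          · rcases hS.mem i hi with h | ⟨b1, b2, x, b3, b4, b5, b6, b7⟩
            · exact Or.inl h
            · refine Or.inr ⟨b1, b2, x, b3, b4, b5, b6, fun a ha hai => ?_⟩
              rcases List.mem_cons.1 ha with rfl | ha
              · rw [e3]
                exact hinv.avail a x b3
              · exact b7 a ha hai
        · simp only [List.map_cons, List.sum_cons]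
          have hjw : stWeight f G τmin ε st₂ j = 0 := if_neg hjI
          have htail : (js.map fun i => 1 + weightPred f G τmin ε st.A i (τ i)).sum =
              (js.map fun i => 1 + weightPred f G τmin ε st.A i (st.τ i)).sum := by
            congr 1
            exact List.map_congr_left fun i hi => by rw [(hout i (hne i hi)).2]
          simp only at hr₂
          push_cast
          linarith
        · simp only [List.map_cons, List.sum_cons]
          have hjw : stWeight f G τmin ε st₂ j = 0 := if_neg hjI
          have htail : (js.map fun i => weightPred f G τmin ε st.A i (τ i)).sum =
              (js.map fun i => weightPred f G τmin ε st.A i (st.τ i)).sum := by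
            congr 1
            exact List.map_congr_left fun i hi => by rw [(hout i (hne i hi)).2]
          simp only at hw₂
          linarith
    · simp only [hτj, if_false]
      have hVne : (V j).Nonempty := by
        rcases hne' with h | h
        · exact Finset.nonempty_iff_ne_empty.2 h
        · exact absurd h hτj
      rw [dif_pos hVne]
      intro x hx
      have hinv := hst.setThresholds (I := st.I) h1 hVsup hlow' (fun i hi => by
        have hij : i ≠ j := by rintro rfl; exact hi (hI i (by simp))
        rw [(hout i hij).2]
        exact hst.inactive i hi)
      rw [hVj] at hx
      obtain ⟨hxu, hxg⟩ := mem_cand.1 hx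
      have hinv' := hinv.insert hf hm j hxu ((not_lt.1 hτj).trans hxg)
      simp only at hinv'
      set A₁ := Function.update st.A j (insert x (st.A j)) with hA₁
      have hsub : ∀ i, st.A i ⊆ A₁ i := fun i => by
        by_cases h : i = j
        · subst h; simp [hA₁]
        · simp [hA₁, h]
      have hA₁n : ∀ i ≠ j, A₁ i = st.A i := fun i hi => by simp [hA₁, hi]
      refine (ih hjs _ hinv' ?_ ?_ ?_).mono ?_
      · intro i hi
        exact hI i (List.mem_cons_of_mem _ hi)
      · intro i hi
        simp only
        rw [(hout i (hne i hi)).1, (hout i (hne i hi)).2, hV i (List.mem_cons_of_mem _ hi)]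
        ext y
        rw [Finset.mem_erase, mem_cand, mem_cand, hA₁n i (hne i hi)]
        -- The candidate sets of later indices stay exact: their own solutions are unchanged, and
        -- `x` is deleted from all of them.
        have : y ∈ used A₁ ↔ y = x ∨ y ∈ used st.A := by
          constructor
          · intro h
            obtain ⟨a, ha⟩ := mem_used.1 h
            by_cases haj : a = j
            · subst haj
              rw [hA₁, Function.update_self, Finset.mem_insert] at ha
              exact ha.imp_right fun h => subset_used _ _ h
            · rw [hA₁n a haj] at ha
              exact Or.inr (subset_used _ _ ha)
          · rintro (rfl | h)
            · exact mem_used.2 ⟨j, by simp [hA₁]⟩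
            · exact used_mono hsub h
        rw [this]
        tauto
      · intro i hi
        simp only
        rw [(hout i (hne i hi)).2]
        exact hτ i (List.mem_cons_of_mem _ hi)
      · rintro st₂ r₂ q₂ ⟨hinv₂, hS, hr₂, hw₂⟩
        obtain ⟨e1, e2, e3, e4⟩ := hS.out j hjn
        have hjI : j ∈ st₂.I := by rw [e4]; exact hI j (by simp)
        simp only at e1 e2 e3 hr₂ hw₂
        rw [hA₁, Function.update_self] at e1
        rw [Function.update_self] at e2
        have hjw : stWeight f G τmin ε st₂ j ≤ weightPred f G τmin ε st.A j (τ j) := by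
          rw [stWeight, if_pos hjI, e3]
          exact weight_le_weightPred hf (fun i => (hsub i).trans (hS.subset i)) hx
            (mem_used.2 ⟨j, by rw [e1]; simp⟩)
        refine ⟨hinv₂, ⟨?_, ?_, fun i => (hS.τ_le i).trans (hlow' i).1⟩, ?_, ?_⟩
        · intro i hi
          rw [List.mem_cons, not_or] at hi
          obtain ⟨a1, a2, a3, a4⟩ := hS.out i hi.2
          simp only at a1 a2 a3 a4
          exact ⟨by rw [a1, hA₁n i hi.1], by rw [a2, Function.update_of_ne hi.1],
            by rw [a3, (hout i hi.1).2], a4⟩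
        · intro i hi
          rcases List.mem_cons.1 hi with rfl | hi
          · refine Or.inr ⟨hjI, by rw [e3]; exact not_lt.1 hτj, x, hxu, e1, e2,
              by rw [e3]; exact hxg, fun a ha hai => ?_⟩
            rcases List.mem_cons.1 ha with rfl | ha
            · rw [e3]
              exact hinv.avail a x hxu
            · exact absurd (hj a ha) (not_lt.2 hai)
          · rcases hS.mem i hi with ⟨b1, b2, b3, b4⟩ | ⟨b1, b2, y, b3, b4, b5, b6, b7⟩
            · simp only at b2 b3
              exact Or.inl ⟨b1, by rw [b2, hA₁n i (hne i hi)],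
                by rw [b3, Function.update_of_ne (hne i hi)], b4⟩
            · simp only at b3 b4 b5 b6 b7
              have hyu : y ∉ used st.A := fun hc => b3 (used_mono hsub hc)
              rw [hA₁n i (hne i hi)] at b4 b6
              rw [Function.update_of_ne (hne i hi)] at b5
              refine Or.inr ⟨b1, b2, y, hyu, b4, b5, b6, fun a ha hai => ?_⟩
              rcases List.mem_cons.1 ha with rfl | ha
              · rw [e3]
                exact hinv.avail a y hyu
              · have := b7 a ha hai
                rwa [hA₁n a (hne a ha)] at this
        · simp only [List.map_cons, List.sum_cons]
          have htail : (js.map fun i => 1 + weightPred f G τmin ε A₁ i (τ i)).sum ≤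
              (js.map fun i => 1 + weightPred f G τmin ε st.A i (st.τ i)).sum := by
            refine List.sum_le_sum fun i hi => ?_
            rw [(hout i (hne i hi)).2]
            have := weightPred_anti (f := f) (G := G) (τmin := τmin) (ε := ε) hf hsub i (st.τ i)
            linarith
          push_cast
          linarith
        · simp only [List.map_cons, List.sum_cons]
          have htail : (js.map fun i => weightPred f G τmin ε A₁ i (τ i)).sum ≤
              (js.map fun i => weightPred f G τmin ε st.A i (st.τ i)).sum := by
            refine List.sum_le_sum fun i hi => ?_
            rw [(hout i (hne i hi)).2]
            exact weightPred_anti hf hsub i (st.τ i)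
          linarith

theorem queriesLE_addOneEach (G : Finset U) (τmin ε : ℝ) (js : List (Fin ℓ))
    (st : PIGState U ℓ) :
    QueriesLE (ℓ * (Fintype.card U + 1)) (addOneEach G τmin ε js st) := by
  induction js generalizing st with
  | nil => exact queriesLE_pure _ _
  | cons j js ih =>
    rw [addOneEach_cons]
    refine QueriesLE.bind ?_ fun p => ?_
    · split
      · exact queriesLE_update _ _ _ _ _ _ _
      · exact queriesLE_pure _ _
    · split
      · exact ih _
      · split
        · exact fun x _ => ih _
        · exact ih _

end AddOneEach

/-! ### Values of selections from a marked list. -/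

section Marks

variable {U : Type} {f : Finset U → ℝ}

theorem map_fst_markList (ans : Finset U → ℝ) (τ : ℝ) (T : Finset U) (l : List U) :
    (markList ans τ T l).map Prod.fst = l := by
  induction l generalizing T with
  | nil => rfl
  | cons v vs ih => simp [markList, ih]

@[simp] theorem length_markList (ans : Finset U → ℝ) (τ : ℝ) (T : Finset U) (l : List U) :
    (markList ans τ T l).length = l.length := by
  rw [← List.length_map Prod.fst, map_fst_markList]

theorem nodup_markList {ans : Finset U → ℝ} {τ : ℝ} {T : Finset U} {l : List U} (h : l.Nodup) :
    (markList ans τ T l).Nodup := by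
  rw [← map_fst_markList ans τ T l] at h
  exact h.of_map

theorem take_markList (ans : Finset U → ℝ) (τ : ℝ) (T : Finset U) (l : List U) (i : ℕ) :
    (markList ans τ T l).take i = markList ans τ T (l.take i) := by
  induction l generalizing T i with
  | nil => simp [markList]
  | cons v vs ih =>
    cases i with
    | zero => simp [markList]
    | succ i => simp [markList, ih]

theorem markList_congr {ans : Finset U → ℝ} (τ : ℝ) (T : Finset U) (l : List U)
    (h : ∀ i ≤ l.length, ans (T ∪ (l.take i).toFinset) = f (T ∪ (l.take i).toFinset)) :
    markList ans τ T l = markList f τ T l := by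
  induction l generalizing T with
  | nil => rfl
  | cons v vs ih =>
    have e0 := h 0 (by simp)
    have e1 := h 1 (by simp)
    simp only [List.take_zero, List.toFinset_nil, Finset.union_empty] at e0
    simp only [List.take_succ_cons, List.take_zero, List.toFinset_cons, List.toFinset_nil,
      Finset.union_insert, Finset.union_empty] at e1
    simp only [markList, e0, e1]
    rw [ih (insert v T)]
    intro i hi
    have := h (i + 1) (by simpa using hi)
    simpa only [List.take_succ_cons, List.toFinset_cons, Finset.union_insert,
      Finset.insert_union] using this

/-- Keeping the selected entries that are not `bad` gains at least `τ` per selected `good` entry. -/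
theorem good_gain_le (hf : IsSubmodular f) {τ : ℝ} (q : U × Mark → Prop)
    (l : List U) (hl : l.Nodup) (T X : Finset U) (hXT : X ⊆ T) (hd : ∀ v ∈ l, v ∉ T) :
    f X + τ * ((markList f τ T l).filter fun p => q p ∧ p.2 = Mark.good).length ≤
      f (X ∪ (((markList f τ T l).filter fun p => q p ∧ p.2 ≠ Mark.bad).map
        Prod.fst).toFinset) := by
  induction l generalizing T X with
  | nil => simp [markList]
  | cons v vs ih =>
    obtain ⟨hv, hvs⟩ := List.nodup_cons.1 hl
    have hvT : v ∉ T := hd v (by simp)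
    have hd' : ∀ w ∈ vs, w ∉ insert v T := fun w hw => by
      rw [Finset.mem_insert, not_or]
      exact ⟨by rintro rfl; exact hv hw, hd w (List.mem_cons_of_mem _ hw)⟩
    -- `T` collects every entry and `X` only those that are kept, so a gain over `X` is at least the
    -- gain that determines the mark.
    have hg := hf.gain_anti hXT (Or.inr hvT)
    have ih1 := ih hvs (insert v T) (insert v X) (Finset.insert_subset_insert _ hXT) hd'
    have ih2 := ih hvs (insert v T) X (hXT.trans (Finset.subset_insert _ _)) hd'
    simp only [markList]
    unfold gain at hg
    by_cases h1 : τ ≤ f (insert v T) - f T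
    · simp only [h1, if_true]
      by_cases hq : q (v, Mark.good)
      · simp only [hq, List.filter_cons, List.map_cons, List.toFinset_cons, ne_eq, reduceCtorEq,
          not_false_eq_true, and_self, decide_true, if_true, List.length_cons, Finset.union_insert]
        rw [Finset.insert_union] at ih1
        push_cast
        linarith
      · simp only [hq, List.filter_cons, false_and, decide_false, Bool.false_eq_true, if_false]
        exact ih2
    · simp only [h1, if_false]
      by_cases h2 : f (insert v T) - f T < 0
      · simp only [h2, if_true, List.filter_cons, ne_eq, not_true, and_false, decide_false,
          Bool.false_eq_true, if_false, reduceCtorEq]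
        exact ih2
      · simp only [h2, if_false]
        by_cases hq : q (v, Mark.neutral)
        · simp only [hq, List.filter_cons, List.map_cons, List.toFinset_cons, ne_eq, reduceCtorEq,
            not_false_eq_true, and_self, and_false, decide_true, decide_false, if_true,
            Bool.false_eq_true, if_false, Finset.union_insert]
          rw [Finset.insert_union] at ih1
          linarith
        · simp only [hq, List.filter_cons, false_and, decide_false, Bool.false_eq_true, if_false]
          exact ih2

/-- Dropping the `bad` entries does not hurt, if a `bad` entry is selected only together with
everything that precedes it. -/
theorem drop_bad_le (hf : IsSubmodular f) {τ : ℝ} (q : U × Mark → Prop)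
    (l : List U) (hl : l.Nodup) (T Y X : Finset U) (hXY : X ⊆ Y) (hYT : Y ⊆ T)
    (hd : ∀ v ∈ l, v ∉ T)
    (hq : (markList f τ T l).Pairwise fun a b => q b → b.2 = Mark.bad → q a)
    (hY : Y = T ∨ ∀ p ∈ markList f τ T l, q p → p.2 ≠ Mark.bad) :
    f (Y ∪ (((markList f τ T l).filter fun p => q p).map Prod.fst).toFinset) - f Y ≤
      f (X ∪ (((markList f τ T l).filter fun p => q p ∧ p.2 ≠ Mark.bad).map
        Prod.fst).toFinset) - f X := by
  induction l generalizing T Y X with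
  | nil => simp [markList]
  | cons v vs ih =>
    obtain ⟨hv, hvs⟩ := List.nodup_cons.1 hl
    have hvT : v ∉ T := hd v (by simp)
    have hd' : ∀ w ∈ vs, w ∉ insert v T := fun w hw => by
      rw [Finset.mem_insert, not_or]
      exact ⟨by rintro rfl; exact hv hw, hd w (List.mem_cons_of_mem _ hw)⟩
    have hg := hf.gain_anti hXY (Or.inr fun h => hvT (hYT h))
    simp only [markList] at hq hY ⊢
    set mk : Mark := if τ ≤ f (insert v T) - f T then Mark.good
      else if f (insert v T) - f T < 0 then Mark.bad else Mark.neutral with hmk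
    obtain ⟨hq1, hq2⟩ := List.pairwise_cons.1 hq
    by_cases hqv : q (v, mk)
    · have hY' : insert v Y = insert v T ∨
          ∀ p ∈ markList f τ (insert v T) vs, q p → p.2 ≠ Mark.bad := by
        rcases hY with h | h
        · exact Or.inl (by rw [h])
        · exact Or.inr fun p hp => h p (List.mem_cons_of_mem _ hp)
      by_cases hb : mk = Mark.bad
      -- A selected bad entry comes with all its predecessors. Hence `Y` is still `T`, the gain of
      -- `v` over `Y` is truly negative, and leaving `v` out of `X` only helps.
      · have hYT' : Y = T := by
          rcases hY with h | h
          · exact h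
          · exact absurd hb (h (v, mk) (by simp) hqv)
        have hneg : f (insert v T) - f T < 0 := by
          by_contra hc
          rw [hmk, if_neg hc] at hb
          split at hb <;> simp at hb
        have := ih hvs (insert v T) (insert v Y) X (hXY.trans (Finset.subset_insert _ _))
          (Finset.insert_subset_insert _ hYT) hd' hq2 hY'
        rw [Finset.insert_union] at this
        simp only [List.filter_cons, hb, ne_eq, not_true, and_false, decide_false,
          Bool.false_eq_true, if_false] at this ⊢
        rw [hb] at hqv
        simp only [hqv, decide_true, if_true, List.map_cons, List.toFinset_cons,
          Finset.union_insert]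
        rw [hYT'] at this ⊢
        linarith
      · have := ih hvs (insert v T) (insert v Y) (insert v X) (Finset.insert_subset_insert _ hXY)
          (Finset.insert_subset_insert _ hYT) hd' hq2 hY'
        rw [Finset.insert_union, Finset.insert_union] at this
        simp only [List.filter_cons, hqv, hb, decide_true, if_true, List.map_cons,
          List.toFinset_cons, Finset.union_insert, ne_eq, not_false_eq_true, and_self]
        unfold gain at hg
        linarith
    -- Once an entry is skipped, no bad entry is selected any more, so `Y` may fall behind `T`.
    · have hnb : ∀ p ∈ markList f τ (insert v T) vs, q p → p.2 ≠ Mark.bad :=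
        fun p hp hqp hb => hqv (hq1 p hp hqp hb)
      have := ih hvs (insert v T) Y X hXY (hYT.trans (Finset.subset_insert _ _)) hd' hq2
        (Or.inr hnb)
      simp only [List.filter_cons, hqv, decide_false, Bool.false_eq_true, if_false, false_and]
      exact this

end Marks

/-! ### The three selection passes. -/

section ThreePass

variable {U : Type}

/-- The order in which `threePass` reads its input. -/
def passOrder (b : List (U × Mark)) : List (U × Mark) :=
  b.filter (fun p => decide (p.2 = Mark.good)) ++
    b.filter (fun p => decide (p.2 = Mark.neutral)) ++
    b.filter (fun p => decide (p.2 = Mark.bad))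

theorem threePass_eq (i : ℕ) (b : List (U × Mark)) : threePass i b = (passOrder b).take i := rfl

theorem passOrder_perm (b : List (U × Mark)) : (passOrder b).Perm b := by
  induction b with
  | nil => rfl
  | cons p b ih =>
    obtain ⟨v, mk⟩ := p
    unfold passOrder at *
    cases mk
    · simpa using ih
    · simp only [List.filter_cons, reduceCtorEq, decide_false, Bool.false_eq_true, if_false,
        decide_true, if_true]
      refine List.Perm.trans ?_ (ih.cons _)
      simp only [List.append_assoc, List.cons_append]
      exact List.perm_middle
    · simp only [List.filter_cons, reduceCtorEq, decide_false, Bool.false_eq_true, if_false,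
        decide_true, if_true]
      exact List.perm_middle.trans (ih.cons _)

theorem length_threePass {i : ℕ} {b : List (U × Mark)} (h : i ≤ b.length) :
    (threePass i b).length = i := by
  rw [threePass_eq, List.length_take, (passOrder_perm b).length_eq]
  omega

theorem nodup_threePass {i : ℕ} {b : List (U × Mark)} (h : b.Nodup) : (threePass i b).Nodup := by
  rw [threePass_eq]
  exact ((passOrder_perm b).nodup_iff.2 h).sublist (List.take_sublist _ _)

theorem threePass_subset (i : ℕ) (b : List (U × Mark)) : threePass i b ⊆ b := fun _ hp =>
  (passOrder_perm b).mem_iff.1 (List.mem_of_mem_take hp)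

theorem mem_threePass_length {b : List (U × Mark)} {p : U × Mark} :
    p ∈ threePass b.length b ↔ p ∈ b := by
  rw [threePass_eq, List.take_of_length_le (passOrder_perm b).length_eq.le,
    (passOrder_perm b).mem_iff]

theorem mem_take_of_sublist {α : Type} {L : List α} (hL : L.Nodup) {a b : α} {i : ℕ}
    (hab : [a, b].Sublist L) (hb : b ∈ L.take i) : a ∈ L.take i := by
  rw [← List.take_append_drop i L] at hab hL
  have hdis := List.disjoint_of_nodup_append hL
  obtain ⟨l₁, l₂, h, h1, h2⟩ := List.sublist_append_iff.1 hab
  cases l₁ with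
  | nil =>
    simp only [List.nil_append] at h
    subst h
    exact absurd (h2.subset (by simp)) (fun h => hdis hb h)
  | cons c l₁ =>
    simp only [List.cons_append, List.cons.injEq] at h
    rw [h.1]
    exact h1.subset (by simp)

/-- An entry that precedes a bad one in `b` also precedes it in `passOrder`: it is read in an
earlier pass, or in the same pass in the same order. A prefix of `passOrder` that contains the later
entry contains the earlier one. This is the hypothesis `hq` of `drop_bad_le`. -/
theorem pairwise_threePass (i : ℕ) {b : List (U × Mark)} (hb : b.Nodup) :
    b.Pairwise fun x y => y ∈ threePass i b → y.2 = Mark.bad → x ∈ threePass i b := by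
  rw [List.pairwise_iff_forall_sublist]
  intro x y hxy hy hbad
  rw [threePass_eq] at hy ⊢
  refine mem_take_of_sublist ((passOrder_perm b).nodup_iff.2 hb) ?_ hy
  have hxb : x ∈ b := hxy.subset (by simp)
  have hyb : y ∈ b := hxy.subset (by simp)
  have hy' : [y].Sublist (b.filter fun p => decide (p.2 = Mark.bad)) := by
    rw [List.singleton_sublist]
    exact List.mem_filter.2 ⟨hyb, by simpa using hbad⟩
  unfold passOrder
  rcases hx : x.2 with _ | _ | _
  · refine List.Sublist.append (l₁ := [x]) ?_ hy'
    rw [List.singleton_sublist, List.mem_append]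
    exact Or.inl (List.mem_filter.2 ⟨hxb, by simpa using hx⟩)
  · refine List.Sublist.append (l₁ := [x]) ?_ hy'
    rw [List.singleton_sublist, List.mem_append]
    exact Or.inr (List.mem_filter.2 ⟨hxb, by simpa using hx⟩)
  · refine List.Sublist.trans ?_ (List.sublist_append_right _ _)
    have := hxy.filter (fun p => decide (p.2 = Mark.bad))
    simpa [List.filter_cons, hx, hbad] using this

theorem goodCount_eq (b : List (U × Mark)) :
    goodCount b = (b.filter fun p => decide (p.2 = Mark.good)).length := by
  rw [goodCount, List.countP_eq_length_filter]

theorem min_le_goodCount_threePass (i : ℕ) (b : List (U × Mark)) :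
    min i (goodCount b) ≤ goodCount (threePass i b) := by
  have h : ((b.filter fun p => decide (p.2 = Mark.good)).take i).Sublist (threePass i b) := by
    unfold threePass
    rw [List.append_assoc, List.take_append]
    exact List.sublist_append_left _ _
  have h2 := h.countP_le (p := fun p => decide (p.2 = Mark.good))
  have h3 : ((b.filter fun p => decide (p.2 = Mark.good)).take i).countP
      (fun p => decide (p.2 = Mark.good)) =
      ((b.filter fun p => decide (p.2 = Mark.good)).take i).length := by
    rw [List.countP_eq_length]
    intro p hp
    exact (List.mem_filter.1 (List.mem_of_mem_take hp)).2
  rw [h3, List.length_take, ← goodCount_eq] at h2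
  exact h2

/-- Leading `good` entries are selected. -/
theorem take_subset_threePass {i n : ℕ} {b : List (U × Mark)} (hn : n ≤ i)
    (hg : ∀ p ∈ b.take n, p.2 = Mark.good) : b.take n ⊆ threePass i b := by
  have h1 : (b.take n) <+: b.filter (fun p => decide (p.2 = Mark.good)) := by
    conv_rhs => rw [← List.take_append_drop n b]
    rw [List.filter_append, List.filter_eq_self.2 (by simpa using hg)]
    exact List.prefix_append _ _
  have h2 : (b.take n) <+: passOrder b := by
    unfold passOrder
    rw [List.append_assoc]
    exact h1.trans (List.prefix_append _ _)
  rw [threePass_eq]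
  have h3 : b.take n = (passOrder b).take (b.take n).length := List.prefix_iff_eq_take.1 h2
  rw [h3]
  intro p hp
  exact (List.take_subset_take_left _ (by rw [List.length_take]; omega)) hp

end ThreePass

/-! ### The length of the longest prefix with enough good entries. -/

section PrefixLength

variable {U : Type}

theorem prefixLength_le (ε : ℝ) (s : ℕ) (b : List (U × Mark)) : prefixLength ε s b ≤ s := by
  unfold prefixLength
  refine Finset.sup_le fun i hi => ?_
  have := (Finset.mem_filter.1 hi).1
  rw [Finset.mem_range] at this
  simp only [id]
  omega

theorem le_prefixLength {ε : ℝ} {s : ℕ} {b : List (U × Mark)} {i : ℕ} (hi : i ≤ s)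
    (h : (1 - ε) * i ≤ goodCount (b.take i)) : i ≤ prefixLength ε s b := by
  unfold prefixLength
  exact Finset.le_sup (f := id) (Finset.mem_filter.2 ⟨Finset.mem_range.2 (by omega), h⟩)

theorem prefixLength_spec (ε : ℝ) (s : ℕ) (b : List (U × Mark)) :
    (1 - ε) * (prefixLength ε s b : ℕ) ≤ goodCount (b.take (prefixLength ε s b)) := by
  unfold prefixLength
  obtain ⟨i, hi, h⟩ := Finset.exists_mem_eq_sup
    ((Finset.range (s + 1)).filter fun i : ℕ => (1 - ε) * i ≤ goodCount (b.take i))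
    ⟨0, Finset.mem_filter.2 ⟨by simp, by simp⟩⟩ id
  rw [h]
  exact (Finset.mem_filter.1 hi).2

end PrefixLength

/-! ### Disjoint candidate sets and their orderings. -/

section Distribute

variable {U : Type} {ℓ : ℕ} {f : Finset U → ℝ}

theorem used_update_empty {D : Fin ℓ → Finset U} {j : Fin ℓ} (hj : D j = ∅) (S : Finset U) :
    used (Function.update D j S) = used D ∪ S := by
  ext x
  rw [Finset.mem_union, mem_used, mem_used]
  constructor
  · rintro ⟨i, hi⟩
    by_cases h : i = j
    · subst h; right; simpa using hi
    · left; exact ⟨i, by simpa [h] using hi⟩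
  · rintro (⟨i, hi⟩ | h)
    · have : i ≠ j := by rintro rfl; rw [hj] at hi; simp at hi
      exact ⟨i, by simpa [this] using hi⟩
    · exact ⟨j, by simpa using h⟩

/-- The hypothesis `hcard` is the loop invariant that keeps every draw possible. It persists because
smaller sets are served first: each draw removes at most `(V i).card / N` elements from any `V i`
still waiting. -/
theorem distributeLoop_spec (N : ℕ) (V : Fin ℓ → Finset U) (n : ℕ) (J : Finset (Fin ℓ))
    (D : Fin ℓ → Finset U) (hn : n = J.card) (hD : ∀ j ∈ J, D j = ∅)
    (hdis : ∀ i j, i ≠ j → Disjoint (D i) (D j))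
    (hcard : ∀ j ∈ J, (used D).card + J.card * ((V j).card / N) ≤ (V j).card) :
    All f (distributeLoop N V n J D) fun D' _ _ =>
      (∀ j ∉ J, D' j = D j) ∧ (∀ j ∈ J, D' j ⊆ V j ∧ (D' j).card = (V j).card / N) ∧
      ∀ i j, i ≠ j → Disjoint (D' i) (D' j) := by
  induction n generalizing J D with
  | zero =>
    have : J = ∅ := Finset.card_eq_zero.1 hn.symm
    subst this
    exact ⟨fun j _ => rfl, fun j hj => by simp at hj, hdis⟩
  | succ n ih =>
    have hJ : J.Nonempty := Finset.card_pos.1 (by omega)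
    rw [distributeLoop, dif_pos hJ]
    have hspec := (J.exists_min_image (fun j => (V j).card) hJ).choose_spec
    set j := (J.exists_min_image (fun j => (V j).card) hJ).choose
    obtain ⟨hj, hmin⟩ := hspec
    have hcj : (V j).card / N ≤ (V j \ used D).card := by
      have h1 := hcard j hj
      have h2 : (V j).card / N ≤ J.card * ((V j).card / N) :=
        Nat.le_mul_of_pos_left _ (Finset.card_pos.2 hJ)
      have h3 := Finset.le_card_sdiff (used D) (V j)
      omega
    have hne : (Finset.powersetCard ((V j).card / N) (V j \ used D)).Nonempty :=
      Finset.powersetCard_nonempty.2 hcj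
    rw [all_bind, all_pick hne]
    intro S hS
    obtain ⟨hSV, hSc⟩ := Finset.mem_powersetCard.1 hS
    have hS1 : S ⊆ V j := hSV.trans Finset.sdiff_subset
    have hS2 : ∀ i, Disjoint S (D i) := fun i => by
      rw [Finset.disjoint_left]
      intro x hx hxi
      exact (Finset.mem_sdiff.1 (hSV hx)).2 (subset_used D i hxi)
    refine (ih (J.erase j) (Function.update D j S) ?_ ?_ ?_ ?_).mono ?_
    · rw [Finset.card_erase_of_mem hj]; omega
    · intro i hi
      rw [Function.update_of_ne (Finset.ne_of_mem_erase hi)]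
      exact hD i (Finset.mem_of_mem_erase hi)
    · intro a b hab
      by_cases ha : a = j
      · subst ha
        rw [Function.update_self, Function.update_of_ne hab.symm]
        exact hS2 b
      · by_cases hb : b = j
        · rw [hb, Function.update_self, Function.update_of_ne ha]
          exact (hS2 a).symm
        · rw [Function.update_of_ne ha, Function.update_of_ne hb]
          exact hdis a b hab
    · intro i hi
      have hiJ := Finset.mem_of_mem_erase hi
      rw [used_update_empty (hD j hj), Finset.card_erase_of_mem hj]
      have h1 := hcard i hiJ
      have h2 := Finset.card_union_le (used D) S
      have h3 : (V j).card / N ≤ (V i).card / N := Nat.div_le_div_right (hmin i hiJ)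
      have h4 : J.card * ((V i).card / N) = (J.card - 1) * ((V i).card / N) + (V i).card / N := by
        conv_lhs => rw [← Nat.sub_add_cancel (Finset.card_pos.2 hJ)]
        rw [Nat.add_mul, Nat.one_mul]
      omega
    · rintro D' r q ⟨h1, h2, h3⟩
      refine ⟨fun i hi => ?_, fun i hi => ?_, h3⟩
      · have hij : i ≠ j := by rintro rfl; exact hi hj
        rw [h1 i fun h => hi (Finset.mem_of_mem_erase h), Function.update_of_ne hij]
      · by_cases hij : i = j
        · subst hij
          rw [h1 _ (Finset.notMem_erase _ _), Function.update_self]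
          exact ⟨hS1, hSc⟩
        · exact h2 i (Finset.mem_erase.2 ⟨hij, hi⟩)

/-- The sets that `distribute` may return. -/
structure IsSplit (I : Finset (Fin ℓ)) (V D : Fin ℓ → Finset U) : Prop where
  sub : ∀ j ∈ I, D j ⊆ V j
  card : ∀ j ∈ I, (D j).card = (V j).card / I.card
  disj : ∀ i j, i ≠ j → Disjoint (D i) (D j)

theorem distribute_spec (I : Finset (Fin ℓ)) (V : Fin ℓ → Finset U) :
    All f (distribute I V) fun D r _ => IsSplit I V D ∧ r = 0 := by
  have h0 : ∀ (n : ℕ) (J : Finset (Fin ℓ)) (D : Fin ℓ → Finset U),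
      All f (distributeLoop I.card V n J D) fun _ r _ => r = 0 := by
    intro n
    induction n with
    | zero => intro J D; rfl
    | succ n ih =>
      intro J D
      rw [distributeLoop]
      split
      · rw [all_bind]
        unfold pick
        split
        · intro S _
          exact ih _ _
        · exact ih _ _
      · rfl
  refine All.mono ((distributeLoop_spec I.card V I.card I (fun _ => ∅) rfl (fun j _ => rfl)
    (fun i j _ => Finset.disjoint_empty_left _) ?_).and (h0 _ _ _)) ?_
  · intro j hj
    have : used (fun _ : Fin ℓ => (∅ : Finset U)) = ∅ := by
      ext x; simp [mem_used]
    rw [this, Finset.card_empty, zero_add]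
    exact Nat.mul_div_le _ _
  · rintro D r q ⟨⟨-, h, h'⟩, hr⟩
    exact ⟨⟨fun j hj => (h j hj).1, fun j hj => (h j hj).2, h'⟩, hr⟩

theorem queriesLE_distribute (B : ℕ) (I : Finset (Fin ℓ)) (V : Fin ℓ → Finset U) :
    QueriesLE B (distribute I V) := by
  unfold distribute
  generalize I.card = n, (fun _ => ∅ : Fin ℓ → Finset U) = D
  suffices h : ∀ k J D, QueriesLE B (distributeLoop n V k J D) from h _ _ _
  intro k
  induction k with
  | zero => intro J D; exact queriesLE_pure _ _
  | succ k ih =>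
    intro J D
    rw [distributeLoop]
    split
    · exact (queriesLE_pick _ _ _).bind fun S => ih _ _
    · exact queriesLE_pure _ _

/-- The orderings that `permuteAll` may return. -/
def IsOrdering (D : Fin ℓ → Finset U) (js : List (Fin ℓ)) (L : Fin ℓ → List U) : Prop :=
  ∀ j ∈ js, (L j).Perm (D j).toList

theorem mem_orderings {D : Finset U} {p : List U} :
    p ∈ D.toList.permutations.toFinset ↔ p.Perm D.toList := by
  simp

theorem orderings_nonempty (D : Finset U) : (D.toList.permutations.toFinset).Nonempty :=
  ⟨D.toList, mem_orderings.2 (List.Perm.refl _)⟩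

theorem permuteAll_spec (D : Fin ℓ → Finset U) (js : List (Fin ℓ)) :
    All f (permuteAll D js) fun L r _ => IsOrdering D js L ∧ r = 0 := by
  induction js with
  | nil => exact ⟨fun j hj => by simp at hj, rfl⟩
  | cons j js ih =>
    rw [permuteAll, all_bind]
    refine ih.mono fun L r q hL => ?_
    rw [all_bind, all_pick (orderings_nonempty _)]
    intro p hp
    refine ⟨fun i hi => ?_, by simpa using hL.2⟩
    by_cases hij : i = j
    · subst hij
      rw [Function.update_self]
      exact mem_orderings.1 hp
    · rw [Function.update_of_ne hij]
      exact hL.1 i (List.mem_of_ne_of_mem hij hi)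

theorem queriesLE_permuteAll (B : ℕ) (D : Fin ℓ → Finset U) (js : List (Fin ℓ)) :
    QueriesLE B (permuteAll D js) := by
  induction js with
  | nil => exact queriesLE_pure _ _
  | cons j js ih =>
    rw [permuteAll]
    exact ih.bind fun L => (queriesLE_pick _ _ _).bind fun p => queriesLE_pure _ _

end Distribute

/-! ### The block step as a function of the orderings. -/

section Block

variable {U : Type} {ℓ : ℕ} {f : Finset U → ℝ}

/-- The number of elements that `Prefix-Selection` inspects. -/
def blockSize (m₀ : ℕ) (I : Finset (Fin ℓ)) (hI : I.Nonempty) (D : Fin ℓ → Finset U) : ℕ :=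
  min m₀ (I.inf' hI fun j => (D j).card)

/-- The array of `Prefix-Selection`, for one solution. -/
def blockMarks (ans : Finset U → ℝ) (G : Finset U) (st : PIGState U ℓ) (s : ℕ)
    (L : Fin ℓ → List U) (j : Fin ℓ) : List (U × Mark) :=
  markList ans (st.τ j) (G ∪ st.A j) ((L j).take s)

/-- The number of elements that are added to each solution. -/
def blockLen (ans : Finset U → ℝ) (G : Finset U) (ε : ℝ) (st : PIGState U ℓ)
    (hI : st.I.Nonempty) (s : ℕ) (L : Fin ℓ → List U) : ℕ :=
  st.I.inf' hI fun j => prefixLength ε s (blockMarks ans G st s L j)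

/-- The selected entries. -/
def blockSel (ans : Finset U → ℝ) (G : Finset U) (ε : ℝ) (st : PIGState U ℓ)
    (hI : st.I.Nonempty) (s : ℕ) (L : Fin ℓ → List U) (j : Fin ℓ) : List (U × Mark) :=
  threePass (blockLen ans G ε st hI s L)
    ((blockMarks ans G st s L j).take (prefixLength ε s (blockMarks ans G st s L j)))

/-- The state after equally many elements have been added to each active solution. -/
def blockNext (ans : Finset U → ℝ) (G : Finset U) (ε : ℝ) (st : PIGState U ℓ)
    (hI : st.I.Nonempty) (s : ℕ) (L : Fin ℓ → List U) : PIGState U ℓ :=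
  { st with
    A := fun j => if j ∈ st.I then
      st.A j ∪ ((blockSel ans G ε st hI s L j).map Prod.fst).toFinset else st.A j
    A' := fun j => if j ∈ st.I then
      st.A' j ∪ (((blockSel ans G ε st hI s L j).filter fun p =>
        decide (p.2 ≠ Mark.bad)).map Prod.fst).toFinset else st.A' j }

/-- The sets that are queried by `addBlock`. -/
def blockQueries (G : Finset U) (st : PIGState U ℓ) (s : ℕ) (L : Fin ℓ → List U) :
    Finset (Finset U) :=
  st.I.biUnion fun j =>
    (Finset.range (s + 1)).image fun i => (G ∪ st.A j) ∪ ((L j).take i).toFinset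

theorem addBlock_eq (G : Finset U) (ε : ℝ) (m₀ : ℕ) (st : PIGState U ℓ) (hI : st.I.Nonempty) :
    addBlock G ε m₀ st hI =
      distribute st.I st.V >>= fun D => permuteAll D (st.I.sort (· ≤ ·)) >>= fun L =>
        ask (blockQueries G st (blockSize m₀ st.I hI D) L) >>= fun ans =>
          pure (blockNext ans G ε st hI (blockSize m₀ st.I hI D) L,
            blockLen ans G ε st hI (blockSize m₀ st.I hI D) L) := rfl

/-- Marks depend only on values at prefixes of length at most `s`, and these are the sets queried,
so the single round reveals enough. -/
theorem blockMarks_restrict (G : Finset U) (st : PIGState U ℓ) (s : ℕ) (L : Fin ℓ → List U)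
    {j : Fin ℓ} (hj : j ∈ st.I) :
    blockMarks (fun S => if S ∈ blockQueries G st s L then f S else 0) G st s L j =
      blockMarks f G st s L j := by
  refine markList_congr _ _ _ fun i hi => if_pos ?_
  refine Finset.mem_biUnion.2 ⟨j, hj, Finset.mem_image.2 ⟨i, ?_, ?_⟩⟩
  · rw [List.length_take] at hi
    exact Finset.mem_range.2 (by omega)
  · rw [List.length_take] at hi
    rw [List.take_take]
    congr 4
    omega

theorem blockLen_restrict (G : Finset U) (ε : ℝ) (st : PIGState U ℓ) (hI : st.I.Nonempty) (s : ℕ)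
    (L : Fin ℓ → List U) :
    blockLen (fun S => if S ∈ blockQueries G st s L then f S else 0) G ε st hI s L =
      blockLen f G ε st hI s L := by
  unfold blockLen
  refine Finset.inf'_congr hI rfl fun j hj => ?_
  rw [blockMarks_restrict G st s L hj]

theorem blockNext_restrict (G : Finset U) (ε : ℝ) (st : PIGState U ℓ) (hI : st.I.Nonempty) (s : ℕ)
    (L : Fin ℓ → List U) :
    blockNext (fun S => if S ∈ blockQueries G st s L then f S else 0) G ε st hI s L =
      blockNext f G ε st hI s L := by
  have h : ∀ j ∈ st.I,
      blockSel (fun S => if S ∈ blockQueries G st s L then f S else 0) G ε st hI s L j =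
      blockSel f G ε st hI s L j := fun j hj => by
    unfold blockSel
    rw [blockLen_restrict, blockMarks_restrict G st s L hj]
  unfold blockNext
  congr 1
  · funext j
    by_cases hj : j ∈ st.I
    · rw [if_pos hj, if_pos hj, h j hj]
    · rw [if_neg hj, if_neg hj]
  · funext j
    by_cases hj : j ∈ st.I
    · rw [if_pos hj, if_pos hj, h j hj]
    · rw [if_neg hj, if_neg hj]

theorem queriesLE_addBlock [Fintype U] (G : Finset U) (ε : ℝ) (m₀ : ℕ) (st : PIGState U ℓ)
    (hI : st.I.Nonempty) :
    QueriesLE (ℓ * (Fintype.card U + 1)) (addBlock G ε m₀ st hI) := by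
  rw [addBlock_eq]
  refine (queriesLE_distribute _ _ _).bind fun D => (queriesLE_permuteAll _ _ _).bind fun L =>
    (queriesLE_ask ?_).bind fun ans => queriesLE_pure _ _
  unfold blockQueries
  refine (Finset.card_biUnion_le_card_mul st.I _ (Fintype.card U + 1) fun j _ => ?_).trans ?_
  · refine Finset.card_image_le.trans ?_
    rw [Finset.card_range]
    obtain ⟨j, hj⟩ := hI
    have h1 : blockSize m₀ st.I ⟨j, hj⟩ D ≤ (D j).card :=
      (min_le_right _ _).trans (Finset.inf'_le _ hj)
    have h2 := Finset.card_le_univ (D j)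
    omega
  · exact Nat.mul_le_mul_right _ ((Finset.card_le_univ st.I).trans_eq (Fintype.card_fin ℓ))

end Block

/-! ### What the single step and the block step have in common. -/

section Pass

variable {U : Type} {ℓ : ℕ} {f : Finset U → ℝ}

/-- The effect of one pass of the while loop that adds `s` elements to each solution that stays
active. -/
structure Pass (f : Finset U → ℝ) (G : Finset U) (τmin ε : ℝ) (st st₂ : PIGState U ℓ) (s : ℕ) :
    Prop where
  I_sub : st₂.I ⊆ st.I
  A_sub : ∀ j, st.A j ⊆ st₂.A j
  new : ∀ j, ∀ x ∈ st₂.A j \ st.A j, x ∉ used st.A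
  card : ∀ j ∈ st₂.I, (st₂.A j).card = (st.A j).card + s
  same : ∀ j ∉ st₂.I, st₂.A j = st.A j ∧ st₂.A' j = st.A' j
  active : ∀ j ∈ st₂.I, τmin ≤ st₂.τ j
  τ_le : ∀ j, st₂.τ j ≤ st.τ j
  gain_le : ∀ j ∈ st₂.I, f (G ∪ st.A' j) + (1 - ε) * s * st₂.τ j ≤ f (G ∪ st₂.A' j)
  charge_le : ∀ i j, i ≤ j → ∀ x ∈ st₂.A j \ st.A j,
    gain f x (G ∪ st.A i) ≤ price τmin ε (st₂.τ i)
  charge : s = 1 ∨ ∀ i j, ∀ x ∈ st₂.A j \ st.A j, gain f x (G ∪ st.A i) ≤ price τmin ε (st₂.τ i)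

theorem Pass.of_update {G : Finset U} {τmin ε : ℝ} {st st₂ : PIGState U ℓ} {s : ℕ}
    {I : Finset (Fin ℓ)} {V : Fin ℓ → Finset U} {τ : Fin ℓ → ℝ} (hI : I ⊆ st.I)
    (hτ : ∀ j, τ j ≤ st.τ j)
    (h : Pass f G τmin ε { st with I := I, V := V, τ := τ } st₂ s) :
    Pass f G τmin ε st st₂ s where
  I_sub := h.I_sub.trans hI
  A_sub := h.A_sub
  new := h.new
  card := h.card
  same := h.same
  active := h.active
  τ_le j := (h.τ_le j).trans (hτ j)
  gain_le := h.gain_le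
  charge_le := h.charge_le
  charge := h.charge

/-- A pass whose update deactivates every solution counts as adding zero elements, so that all exits
of the loop are passes. -/
theorem pass_stop {G : Finset U} {τmin ε : ℝ} {st : PIGState U ℓ} (hI : st.I = ∅) :
    Pass f G τmin ε st st 0 where
  I_sub := subset_rfl
  A_sub _ := subset_rfl
  new j x hx := by simp at hx
  card _ _ := rfl
  same _ _ := ⟨rfl, rfl⟩
  active j hj := by simp [hI] at hj
  τ_le _ := le_rfl
  gain_le j _ := by simp
  charge_le i j _ x hx := by simp at hx
  charge := Or.inr fun i j x hx => by simp at hx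

variable [Fintype U]

theorem Singles.pass (hf : IsSubmodular f) {G : Finset U} {τmin ε : ℝ} (hm : 0 < τmin)
    (h0 : 0 < ε) {js : List (Fin ℓ)} {st st₂ : PIGState U ℓ} (hst : PIGInv f G τmin ε st)
    (hjs : ∀ j, j ∈ js ↔ j ∈ st.I) (h : Singles f G τmin ε js st st₂) :
    Pass f G τmin ε st st₂ 1 := by
  have hnew : ∀ j, ∀ x ∈ st₂.A j \ st.A j, x ∉ used st.A ∧ j ∈ js ∧
      ∀ i ∈ js, i ≤ j → gain f x (G ∪ st.A i) ≤ price τmin ε (st₂.τ i) := by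
    intro j x hx
    obtain ⟨hx1, hx2⟩ := Finset.mem_sdiff.1 hx
    by_cases hj : j ∈ js
    · rcases h.mem j hj with ⟨-, h2, -⟩ | ⟨-, -, y, h3, h4, -, -, h7⟩
      · rw [h2] at hx1; exact absurd hx1 hx2
      · rw [h4, Finset.mem_insert] at hx1
        rcases hx1 with rfl | hx1
        · exact ⟨h3, hj, h7⟩
        · exact absurd hx1 hx2
    · rw [(h.out j hj).1] at hx1
      exact absurd hx1 hx2
  have hI : st₂.I ⊆ st.I := fun j hj => by
    by_cases hjj : j ∈ js
    · exact (hjs j).1 hjj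
    · exact (h.out j hjj).2.2.2.1 hj
  have hkept : ∀ j ∈ st₂.I, τmin ≤ st₂.τ j ∧ ∃ x ∉ used st.A, st₂.A j = insert x (st.A j) ∧
      st₂.A' j = insert x (st.A' j) ∧ st₂.τ j ≤ gain f x (G ∪ st.A j) := fun j hj => by
    rcases h.mem j ((hjs j).2 (hI hj)) with h1 | ⟨-, h2, x, h3, h4, h5, h6, -⟩
    · exact absurd hj h1.1
    · exact ⟨h2, x, h3, h4, h5, h6⟩
  refine ⟨hI, h.subset, fun j x hx => (hnew j x hx).1, ?_, ?_, fun j hj => (hkept j hj).1, h.τ_le,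
    ?_, ?_, Or.inl rfl⟩
  · intro j hj
    obtain ⟨-, x, h3, h4, -⟩ := hkept j hj
    rw [h4, Finset.card_insert_of_notMem fun hc => h3 (subset_used _ j hc)]
  · intro j hj
    by_cases hjj : j ∈ js
    · rcases h.mem j hjj with h1 | h1
      · exact ⟨h1.2.1, h1.2.2.1⟩
      · exact absurd h1.1 hj
    · exact ⟨(h.out j hjj).1, (h.out j hjj).2.1⟩
  · intro j hj
    obtain ⟨h2, x, h3, h4, h5, h6⟩ := hkept j hj
    have h7 := hf.le_gain_of_le (Finset.union_subset_union_right (s := G) (hst.sub j))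
      (hm.trans_le h2) h6
    rw [h5, Finset.union_insert]
    unfold gain at h7
    have : 0 ≤ ε * st₂.τ j := mul_nonneg h0.le (hm.le.trans h2)
    push_cast
    linarith
  · intro i j hij x hx
    obtain ⟨h1, h2, h3⟩ := hnew j x hx
    by_cases hi : i ∈ js
    · exact h3 i hi hij
    · rw [(h.out i hi).2.2.1]
      exact hst.avail i x h1

end Pass

/-! ### The block step keeps the invariants and is a pass. -/

section BlockPass

variable {U : Type} {ℓ : ℕ} {f : Finset U → ℝ}

/-- The new elements of solution `j`. -/
def blockSet (f : Finset U → ℝ) (G : Finset U) (ε : ℝ) (st : PIGState U ℓ)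
    (hI : st.I.Nonempty) (s : ℕ) (L : Fin ℓ → List U) (j : Fin ℓ) : Finset U :=
  ((blockSel f G ε st hI s L j).map Prod.fst).toFinset

/-- What is known about the candidates of solution `j` when a block is added. -/
structure BlockReady (f : Finset U → ℝ) (G : Finset U) (τmin ε : ℝ) (st : PIGState U ℓ)
    (m₀ : ℕ) (hI : st.I.Nonempty) (D : Fin ℓ → Finset U) (L : Fin ℓ → List U) : Prop where
  pos : 0 < m₀
  thr : ∀ j ∈ st.I, τmin ≤ st.τ j
  gain_ge : ∀ j ∈ st.I, ∀ x ∈ st.V j, st.τ j ≤ gain f x (G ∪ st.A j) ∧ x ∉ used st.A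
  big : ∀ j ∈ st.I, 2 * ℓ ≤ (st.V j).card
  split : IsSplit st.I st.V D
  order : IsOrdering D (st.I.sort (· ≤ ·)) L

namespace BlockReady

variable {G : Finset U} {τmin ε : ℝ} {st : PIGState U ℓ} {m₀ : ℕ} {hI : st.I.Nonempty}
  {D : Fin ℓ → Finset U} {L : Fin ℓ → List U}

theorem perm (h : BlockReady f G τmin ε st m₀ hI D L) {j : Fin ℓ} (hj : j ∈ st.I) :
    (L j).Perm (D j).toList := h.order j ((Finset.mem_sort _).2 hj)

theorem nodup (h : BlockReady f G τmin ε st m₀ hI D L) {j : Fin ℓ} (hj : j ∈ st.I) :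
    (L j).Nodup := (h.perm hj).nodup_iff.2 (Finset.nodup_toList _)

theorem mem_iff (h : BlockReady f G τmin ε st m₀ hI D L) {j : Fin ℓ} (hj : j ∈ st.I) {x : U} :
    x ∈ L j ↔ x ∈ D j := by rw [(h.perm hj).mem_iff, Finset.mem_toList]

theorem length_eq (h : BlockReady f G τmin ε st m₀ hI D L) {j : Fin ℓ} (hj : j ∈ st.I) :
    (L j).length = (D j).card := by rw [(h.perm hj).length_eq, Finset.length_toList]

theorem size_le (_ : BlockReady f G τmin ε st m₀ hI D L) {j : Fin ℓ} (hj : j ∈ st.I) :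
    blockSize m₀ st.I hI D ≤ (D j).card :=
  (min_le_right _ _).trans (Finset.inf'_le _ hj)

theorem two_le_card (h : BlockReady f G τmin ε st m₀ hI D L) {j : Fin ℓ} (hj : j ∈ st.I) :
    2 ≤ (D j).card := by
  rw [h.split.card j hj, Nat.le_div_iff_mul_le (Finset.card_pos.2 hI)]
  refine le_trans (Nat.mul_le_mul_left 2 ?_) (h.big j hj)
  exact (Finset.card_le_univ st.I).trans_eq (Fintype.card_fin ℓ)

theorem size_pos (h : BlockReady f G τmin ε st m₀ hI D L) : 0 < blockSize m₀ st.I hI D := by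
  refine lt_min h.pos ?_
  rw [Finset.lt_inf'_iff]
  intro j hj
  have := h.two_le_card hj
  omega

theorem not_mem (hm : 0 < τmin) (h : BlockReady f G τmin ε st m₀ hI D L) {j : Fin ℓ}
    (hj : j ∈ st.I) {x : U} (hx : x ∈ L j) : x ∉ G ∪ st.A j ∧ x ∉ used st.A := by
  have h1 := h.gain_ge j hj x (h.split.sub j hj ((h.mem_iff hj).1 hx))
  refine ⟨fun hc => ?_, h1.2⟩
  have h2 := h.thr j hj
  rw [gain_of_mem hc] at h1
  linarith [h1.1]

/-- All candidates are current, so the first element of every ordering is good; hence a block step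
always uses up capacity. -/
theorem one_le_prefixLength (h0 : 0 < ε)
    (h : BlockReady f G τmin ε st m₀ hI D L) {j : Fin ℓ} (hj : j ∈ st.I) :
    1 ≤ prefixLength ε (blockSize m₀ st.I hI D)
      (blockMarks f G st (blockSize m₀ st.I hI D) L j) := by
  have hs := h.size_pos
  have hs' := h.size_le hj
  refine le_prefixLength hs ?_
  unfold blockMarks
  have hl := h.length_eq hj
  rcases hL : L j with _ | ⟨v, vs⟩
  · rw [hL] at hl; simp at hl; omega
  · obtain ⟨s, hs⟩ : ∃ s, blockSize m₀ st.I hI D = s + 1 := ⟨_, (Nat.succ_pred_eq_of_pos hs).symm⟩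
    have hg := (h.gain_ge j hj v (h.split.sub j hj
      ((h.mem_iff hj).1 (by rw [hL]; simp)))).1
    unfold gain at hg
    rw [hs, List.take_succ_cons, markList, if_pos hg]
    simp [goodCount, h0.le]

theorem len_le (_ : BlockReady f G τmin ε st m₀ hI D L) {j : Fin ℓ} (hj : j ∈ st.I) (s : ℕ) :
    blockLen f G ε st hI s L ≤ prefixLength ε s (blockMarks f G st s L j) :=
  Finset.inf'_le _ hj

theorem one_le_len (h0 : 0 < ε) (h : BlockReady f G τmin ε st m₀ hI D L) :
    1 ≤ blockLen f G ε st hI (blockSize m₀ st.I hI D) L := by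
  unfold blockLen
  rw [Finset.le_inf'_iff]
  exact fun j hj => h.one_le_prefixLength h0 hj

theorem len_le_size (_ : BlockReady f G τmin ε st m₀ hI D L) (s : ℕ) :
    blockLen f G ε st hI s L ≤ s := by
  obtain ⟨j, hj⟩ := hI
  exact (Finset.inf'_le _ hj).trans (prefixLength_le _ _ _)

/-- The entries from which `threePass` selects. -/
theorem marks_take (h : BlockReady f G τmin ε st m₀ hI D L) {j : Fin ℓ} (hj : j ∈ st.I) {n : ℕ}
    (hn : n ≤ blockSize m₀ st.I hI D) :
    (blockMarks f G st (blockSize m₀ st.I hI D) L j).take n =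
      markList f (st.τ j) (G ∪ st.A j) ((L j).take n) ∧ ((L j).take n).length = n := by
  have h1 := h.length_eq hj
  have h2 := h.size_le hj
  unfold blockMarks
  rw [take_markList, List.take_take, min_eq_left hn, List.length_take]
  exact ⟨rfl, by omega⟩

theorem blockSet_subset (h : BlockReady f G τmin ε st m₀ hI D L) {j : Fin ℓ} (hj : j ∈ st.I) :
    blockSet f G ε st hI (blockSize m₀ st.I hI D) L j ⊆ D j := by
  intro x hx
  unfold blockSet at hx
  rw [List.mem_toFinset, List.mem_map] at hx
  obtain ⟨p, hp, rfl⟩ := hx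
  unfold blockSel at hp
  have hp := threePass_subset _ _ hp
  rw [(h.marks_take hj (prefixLength_le _ _ _)).1] at hp
  have : p.1 ∈ (markList f (st.τ j) (G ∪ st.A j) ((L j).take (prefixLength ε
    (blockSize m₀ st.I hI D) (blockMarks f G st (blockSize m₀ st.I hI D) L j)))).map Prod.fst :=
    List.mem_map_of_mem hp
  rw [map_fst_markList] at this
  exact (h.mem_iff hj).1 (List.mem_of_mem_take this)

theorem card_blockSet (h : BlockReady f G τmin ε st m₀ hI D L) {j : Fin ℓ} (hj : j ∈ st.I) :
    (blockSet f G ε st hI (blockSize m₀ st.I hI D) L j).card =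
      blockLen f G ε st hI (blockSize m₀ st.I hI D) L := by
  set s := blockSize m₀ st.I hI D
  obtain ⟨hb, hlen⟩ := h.marks_take hj (prefixLength_le ε s (blockMarks f G st s L j))
  have hnd := (h.nodup hj).sublist (List.take_sublist
    (prefixLength ε s (blockMarks f G st s L j)) (L j))
  unfold blockSet blockSel
  rw [hb, List.toFinset_card_of_nodup, List.length_map, length_threePass]
  · rw [length_markList, hlen]
    exact h.len_le hj s
  · refine List.Nodup.map_on ?_ (nodup_threePass (nodup_markList hnd))
    intro x hx y hy hxy
    refine List.inj_on_of_nodup_map ?_ (threePass_subset _ _ hx) (threePass_subset _ _ hy) hxy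
    rw [map_fst_markList]
    exact hnd

/-- The first `n` entries contain at least `(1 - ε) * n` good ones and `i ≤ n`; reading good entries
first, the selection contains at least `(1 - ε) * i` of them, each worth the threshold. The second
bound is `drop_bad_le` started at `Y = T`. -/
theorem value_bounds (hf : IsSubmodular f) (hm : 0 < τmin) (h0 : 0 < ε) (h1 : ε < 1)
    (h : BlockReady f G τmin ε st m₀ hI D L) {j : Fin ℓ} (hj : j ∈ st.I) {X : Finset U}
    (hX : X ⊆ G ∪ st.A j) :
    f X + (1 - ε) * blockLen f G ε st hI (blockSize m₀ st.I hI D) L * st.τ j ≤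
      f (X ∪ (((blockSel f G ε st hI (blockSize m₀ st.I hI D) L j).filter fun p =>
        decide (p.2 ≠ Mark.bad)).map Prod.fst).toFinset) ∧
    f (G ∪ st.A j ∪ blockSet f G ε st hI (blockSize m₀ st.I hI D) L j) - f (G ∪ st.A j) ≤
      f (X ∪ (((blockSel f G ε st hI (blockSize m₀ st.I hI D) L j).filter fun p =>
        decide (p.2 ≠ Mark.bad)).map Prod.fst).toFinset) - f X := by
  set s := blockSize m₀ st.I hI D
  set n := prefixLength ε s (blockMarks f G st s L j) with hn
  obtain ⟨hb, hlen⟩ := h.marks_take hj (prefixLength_le ε s (blockMarks f G st s L j))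
  have hnd := (h.nodup hj).sublist (List.take_sublist n (L j))
  have hd : ∀ v ∈ (L j).take n, v ∉ G ∪ st.A j := fun v hv =>
    (h.not_mem hm hj (List.mem_of_mem_take hv)).1
  set i := blockLen f G ε st hI s L with hi
  have hin : i ≤ n := h.len_le hj s
  set b := markList f (st.τ j) (G ∪ st.A j) ((L j).take n) with hbdef
  have hsel : blockSel f G ε st hI s L j = threePass i b := by
    unfold blockSel
    rw [hb]
  have hbn : b.Nodup := nodup_markList hnd
  obtain ⟨q, hq⟩ : ∃ q : U × Mark → Prop, ∀ p, q p ↔ p ∈ threePass i b := ⟨_, fun _ => Iff.rfl⟩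
  have hS' : ((b.filter fun p => q p ∧ p.2 ≠ Mark.bad).map Prod.fst).toFinset =
      (((threePass i b).filter fun p => decide (p.2 ≠ Mark.bad)).map Prod.fst).toFinset := by
    ext x
    simp only [List.mem_toFinset, List.mem_map, List.mem_filter, decide_eq_true_eq, hq]
    constructor
    · rintro ⟨p, ⟨-, h1, h2⟩, h3⟩
      exact ⟨p, ⟨h1, h2⟩, h3⟩
    · rintro ⟨p, ⟨h1, h2⟩, h3⟩
      exact ⟨p, ⟨threePass_subset _ _ h1, h1, h2⟩, h3⟩
  have hS : ((b.filter fun p => q p).map Prod.fst).toFinset =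
      ((threePass i b).map Prod.fst).toFinset := by
    ext x
    simp only [List.mem_toFinset, List.mem_map, List.mem_filter, decide_eq_true_eq, hq]
    constructor
    · rintro ⟨p, ⟨-, h1⟩, h3⟩
      exact ⟨p, h1, h3⟩
    · rintro ⟨p, h1, h3⟩
      exact ⟨p, ⟨threePass_subset _ _ h1, h1⟩, h3⟩
  unfold blockSet
  rw [hsel, ← hS', ← hS]
  constructor
  · have hgg := good_gain_le hf (τ := st.τ j) q ((L j).take n) hnd (G ∪ st.A j) X hX hd
    rw [← hbdef] at hgg
    refine le_trans ?_ hgg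
    have hcount : goodCount (threePass i b) ≤
        (b.filter fun p => q p ∧ p.2 = Mark.good).length := by
      rw [goodCount_eq]
      refine (List.subperm_of_subset ((nodup_threePass hbn).filter _) ?_).length_le
      intro p hp
      obtain ⟨h1, h2⟩ := List.mem_filter.1 hp
      rw [decide_eq_true_eq] at h2
      refine List.mem_filter.2 ⟨threePass_subset _ _ h1, ?_⟩
      rw [decide_eq_true_eq]
      exact ⟨(hq p).2 h1, h2⟩
    have hgood : (1 - ε) * i ≤ goodCount (threePass i b) := by
      have h2 := prefixLength_spec ε s (blockMarks f G st s L j)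
      rw [hb] at h2
      have h3 : ((min i (goodCount b) : ℕ) : ℝ) ≤ goodCount (threePass i b) := by
        exact_mod_cast min_le_goodCount_threePass i b
      refine le_trans ?_ h3
      rw [Nat.cast_min, le_min_iff]
      constructor
      · have : (0 : ℝ) ≤ i := Nat.cast_nonneg i
        nlinarith
      · refine le_trans ?_ h2
        refine mul_le_mul_of_nonneg_left ?_ (by linarith)
        exact_mod_cast hin
    have hτ : 0 ≤ st.τ j := hm.le.trans (h.thr j hj)
    have : (goodCount (threePass i b) : ℝ) ≤
        (b.filter fun p => q p ∧ p.2 = Mark.good).length := by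
      exact_mod_cast hcount
    have h5 := mul_le_mul_of_nonneg_right (hgood.trans this) hτ
    linarith
  · refine drop_bad_le hf (τ := st.τ j) q ((L j).take n) hnd
      (G ∪ st.A j) (G ∪ st.A j) X hX subset_rfl hd ?_ (Or.inl rfl)
    refine (pairwise_threePass i hbn).imp ?_
    intro x y hxy hy hbad
    exact (hq x).2 (hxy ((hq y).1 hy) hbad)

variable [Fintype U]

theorem next_inv (hf : IsSubmodular f) (hm : 0 < τmin) (h0 : 0 < ε) (h1 : ε < 1)
    (hst : PIGInv f G τmin ε st) (h : BlockReady f G τmin ε st m₀ hI D L) :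
    PIGInv f G τmin ε (blockNext f G ε st hI (blockSize m₀ st.I hI D) L) := by
  set s := blockSize m₀ st.I hI D
  have hA : ∀ j ∈ st.I, (blockNext f G ε st hI s L).A j =
      st.A j ∪ blockSet f G ε st hI s L j := fun j hj => if_pos hj
  have hAn : ∀ j ∉ st.I, (blockNext f G ε st hI s L).A j = st.A j := fun j hj => if_neg hj
  have hA' : ∀ j ∈ st.I, (blockNext f G ε st hI s L).A' j =
      st.A' j ∪ (((blockSel f G ε st hI s L j).filter fun p =>
        decide (p.2 ≠ Mark.bad)).map Prod.fst).toFinset := fun j hj => if_pos hj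
  have hAn' : ∀ j ∉ st.I, (blockNext f G ε st hI s L).A' j = st.A' j := fun j hj => if_neg hj
  have hsub : ∀ j, st.A j ⊆ (blockNext f G ε st hI s L).A j := fun j => by
    by_cases hj : j ∈ st.I
    · rw [hA j hj]; exact Finset.subset_union_left
    · rw [hAn j hj]
  have hnew : ∀ j ∈ st.I, ∀ i, Disjoint (blockSet f G ε st hI s L j) (st.A i) := by
    intro j hj i
    rw [Finset.disjoint_left]
    intro x hx hxi
    exact (h.not_mem hm hj ((h.mem_iff hj).2 (h.blockSet_subset hj hx))).2 (subset_used _ i hxi)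
  refine ⟨?_, ?_, ?_, ?_, ?_, hst.inactive⟩
  · intro a b hab
    have h2 := hst.disj a b hab
    by_cases ha : a ∈ st.I <;> by_cases hb : b ∈ st.I
    · rw [hA a ha, hA b hb, Finset.disjoint_union_left, Finset.disjoint_union_right,
        Finset.disjoint_union_right]
      exact ⟨⟨h2, (hnew b hb a).symm⟩, hnew a ha b, (h.split.disj a b hab).mono
        (h.blockSet_subset ha) (h.blockSet_subset hb)⟩
    · rw [hA a ha, hAn b hb, Finset.disjoint_union_left]
      exact ⟨h2, hnew a ha b⟩
    · rw [hAn a ha, hA b hb, Finset.disjoint_union_right]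
      exact ⟨h2, (hnew b hb a).symm⟩
    · rw [hAn a ha, hAn b hb]
      exact h2
  · intro j
    by_cases hj : j ∈ st.I
    · rw [hA j hj]
      rw [hA' j hj]
      refine Finset.union_subset_union (hst.sub j) ?_
      intro x hx
      unfold blockSet
      rw [List.mem_toFinset, List.mem_map] at hx ⊢
      obtain ⟨p, hp, rfl⟩ := hx
      exact ⟨p, (List.mem_filter.1 hp).1, rfl⟩
    · rw [hAn j hj]
      rw [hAn' j hj]
      exact hst.sub j
  · intro j
    by_cases hj : j ∈ st.I
    · rw [hA j hj]
      rw [hA' j hj]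
      have := (h.value_bounds hf hm h0 h1 hj
        (Finset.union_subset_union_right (s := G) (hst.sub j))).2
      have := hst.le j
      rw [← Finset.union_assoc, ← Finset.union_assoc]
      linarith
    · rw [hAn j hj]
      rw [hAn' j hj]
      exact hst.le j
  · intro i y hy
    have hyA : y ∉ used st.A := fun hc => hy (used_mono hsub hc)
    refine le_trans ?_ (hst.avail i y hyA)
    refine hf.gain_anti (Finset.union_subset_union_right (hsub i)) ?_
    by_cases hG : y ∈ G
    · exact Or.inl (Finset.mem_union_left _ hG)
    · refine Or.inr fun hc => ?_
      rcases Finset.mem_union.1 hc with hc | hc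
      · exact hG hc
      · exact hy (subset_used _ i hc)
  · intro i
    exact (cand_anti hf hsub i _).trans (hst.vsup i)

theorem next_pass (hf : IsSubmodular f) (hm : 0 < τmin) (h0 : 0 < ε) (h1 : ε < 1)
    (hst : PIGInv f G τmin ε st) (h : BlockReady f G τmin ε st m₀ hI D L) :
    Pass f G τmin ε st (blockNext f G ε st hI (blockSize m₀ st.I hI D) L)
      (blockLen f G ε st hI (blockSize m₀ st.I hI D) L) := by
  set s := blockSize m₀ st.I hI D
  have hA : ∀ j ∈ st.I, (blockNext f G ε st hI s L).A j =
      st.A j ∪ blockSet f G ε st hI s L j := fun j hj => if_pos hj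
  have hAn : ∀ j ∉ st.I, (blockNext f G ε st hI s L).A j = st.A j := fun j hj => if_neg hj
  have hdis : ∀ j ∈ st.I, Disjoint (st.A j) (blockSet f G ε st hI s L j) := by
    intro j hj
    rw [Finset.disjoint_right]
    intro x hx hxi
    exact (h.not_mem hm hj ((h.mem_iff hj).2 (h.blockSet_subset hj hx))).2 (subset_used _ j hxi)
  have hnew : ∀ j, ∀ x ∈ (blockNext f G ε st hI s L).A j \ st.A j, x ∉ used st.A := by
    intro j x hx
    obtain ⟨hx1, hx2⟩ := Finset.mem_sdiff.1 hx
    by_cases hj : j ∈ st.I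
    · rw [hA j hj, Finset.mem_union] at hx1
      rcases hx1 with hx1 | hx1
      · exact absurd hx1 hx2
      · exact (h.not_mem hm hj ((h.mem_iff hj).2 (h.blockSet_subset hj hx1))).2
    · rw [hAn j hj] at hx1
      exact absurd hx1 hx2
  refine ⟨subset_rfl, ?_, hnew, ?_, ?_, h.thr, fun j => le_rfl, ?_, ?_, ?_⟩
  · intro j
    by_cases hj : j ∈ st.I
    · rw [hA j hj]; exact Finset.subset_union_left
    · rw [hAn j hj]
  · intro j hj
    rw [hA j hj, Finset.card_union_of_disjoint (hdis j hj), h.card_blockSet hj]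
  · intro j hj
    exact ⟨hAn j hj, if_neg hj⟩
  · intro j hj
    have h2 := (h.value_bounds hf hm h0 h1 hj
        (Finset.union_subset_union_right (s := G) (hst.sub j))).1
    have hA' : (blockNext f G ε st hI s L).A' j = _ := if_pos hj
    rw [hA', ← Finset.union_assoc]
    exact h2
  · intro i j _ x hx
    exact hst.avail i x (hnew j x hx)
  · exact Or.inr fun i j x hx => hst.avail i x (hnew j x hx)

end BlockReady

end BlockPass

/-! ### The accounting for a pair of solutions. -/

section Pairs

variable {U : Type} {ℓ : ℕ} {f : Finset U → ℝ}

/-- The value that the optimal elements of solution `h` add to solution `l`. -/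
def cross (f : Finset U → ℝ) (G O : Finset U) (st : PIGState U ℓ) (h l : Fin ℓ) : ℝ :=
  f (G ∪ st.A l ∪ (st.A h ∩ O)) - f (G ∪ st.A l)

/-- The value that solution `j` adds to `G`. -/
def value (f : Finset U → ℝ) (G : Finset U) (st : PIGState U ℓ) (j : Fin ℓ) : ℝ :=
  f (G ∪ st.A' j) - f G

/-- The spare value of solution `l` against the optimal elements of solution `h`. -/
def spare (O : Finset U) (τmin ε : ℝ) (st : PIGState U ℓ) (h l : Fin ℓ) (δ : ℝ) : ℝ :=
  if l ∈ st.I then ((st.A l).card - (st.A h ∩ O).card + δ) * price τmin ε (st.τ l)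
  else -((st.A h ∩ O).card * (τmin / (1 - ε)))

/-- The invariant for a pair of solutions `h < l`: either both consist of optimal elements, or
what they can gain from each other's optimal elements is paid for by their values. -/
def PairInv (f : Finset U → ℝ) (G O : Finset U) (τmin ε : ℝ) (st : PIGState U ℓ)
    (h l : Fin ℓ) : Prop :=
  (h ∈ st.I ∧ l ∈ st.I ∧ st.A h ⊆ O ∧ st.A l ⊆ O ∧ (st.A h).card = (st.A l).card) ∨
  ∃ δ : ℝ, 0 ≤ δ ∧ δ ≤ 1 ∧
    cross f G O st h l + cross f G O st l h + spare O τmin ε st h l δ +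
      spare O τmin ε st l h (-δ) ≤ ((1 - ε) ^ 2)⁻¹ * (value f G st h + value f G st l) ∧
    (l ∈ st.I → 0 ≤ ((st.A l).card : ℝ) - (st.A h ∩ O).card + δ) ∧
    (h ∈ st.I → 0 ≤ ((st.A h).card : ℝ) - (st.A l ∩ O).card - δ) ∧
    (h ∈ st.I → l ∈ st.I → 1 ≤ ((st.A l).card : ℝ) - (st.A h ∩ O).card + δ)

variable {G O : Finset U} {τmin ε : ℝ} {st st₂ : PIGState U ℓ} {s : ℕ}

theorem inter_card_pass (hp : Pass f G τmin ε st st₂ s) (h : Fin ℓ) :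
    (st₂.A h ∩ O).card = (st.A h ∩ O).card + ((st₂.A h \ st.A h) ∩ O).card := by
  rw [← Finset.card_union_of_disjoint]
  · congr 1
    have := hp.A_sub h
    ext x
    simp only [Finset.mem_union, Finset.mem_inter, Finset.mem_sdiff]
    have := @this x
    tauto
  · exact Finset.disjoint_sdiff.mono Finset.inter_subset_left Finset.inter_subset_left

/-- The two factors `1 - ε` are the share of good elements and the ratio of threshold to price.
After scaling, every element taken is worth a full unit of the price. -/
theorem gain_value (hε : 0 < 1 - ε) (hp : Pass f G τmin ε st st₂ s) {j : Fin ℓ}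
    (hj : j ∈ st₂.I) :
    ((1 - ε) ^ 2)⁻¹ * value f G st j + s * price τmin ε (st₂.τ j) ≤
      ((1 - ε) ^ 2)⁻¹ * value f G st₂ j := by
  have h1 := hp.gain_le j hj
  rw [price_of_le (hp.active j hj)]
  have h2 : (s : ℝ) * (st₂.τ j / (1 - ε)) =
      ((1 - ε) ^ 2)⁻¹ * ((1 - ε) * s * st₂.τ j) := by
    field_simp
  rw [h2, ← mul_add]
  refine mul_le_mul_of_nonneg_left ?_ (by positivity)
  unfold value
  linarith

variable [Fintype U]

/-- Each new optimal element of `h` costs at most its gain over the old `G ∪ A l`. The old optimal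
elements cost less over the larger `A l`, as the two solutions are disjoint. -/
theorem cross_pass_le (hf : IsSubmodular f) (hst₂ : PIGInv f G τmin ε st₂)
    (hp : Pass f G τmin ε st st₂ s) {h l : Fin ℓ} (hhl : h ≠ l) {κ : ℝ} (hκ0 : 0 ≤ κ)
    (hκ : ∀ x ∈ st₂.A h \ st.A h, gain f x (G ∪ st.A l) ≤ κ) :
    cross f G O st₂ h l ≤ cross f G O st h l + ((st₂.A h \ st.A h) ∩ O).card * κ := by
  have hdis := hst₂.disj h l hhl
  have h1 := hf.union_sub_le_card_mul (B := G ∪ st.A l) (C := G ∪ st₂.A l ∪ (st.A h ∩ O))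
    ((Finset.union_subset_union_right (hp.A_sub l)).trans Finset.subset_union_left) hκ0
    ((st₂.A h \ st.A h) ∩ O) (fun x hx => hκ x (Finset.mem_inter.1 hx).1)
  have h2 := hf.union_sub_anti (B := G ∪ st.A l) (C := G ∪ st₂.A l) (N := st.A h ∩ O)
    (Finset.union_subset_union_right (hp.A_sub l)) (by
      intro x hx
      simp only [Finset.mem_inter, Finset.mem_union] at hx ⊢
      rcases hx.2 with h3 | h3
      · exact Or.inl h3
      · exact absurd h3 (Finset.disjoint_left.1 hdis (hp.A_sub h hx.1.1)))
  have h3 : G ∪ st₂.A l ∪ st.A h ∩ O ∪ (st₂.A h \ st.A h) ∩ O =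
      G ∪ st₂.A l ∪ st₂.A h ∩ O := by
    have := hp.A_sub h
    ext x
    simp only [Finset.mem_union, Finset.mem_inter, Finset.mem_sdiff]
    have := @this x
    tauto
  rw [h3] at h1
  unfold cross
  linarith

theorem cross_le_value (hf : IsSubmodular f) (hst : PIGInv f G τmin ε st) {h l : Fin ℓ}
    (hhl : h ≠ l) (hO : st.A h ⊆ O) : cross f G O st h l ≤ value f G st h := by
  have h2 := hf.union_sub_anti (B := G) (C := G ∪ st.A l) (N := st.A h)
    Finset.subset_union_left (by
      intro x hx
      simp only [Finset.mem_inter, Finset.mem_union] at hx ⊢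
      rcases hx.2 with h3 | h3
      · exact h3
      · exact absurd h3 (Finset.disjoint_left.1 (hst.disj h l hhl) hx.1))
  have := hst.le h
  unfold cross value
  rw [Finset.inter_eq_left.2 hO]
  linarith

/-- While `A h` consists of optimal elements, it may be compared with `G` instead of `G ∪ A l`. One
new element is moved to this side, where it costs the price of `h` instead of that of `l`; this is
the unit that `δ = 1` transfers in `PairInv`. -/
theorem cross_pass_le_value (hf : IsSubmodular f) (hst : PIGInv f G τmin ε st)
    (hst₂ : PIGInv f G τmin ε st₂)
    (hp : Pass f G τmin ε st st₂ s) {h l : Fin ℓ} (hhl : h ≠ l) {κ : ℝ} (hκ0 : 0 ≤ κ)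
    (hκ : ∀ x ∈ st₂.A h \ st.A h, gain f x (G ∪ st.A l) ≤ κ) (hO : st.A h ⊆ O)
    (hN : 0 < ((st₂.A h \ st.A h) ∩ O).card) :
    cross f G O st₂ h l ≤ value f G st h + price τmin ε (st₂.τ h) +
      (((st₂.A h \ st.A h) ∩ O).card - 1) * κ := by
  obtain ⟨x, hx⟩ := Finset.card_pos.1 hN
  obtain ⟨hxS, hxO⟩ := Finset.mem_inter.1 hx
  have hx2 := (Finset.mem_sdiff.1 hxS).1
  have hdis := hst₂.disj h l hhl
  set N := ((st₂.A h \ st.A h) ∩ O).erase x with hNdef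
  have hNc : (N.card : ℝ) = ((st₂.A h \ st.A h) ∩ O).card - 1 := by
    rw [hNdef, Finset.card_erase_of_mem hx, Nat.cast_sub hN]
    simp
  have h1 := hf.union_sub_le_card_mul (B := G ∪ st.A l)
    (C := G ∪ st₂.A l ∪ insert x (st.A h))
    ((Finset.union_subset_union_right (hp.A_sub l)).trans Finset.subset_union_left) hκ0
    N (fun y hy => hκ y (Finset.mem_inter.1 (Finset.mem_of_mem_erase hy)).1)
  have h2 := hf.union_sub_anti (B := G) (C := G ∪ st₂.A l) (N := insert x (st.A h))
    Finset.subset_union_left (by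
      intro y hy
      simp only [Finset.mem_inter, Finset.mem_union, Finset.mem_insert] at hy ⊢
      rcases hy.2 with h3 | h3
      · exact h3
      · refine absurd h3 (Finset.disjoint_left.1 hdis ?_)
        rcases hy.1 with rfl | h4
        · exact hx2
        · exact hp.A_sub h h4)
  have h3 : G ∪ st₂.A l ∪ insert x (st.A h) ∪ N = G ∪ st₂.A l ∪ st₂.A h ∩ O := by
    have h4 := hp.A_sub h
    ext y
    have h5 := @h4 y
    have h6 := @hO y
    simp only [hNdef, Finset.mem_union, Finset.mem_inter, Finset.mem_sdiff, Finset.mem_insert,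
      Finset.mem_erase]
    by_cases hyx : y = x
    · subst hyx; tauto
    · tauto
  have h4 := hp.charge_le h h le_rfl x hxS
  have h5 := hst.le h
  rw [h3, hNc] at h1
  simp only [Finset.union_insert] at h2
  unfold gain at h4
  unfold cross value
  rw [Finset.union_insert] at h1
  linarith

/-- Bookkeeping in units of price. Every element of `l` earns a unit at the price of `l`
(`gain_value`), every optimal element of `h` spends at most one (`cross_pass_le`), and active
solutions grow equally; so the units in stock stay nonnegative, and falling prices only devalue
them. The exception is a single step in which the price of `l` falls after `h` has chosen: the
element of `h` is charged at the old price, and the spare unit required by the last clause of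
`PairInv` pays the difference. Elements of `l` are charged to `h` at its new price, since `h` is
served first. A solution that has dropped out keeps a debt of `τmin / (1 - ε)` per optimal element
of the other. -/
theorem PairInv.pass (hf : IsSubmodular f) (hm : 0 < τmin) (h0 : 0 < ε) (h1 : ε < 1)
    (hst : PIGInv f G τmin ε st) (hst₂ : PIGInv f G τmin ε st₂)
    (hp : Pass f G τmin ε st st₂ s) (hv : ∀ j, 0 ≤ value f G st j) {h l : Fin ℓ} (hhl : h < l)
    (hpair : PairInv f G O τmin ε st h l) : PairInv f G O τmin ε st₂ h l := by
  have hε : 0 < 1 - ε := by linarith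
  have hne : h ≠ l := hhl.ne
  have hΛ : 1 ≤ ((1 - ε) ^ 2)⁻¹ := (one_le_inv₀ (by positivity)).2 (by nlinarith)
  have he : 0 ≤ τmin / (1 - ε) := by positivity
  have hθl : price τmin ε (st₂.τ l) ≤ price τmin ε (st.τ l) := price_mono h1 (hp.τ_le l)
  have hθh : price τmin ε (st₂.τ h) ≤ price τmin ε (st.τ h) := price_mono h1 (hp.τ_le h)
  have hθl0 : 0 ≤ price τmin ε (st₂.τ l) := price_nonneg hm h1
  have hθh0 : 0 ≤ price τmin ε (st₂.τ h) := price_nonneg hm h1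
  have hrh := inter_card_pass (O := O) hp h
  have hrl := inter_card_pass (O := O) hp l
  have hsame : ∀ j ∉ st₂.I, ((st₂.A j \ st.A j) ∩ O).card = 0 ∧ value f G st₂ j = value f G st j ∧
      st₂.A j = st.A j := fun j hj => by
    obtain ⟨a, b⟩ := hp.same j hj
    refine ⟨by rw [a]; simp, by unfold value; rw [b], a⟩
  have hnle : ∀ j ∈ st₂.I, ((st₂.A j \ st.A j) ∩ O).card ≤ s := fun j hj => by
    refine (Finset.card_le_card Finset.inter_subset_left).trans ?_
    rw [Finset.card_sdiff_of_subset (hp.A_sub j), hp.card j hj]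
    omega
  have hBl : cross f G O st₂ l h ≤ cross f G O st l h +
      ((st₂.A l \ st.A l) ∩ O).card * price τmin ε (st₂.τ h) :=
    cross_pass_le hf hst₂ hp hne.symm hθh0 (hp.charge_le h l hhl.le)
  -- the price at which the new elements of `h` are charged to `l`
  obtain ⟨κ, hκ0, hκ, hκ'⟩ : ∃ κ : ℝ, 0 ≤ κ ∧
      (∀ x ∈ st₂.A h \ st.A h, gain f x (G ∪ st.A l) ≤ κ) ∧
      (κ = price τmin ε (st₂.τ l) ∨ (s = 1 ∧ κ = price τmin ε (st.τ l))) := by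
    rcases hp.charge with hs | hc
    · exact ⟨_, price_nonneg hm h1, fun x hx => hst.avail l x (hp.new h x hx), Or.inr ⟨hs, rfl⟩⟩
    · exact ⟨_, hθl0, hc l h, Or.inl rfl⟩
  have hBh := cross_pass_le (O := O) hf hst₂ hp hne hκ0 hκ
  set nh : ℕ := ((st₂.A h \ st.A h) ∩ O).card with hnh
  set nl : ℕ := ((st₂.A l \ st.A l) ∩ O).card with hnl
  set θl := price τmin ε (st.τ l)
  set θh := price τmin ε (st.τ h)
  set θl' := price τmin ε (st₂.τ l) with hθl'def
  set θh' := price τmin ε (st₂.τ h) with hθh'def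
  set e := τmin / (1 - ε) with hedef
  set Λ := ((1 - ε) ^ 2)⁻¹
  have hl2 : l ∉ st₂.I → θl' = e := fun hl => price_of_lt (hst₂.inactive l hl)
  have hh2 : h ∉ st₂.I → θh' = e := fun hl => price_of_lt (hst₂.inactive h hl)
  have hl1 : l ∉ st.I → θl = e := fun hl => price_of_lt (hst.inactive l hl)
  have hrhr : ((st₂.A h ∩ O).card : ℝ) = (st.A h ∩ O).card + nh := by exact_mod_cast hrh
  have hrlr : ((st₂.A l ∩ O).card : ℝ) = (st.A l ∩ O).card + nl := by exact_mod_cast hrl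
  have hnh0 : (0 : ℝ) ≤ nh := Nat.cast_nonneg _
  have hnl0 : (0 : ℝ) ≤ nl := Nat.cast_nonneg _
  have hcard : ∀ j ∈ st₂.I, ((st₂.A j).card : ℝ) = (st.A j).card + s := fun j hj => by
    exact_mod_cast hp.card j hj
  have hnler : ∀ j ∈ st₂.I, (((st₂.A j \ st.A j) ∩ O).card : ℝ) ≤ s := fun j hj => by
    exact_mod_cast hnle j hj
  have hrh0 : (0 : ℝ) ≤ (st.A h ∩ O).card := Nat.cast_nonneg _
  have hrl0 : (0 : ℝ) ≤ (st.A l ∩ O).card := Nat.cast_nonneg _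
  unfold PairInv spare
  rw [hrhr, hrlr]
  rcases hpair with ⟨hh, hl, hhO, hlO, hcc⟩ | ⟨δ, hδ0, hδ1, hineq, hαl, hαh, hα1⟩
  · have hvh := cross_le_value (l := l) hf hst hne hhO
    have hvl := cross_le_value (l := h) hf hst hne.symm hlO
    have hΛh : value f G st h ≤ Λ * value f G st h := le_mul_of_one_le_left (hv h) hΛ
    have hΛl : value f G st l ≤ Λ * value f G st l := le_mul_of_one_le_left (hv l) hΛ
    have hch : (st.A h ∩ O).card = (st.A h).card := by rw [Finset.inter_eq_left.2 hhO]
    have hcl : (st.A l ∩ O).card = (st.A l).card := by rw [Finset.inter_eq_left.2 hlO]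
    have hccr : ((st.A h).card : ℝ) = (st.A l).card := by exact_mod_cast hcc
    have ht0 : (0 : ℝ) ≤ (st.A l).card := Nat.cast_nonneg _
    rw [hch, hcl, hccr]
    by_cases hh : h ∈ st₂.I <;> by_cases hl : l ∈ st₂.I
    · have g1 := gain_value hε hp hh
      have g2 := gain_value hε hp hl
      have hnhs := hnle h hh
      have hnls := hnle l hl
      have hnlr := hnler l hl
      simp only [if_pos hh, if_pos hl]
      rw [hcard h hh, hcard l hl, hccr]
      -- The first alternative ends when one of the two takes an element outside `O`. If `h` does,
      -- this element leaves a spare unit on the side of `l`, and `δ = 0`.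
      rcases Nat.lt_or_ge nh s with hlt | hge
      · have hltr : (nh : ℝ) + 1 ≤ s := by exact_mod_cast hlt
        -- An outdated price occurs only for `s = 1`, and then `nh < s` leaves no element to charge.
        have hk : nh * κ ≤ (nh : ℝ) * θl' := by
          rcases hκ' with rfl | ⟨hs, rfl⟩
          · exact le_rfl
          · have : nh = 0 := by omega
            simp [this]
        refine Or.inr ⟨0, le_rfl, zero_le_one, ?_, fun _ => ?_, fun _ => ?_, fun _ _ => ?_⟩
        · linarith
        · linarith
        · linarith
        · linarith
      · have hnhe : nh = s := le_antisymm hnhs hge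
        have hsub : ∀ j ∈ st₂.I, ((st₂.A j \ st.A j) ∩ O).card = s → st.A j ⊆ O →
            st₂.A j ⊆ O := by
          intro j hj hjc hjO x hx
          by_cases hxA : x ∈ st.A j
          · exact hjO hxA
          · have h5 : (st₂.A j \ st.A j).card = s := by
              rw [Finset.card_sdiff_of_subset (hp.A_sub j), hp.card j hj]
              omega
            have h6 : (st₂.A j \ st.A j) ∩ O = st₂.A j \ st.A j :=
              Finset.eq_of_subset_of_card_le Finset.inter_subset_left (by omega)
            have h7 : x ∈ (st₂.A j \ st.A j) ∩ O := by
              rw [h6]; exact Finset.mem_sdiff.2 ⟨hx, hxA⟩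
            exact (Finset.mem_inter.1 h7).2
        rcases Nat.lt_or_ge nl s with hlt | hge'
        · have hltr : (nl : ℝ) + 1 ≤ s := by exact_mod_cast hlt
          have hnhr : (nh : ℝ) = s := by exact_mod_cast hnhe
          have hB := cross_pass_le_value hf hst hst₂ hp hne hκ0 hκ hhO (by omega)
          rw [← hnh] at hB
          have hk : ((nh : ℝ) - 1) * κ ≤ ((nh : ℝ) - 1) * θl' := by
            rcases hκ' with rfl | ⟨hs, rfl⟩
            · exact le_rfl
            · have : nh = 1 := by omega
              simp [this]
          rw [hnhr] at hk hB ⊢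
          -- Here `h` took only optimal elements and `l` did not, so the counts give `l` no slack.
          -- The surplus unit is on the side of `h`; `hB` exchanges it for a unit of `l`.
          refine Or.inr ⟨1, zero_le_one, le_rfl, ?_, fun _ => ?_, fun _ => ?_, fun _ _ => ?_⟩
          · linarith
          · linarith
          · linarith
          · linarith
        · refine Or.inl ⟨hh, hl, hsub h hh hnhe hhO, hsub l hl (le_antisymm hnls hge') hlO, ?_⟩
          rw [hp.card h hh, hp.card l hl, hcc]
    · obtain ⟨c1, c2, c3⟩ := hsame l hl
      have g1 := gain_value hε hp hh
      have hnhs := hnle h hh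
      have hnlz : (nl : ℝ) = 0 := by exact_mod_cast c1
      simp only [if_pos hh, if_neg hl]
      rw [hcard h hh, c2, c3, hccr, hnlz]
      rw [hnlz] at hBl
      have hs0 : (0 : ℝ) ≤ s := Nat.cast_nonneg _
      have pe := mul_nonneg ht0 he
      have pe' := mul_nonneg hnh0 he
      -- The bound can fail only if `h` took a single element, charged at a price that `l` gave up
      -- before dropping out. That element is then charged to `h` itself, with `δ = 1`.
      by_cases hk : nh * κ ≤ (nh : ℝ) * e
      · refine Or.inr ⟨0, le_rfl, zero_le_one, ?_, fun h => absurd h hl, fun _ => ?_,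
          fun _ h => absurd h hl⟩
        · linarith
        · linarith
      · rcases hκ' with hκe | ⟨hs, -⟩
        · exact absurd (by rw [hκe, hl2 hl]) hk
        · have hnh1 : nh = 1 := by
            rcases Nat.eq_zero_or_pos nh with h3 | h3
            · rw [h3] at hk; simp at hk
            · omega
          have hB := cross_pass_le_value hf hst hst₂ hp hne hκ0 hκ hhO (by omega)
          rw [← hnh] at hB
          have hnhr : (nh : ℝ) = 1 := by exact_mod_cast hnh1
          have hsr : (s : ℝ) = 1 := by exact_mod_cast hs
          rw [hnhr] at hB ⊢
          rw [hsr] at g1 ⊢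
          refine Or.inr ⟨1, zero_le_one, le_rfl, ?_, fun h => absurd h hl, fun _ => ?_,
            fun _ h => absurd h hl⟩
          · linarith
          · linarith
    · obtain ⟨c1, c2, c3⟩ := hsame h hh
      have g2 := gain_value hε hp hl
      have hnhz : (nh : ℝ) = 0 := by exact_mod_cast c1
      simp only [if_neg hh, if_pos hl]
      rw [hcard l hl, c2, hnhz]
      rw [hnhz] at hBh
      rw [hh2 hh] at hBl
      have hs0 : (0 : ℝ) ≤ s := Nat.cast_nonneg _
      have pe := mul_nonneg ht0 he
      refine Or.inr ⟨0, le_rfl, zero_le_one, ?_, fun _ => ?_, fun h => absurd h hh,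
        fun h => absurd h hh⟩
      · linarith
      · linarith
    · obtain ⟨c1, c2, c3⟩ := hsame h hh
      obtain ⟨d1, d2, d3⟩ := hsame l hl
      have hnhz : (nh : ℝ) = 0 := by exact_mod_cast c1
      have hnlz : (nl : ℝ) = 0 := by exact_mod_cast d1
      simp only [if_neg hh, if_neg hl]
      rw [c2, d2, hnhz, hnlz]
      rw [hnhz] at hBh
      rw [hnlz] at hBl
      have pe := mul_nonneg ht0 he
      refine Or.inr ⟨0, le_rfl, zero_le_one, ?_, fun h => absurd h hl, fun h => absurd h hh,
        fun h => absurd h hh⟩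
      linarith
  · unfold spare at hineq
    -- Dropping out forfeits a nonnegative stock and leaves only the debt.
    have hlow_l : l ∉ st₂.I → -((st.A h ∩ O).card * e) ≤
        (if l ∈ st.I then ((st.A l).card - (st.A h ∩ O).card + δ) * θl
          else -((st.A h ∩ O).card * e)) := fun _ => by
      have pe := mul_nonneg hrh0 he
      split
      · rename_i hlI
        have := mul_nonneg (hαl hlI) (hθl0.trans hθl)
        linarith
      · exact le_rfl
    have hlow_h : h ∉ st₂.I → -((st.A l ∩ O).card * e) ≤
        (if h ∈ st.I then ((st.A h).card - (st.A l ∩ O).card + -δ) * θh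
          else -((st.A l ∩ O).card * e)) := fun _ => by
      have pe := mul_nonneg hrl0 he
      split
      · rename_i hhI
        have := mul_nonneg (hαh hhI) (hθh0.trans hθh)
        linarith
      · exact le_rfl
    refine Or.inr ⟨δ, hδ0, hδ1, ?_, ?_, ?_, ?_⟩
    · by_cases hh : h ∈ st₂.I <;> by_cases hl : l ∈ st₂.I
      · have hhI := hp.I_sub hh
        have hlI := hp.I_sub hl
        rw [if_pos hh, if_pos hl, hcard h hh, hcard l hl]
        rw [if_pos hhI, if_pos hlI] at hineq
        have g1 := gain_value hε hp hh
        have g2 := gain_value hε hp hl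
        have hαl := hαl hlI
        have hαh := hαh hhI
        have hα1 := hα1 hhI hlI
        have hn := hnler h hh
        have p1 := mul_nonneg hαh (sub_nonneg.2 hθh)
        -- At least one unit is held while the price falls from `θl` to `θl'`. Its loss in value
        -- covers the surcharge for at most one element at the old price.
        have p2 : nh * κ ≤ (nh : ℝ) * θl' +
            ((st.A l).card - (st.A h ∩ O).card + δ) * (θl - θl') := by
          rcases hκ' with rfl | ⟨hs, rfl⟩
          · have := mul_nonneg hαl (sub_nonneg.2 hθl)
            linarith
          · have hs1 : (s : ℝ) = 1 := by exact_mod_cast hs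
            have := mul_nonneg (by linarith : 0 ≤ ((st.A l).card : ℝ) - (st.A h ∩ O).card + δ - nh)
              (sub_nonneg.2 hθl)
            linarith
        linarith
      · have hhI := hp.I_sub hh
        obtain ⟨c1, c2, c3⟩ := hsame l hl
        have g1 := gain_value hε hp hh
        have hnlz : (nl : ℝ) = 0 := by exact_mod_cast c1
        rw [if_pos hh, if_neg hl, hcard h hh, c2, hnlz]
        rw [if_pos hhI] at hineq
        rw [hnlz] at hBl
        have hn := hnler h hh
        have p1 := mul_nonneg (hαh hhI) (sub_nonneg.2 hθh)
        have p2 : nh * κ - ((st.A h ∩ O).card + nh) * e ≤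
            (if l ∈ st.I then ((st.A l).card - (st.A h ∩ O).card + δ) * θl
              else -((st.A h ∩ O).card * e)) := by
          rcases hκ' with hκe | ⟨hs, hκe⟩
          · rw [hκe, hl2 hl]
            have := hlow_l hl
            linarith
          · have hs1 : (s : ℝ) = 1 := by exact_mod_cast hs
            have pe := mul_nonneg hrh0 he
            have pe' := mul_nonneg hnh0 he
            split
            · rename_i hlI
              have := mul_nonneg (by linarith [hα1 hhI hlI] :
                0 ≤ ((st.A l).card : ℝ) - (st.A h ∩ O).card + δ - nh) (hθl0.trans hθl)
              rw [hκe]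
              linarith
            · rename_i hlI
              rw [hκe, hl1 hlI]
              linarith
        linarith
      · have hlI := hp.I_sub hl
        obtain ⟨c1, c2, c3⟩ := hsame h hh
        have g2 := gain_value hε hp hl
        have hnhz : (nh : ℝ) = 0 := by exact_mod_cast c1
        rw [if_neg hh, if_pos hl, hcard l hl, c2, hnhz]
        rw [if_pos hlI] at hineq
        rw [hnhz] at hBh
        rw [hh2 hh] at hBl
        have p1 := mul_nonneg (hαl hlI) (sub_nonneg.2 hθl)
        have := hlow_h hh
        linarith
      · obtain ⟨c1, c2, c3⟩ := hsame h hh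
        obtain ⟨d1, d2, d3⟩ := hsame l hl
        have hnhz : (nh : ℝ) = 0 := by exact_mod_cast c1
        have hnlz : (nl : ℝ) = 0 := by exact_mod_cast d1
        rw [if_neg hh, if_neg hl, c2, d2, hnhz, hnlz]
        rw [hnhz] at hBh
        rw [hnlz] at hBl
        have := hlow_h hh
        have := hlow_l hl
        linarith
    · intro hl
      have := hαl (hp.I_sub hl)
      rw [hcard l hl]
      by_cases hh : h ∈ st₂.I
      · have := hnler h hh
        linarith
      · have hnhz : (nh : ℝ) = 0 := by exact_mod_cast (hsame h hh).1
        have hs0 : (0 : ℝ) ≤ s := Nat.cast_nonneg _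
        linarith
    · intro hh
      have := hαh (hp.I_sub hh)
      rw [hcard h hh]
      by_cases hl : l ∈ st₂.I
      · have := hnler l hl
        linarith
      · have hnlz : (nl : ℝ) = 0 := by exact_mod_cast (hsame l hl).1
        have hs0 : (0 : ℝ) ≤ s := Nat.cast_nonneg _
        linarith
    · intro hh hl
      have := hα1 (hp.I_sub hh) (hp.I_sub hl)
      have := hnler h hh
      rw [hcard l hl]
      linarith

end Pairs

/-! ### The main loop: potential, passes and induction over the execution. -/

section Loop

variable {U : Type} [Fintype U] {ℓ : ℕ} {f : Finset U → ℝ} {G : Finset U} {τmin ε : ℝ}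

/-- The state is as after the parallel update: the candidate sets of the active solutions are
current and nonempty, and their thresholds are not below `τmin`. -/
structure Ready (f : Finset U → ℝ) (G : Finset U) (τmin ε : ℝ) (st : PIGState U ℓ) : Prop where
  inv : PIGInv f G τmin ε st
  thr : ∀ j ∈ st.I, τmin ≤ st.τ j
  cand_eq : ∀ j ∈ st.I, st.V j = cand f G st.A j (st.τ j)
  nonempty : ∀ j ∈ st.I, (st.V j).Nonempty

/-- The potential of a state. -/
def potential (f : Finset U → ℝ) (G : Finset U) (τmin ε : ℝ) (st : PIGState U ℓ) : ℝ :=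
  ∑ j, stWeight f G τmin ε st j

theorem stWeight_nonneg (st : PIGState U ℓ) (j : Fin ℓ) : 0 ≤ stWeight f G τmin ε st j := by
  unfold stWeight
  split
  · exact weight_nonneg _ _ _ _ _ _
  · exact le_rfl

theorem potential_nonneg (st : PIGState U ℓ) : 0 ≤ potential f G τmin ε st :=
  Finset.sum_nonneg fun j _ => stWeight_nonneg st j

theorem potential_eq_sum (st : PIGState U ℓ) {J : Finset (Fin ℓ)} (hJ : st.I ⊆ J) :
    potential f G τmin ε st = ∑ j ∈ J, stWeight f G τmin ε st j := by
  unfold potential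
  refine (Finset.sum_subset (Finset.subset_univ J) fun j _ hj => ?_).symm
  exact if_neg fun h => hj (hJ h)

/-- The state after the parallel update. -/
def afterUpdate (τmin : ℝ) (st : PIGState U ℓ) (p : (Fin ℓ → Finset U) × (Fin ℓ → ℝ)) :
    PIGState U ℓ :=
  { st with I := st.I.filter fun j => τmin ≤ p.2 j, V := p.1, τ := p.2 }

theorem update_ready (hm : 0 < τmin) (h0 : 0 < ε) (h1 : ε < 1) {st : PIGState U ℓ}
    (hst : PIGInv f G τmin ε st) :
    All f (update G τmin ε st.I st.A st.V st.τ) fun p r _ =>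
      Ready f G τmin ε (afterUpdate τmin st p) ∧ (∀ j, p.2 j ≤ st.τ j) ∧
      r + potential f G τmin ε (afterUpdate τmin st p) ≤ 1 + potential f G τmin ε st ∧
      potential f G τmin ε (afterUpdate τmin st p) ≤ potential f G τmin ε st := by
  refine (update_spec hm h0 h1 st.I st.A st.V st.τ fun j _ => hst.vsup j).mono ?_
  rintro ⟨V, τ⟩ r q ⟨hout, hin, hr⟩
  simp only at hout hin hr
  have hlow : ∀ j, Lowered f G ε st.A j (st.τ j) (τ j) := fun j => by
    by_cases hj : j ∈ st.I
    · exact (hin j hj).2.2.1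
    · rw [(hout j hj).2]
      exact ⟨le_rfl, Or.inl rfl⟩
  refine ⟨⟨?_, ?_, ?_, ?_⟩, fun j => (hlow j).1, ?_⟩
  · refine hst.setThresholds h1 (fun j => ?_) hlow fun j hj => ?_
    · by_cases hj : j ∈ st.I
      · exact (hin j hj).1.symm.subset
      · dsimp only
        rw [(hout j hj).1, (hout j hj).2]
        exact hst.vsup j
    · by_cases hjI : j ∈ st.I
      · by_contra hc
        exact hj (Finset.mem_filter.2 ⟨hjI, not_lt.1 hc⟩)
      · dsimp only
        rw [(hout j hjI).2]
        exact hst.inactive j hjI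
  · exact fun j hj => (Finset.mem_filter.1 hj).2
  · exact fun j hj => (hin j (Finset.mem_filter.1 hj).1).1
  · intro j hj
    obtain ⟨hj, hle⟩ := Finset.mem_filter.1 hj
    exact Finset.nonempty_iff_ne_empty.2 ((hin j hj).2.1.resolve_right (not_lt.2 hle))
  · rw [potential_eq_sum (afterUpdate τmin st (V, τ)) (Finset.filter_subset _ st.I),
      potential_eq_sum st subset_rfl]
    have h2 : ∑ j ∈ st.I, stWeight f G τmin ε (afterUpdate τmin st (V, τ)) j ≤
        ∑ j ∈ st.I, weight f G τmin ε st.A j (τ j) := by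
      refine Finset.sum_le_sum fun j _ => ?_
      unfold stWeight
      split
      · exact le_rfl
      · exact weight_nonneg _ _ _ _ _ _
    have h3 : ∑ j ∈ st.I, stWeight f G τmin ε st j =
        ∑ j ∈ st.I, weight f G τmin ε st.A j (st.τ j) :=
      Finset.sum_congr rfl fun j hj => if_pos hj
    have h4 : ∑ j ∈ st.I, weight f G τmin ε st.A j (τ j) ≤
        ∑ j ∈ st.I, weight f G τmin ε st.A j (st.τ j) :=
      Finset.sum_le_sum fun j hj => (hin j hj).2.2.2
    rw [h3]
    exact ⟨by linarith, by linarith⟩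

omit [Fintype U] in
theorem pass_afterUpdate {st st₂ : PIGState U ℓ} {p : (Fin ℓ → Finset U) × (Fin ℓ → ℝ)} {s : ℕ}
    (hτ : ∀ j, p.2 j ≤ st.τ j) (h : Pass f G τmin ε (afterUpdate τmin st p) st₂ s) :
    Pass f G τmin ε st st₂ s :=
  h.of_update (Finset.filter_subset _ _) hτ

theorem addOneEach_ready (hf : IsSubmodular f) (hm : 0 < τmin) (h0 : 0 < ε) (h1 : ε < 1)
    {st : PIGState U ℓ} (hst : Ready f G τmin ε st) :
    All f (addOneEach G τmin ε (st.I.sort (· ≤ ·)) st) fun st₂ r _ =>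
      PIGInv f G τmin ε st₂ ∧ Pass f G τmin ε st st₂ 1 ∧
      r + potential f G τmin ε st₂ ≤
        ∑ j ∈ st.I, (1 + weightPred f G τmin ε st.A j (st.τ j)) ∧
      potential f G τmin ε st₂ ≤ ∑ j ∈ st.I, weightPred f G τmin ε st.A j (st.τ j) := by
  have hmem : ∀ j, j ∈ st.I.sort (· ≤ ·) ↔ j ∈ st.I := fun j => Finset.mem_sort _
  refine (addOneEach_spec hf hm h0 h1 (st.I.sort (· ≤ ·)) (Finset.sortedLT_sort _).pairwise st
    hst.inv (fun j hj => (hmem j).1 hj) (fun j hj => hst.cand_eq j ((hmem j).1 hj))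
    fun j hj => hst.thr j ((hmem j).1 hj)).mono ?_
  rintro st₂ r q ⟨hi, hs, hr, hw⟩
  have hp := hs.pass hf hm h0 hst.inv hmem
  refine ⟨hi, hp, ?_⟩
  rw [potential_eq_sum st₂ hp.I_sub]
  have hsum : ∀ g : Fin ℓ → ℝ, ((st.I.sort (· ≤ ·)).map g).sum = ∑ j ∈ st.I, g j := fun g => by
    rw [← List.sum_toFinset g (Finset.sort_nodup _ _), Finset.sort_toFinset]
  rw [hsum, hsum] at hr hw
  exact ⟨hr, hw⟩

theorem Ready.block {st : PIGState U ℓ} (hst : Ready f G τmin ε st) {m₀ : ℕ} (hm₀ : 0 < m₀)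
    (hI : st.I.Nonempty) (hbig : ∀ j ∈ st.I, 2 * ℓ ≤ (st.V j).card) {D : Fin ℓ → Finset U}
    (hD : IsSplit st.I st.V D) {L : Fin ℓ → List U} (hL : IsOrdering D (st.I.sort (· ≤ ·)) L) :
    BlockReady f G τmin ε st m₀ hI D L where
  pos := hm₀
  thr := hst.thr
  gain_ge j hj x hx := by
    rw [hst.cand_eq j hj, mem_cand] at hx
    exact ⟨hx.2, hx.1⟩
  big := hbig
  split := hD
  order := hL

theorem addBlock_all (P : PIGState U ℓ × ℕ → ℕ → Prop) {st : PIGState U ℓ}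
    (hst : Ready f G τmin ε st) {m₀ : ℕ} (hm₀ : 0 < m₀) (hI : st.I.Nonempty)
    (hbig : ∀ j ∈ st.I, 2 * ℓ ≤ (st.V j).card)
    (hP : ∀ D L, BlockReady f G τmin ε st m₀ hI D L →
      P (blockNext f G ε st hI (blockSize m₀ st.I hI D) L,
        blockLen f G ε st hI (blockSize m₀ st.I hI D) L) 1) :
    All f (addBlock G ε m₀ st hI) fun p r _ => P p r := by
  rw [addBlock_eq, all_bind]
  refine (distribute_spec st.I st.V).mono ?_
  rintro D r q ⟨hD, rfl⟩
  rw [all_bind]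
  refine (permuteAll_spec D _).mono ?_
  rintro L r q ⟨hL, rfl⟩
  rw [all_ask_bind, all_pure, blockNext_restrict, blockLen_restrict]
  exact hP D L (hst.block hm₀ hI hbig hD hL)

theorem pigLoop_succ (n m₀ : ℕ) (st : PIGState U ℓ) :
    pigLoop G τmin ε (n + 1) m₀ st =
      if st.I = ∅ ∨ m₀ = 0 then pure st.A'
      else update G τmin ε st.I st.A st.V st.τ >>= fun p =>
        if hI : (afterUpdate τmin st p).I.Nonempty then
          if ∃ i ∈ (afterUpdate τmin st p).I, ((afterUpdate τmin st p).V i).card < 2 * ℓ then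
            addOneEach G τmin ε ((afterUpdate τmin st p).I.sort (· ≤ ·)) (afterUpdate τmin st p)
              >>= fun st₂ => pigLoop G τmin ε n (m₀ - 1) st₂
          else
            addBlock G ε m₀ (afterUpdate τmin st p) hI >>= fun b =>
              pigLoop G τmin ε n (m₀ - b.2) b.1
        else pure (afterUpdate τmin st p).A' := rfl

/-- Any property stable under `Pass` survives the loop, whichever branch is taken. Every pass that
continues uses at least one unit of capacity, so the recursion bound runs out only together with the
capacity. -/
theorem pigLoop_all (hf : IsSubmodular f) (hm : 0 < τmin) (h0 : 0 < ε) (h1 : ε < 1)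
    {Inv : ℕ → PIGState U ℓ → Prop}
    (hInv : ∀ m₀ st st₂ s, PIGInv f G τmin ε st → PIGInv f G τmin ε st₂ →
      Pass f G τmin ε st st₂ s → s ≤ m₀ → Inv m₀ st → Inv (m₀ - s) st₂)
    (n m₀ : ℕ) (hn : m₀ ≤ n) (st : PIGState U ℓ) (hst : PIGInv f G τmin ε st)
    (hi : Inv m₀ st) :
    All f (pigLoop G τmin ε n m₀ st) fun A' _ _ =>
      ∃ m₁ st', PIGInv f G τmin ε st' ∧ Inv m₁ st' ∧ (st'.I = ∅ ∨ m₁ = 0) ∧ A' = st'.A' := by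
  induction n generalizing m₀ st with
  | zero => exact ⟨m₀, st, hst, hi, Or.inr (Nat.le_zero.1 hn), rfl⟩
  | succ n ih =>
    rw [pigLoop_succ]
    split
    · rename_i hhalt
      exact ⟨m₀, st, hst, hi, hhalt, rfl⟩
    · rename_i hgo
      have hm₀ : 0 < m₀ := by
        rw [not_or] at hgo
        exact Nat.pos_of_ne_zero hgo.2
      rw [all_bind]
      refine (update_ready hm h0 h1 hst).mono ?_
      rintro p r q ⟨hr, hτ, -⟩
      split
      · rename_i hI
        split
        · rw [all_bind]
          refine (addOneEach_ready hf hm h0 h1 hr).mono ?_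
          rintro st₂ r' q' ⟨hi₂, hp, -⟩
          exact ih (m₀ - 1) (by omega) st₂ hi₂
            (hInv m₀ st st₂ 1 hst hi₂ (pass_afterUpdate hτ hp) hm₀ hi)
        · rename_i hbig
          push Not at hbig
          rw [all_bind]
          refine addBlock_all (fun b _ => All f (pigLoop G τmin ε n (m₀ - b.2) b.1) fun A' _ _ =>
            ∃ m₁ st', PIGInv f G τmin ε st' ∧ Inv m₁ st' ∧ (st'.I = ∅ ∨ m₁ = 0) ∧
              A' = st'.A') hr hm₀ hI hbig ?_
          intro D L hB
          have hlen := hB.one_le_len h0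
          have hi₂ := hB.next_inv hf hm h0 h1 hr.inv
          refine ih _ (by omega) _ hi₂ (hInv m₀ st _ _ hst hi₂
            (pass_afterUpdate hτ (hB.next_pass hf hm h0 h1 hr.inv)) ?_ hi)
          exact (hB.len_le_size _).trans (min_le_left _ _)
      · rename_i hI
        have hI := Finset.not_nonempty_iff_eq_empty.1 hI
        exact ⟨m₀ - 0, _, hr.inv, hInv m₀ st _ 0 hst hr.inv (pass_afterUpdate hτ (pass_stop hI))
          (Nat.zero_le _) hi, Or.inl hI, rfl⟩

/-- The initial state of `ParallelInterlaceGreedy`. -/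
def initState (U : Type) [Fintype U] (ℓ : ℕ) (M : ℝ) : PIGState U ℓ where
  I := Finset.univ
  A := fun _ => ∅
  A' := fun _ => ∅
  V := fun _ => Finset.univ
  τ := fun _ => M

theorem initState_inv (hm : 0 < τmin) (h0 : 0 < ε) (h1 : ε < 1) {M : ℝ}
    (hM : ∀ x, gain f x G ≤ M) : PIGInv f G τmin ε (initState U ℓ M) where
  disj _ _ _ := Finset.disjoint_empty_left _
  sub _ := subset_rfl
  le _ := le_rfl
  avail j x _ := by
    have h2 : G ∪ (initState U ℓ M).A j = G := Finset.union_empty G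
    rw [h2]
    refine (hM x).trans ((le_max_left M τmin).trans ?_)
    have : 0 ≤ max M τmin := hm.le.trans (le_max_right _ _)
    unfold price
    rw [le_div_iff₀ (by linarith)]
    change max M τmin * (1 - ε) ≤ max M τmin
    nlinarith
  vsup _ := Finset.subset_univ _
  inactive j hj := absurd (Finset.mem_univ j) hj

/-- The largest marginal gain over `G`. -/
def maxGain [Nonempty U] (f : Finset U → ℝ) (G : Finset U) : ℝ :=
  Finset.univ.sup' Finset.univ_nonempty fun x : U => gain f x G

theorem gain_le_maxGain [Nonempty U] (f : Finset U → ℝ) (G : Finset U) (x : U) :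
    gain f x G ≤ maxGain f G :=
  Finset.le_sup' (fun x => gain f x G) (Finset.mem_univ x)

theorem maxGain_restrict [Nonempty U] (f : Finset U → ℝ) (G : Finset U) :
    (Finset.univ.sup' Finset.univ_nonempty fun x : U =>
      (fun S => if S ∈ gainQueries G Finset.univ then f S else 0) (insert x G) -
        (fun S => if S ∈ gainQueries G Finset.univ then f S else 0) G) = maxGain f G := by
  unfold maxGain
  congr 1
  funext x
  have h1 : G ∈ gainQueries G Finset.univ := Finset.mem_insert_self _ _
  have h2 : insert x G ∈ gainQueries G Finset.univ :=
    Finset.mem_insert_of_mem (Finset.mem_image_of_mem _ (Finset.mem_univ x))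
  simp only [h1, h2, if_true]
  rfl

theorem all_parallelInterlaceGreedy [Nonempty U] (m : ℕ)
    (P : (Fin ℓ → Finset U) → ℕ → ℕ → Prop) :
    All f (parallelInterlaceGreedy G m ℓ τmin ε) P ↔
      All f (pigLoop G τmin ε m m (initState U ℓ (maxGain f G))) fun y r q =>
        P y (r + 1) (q + (gainQueries G Finset.univ).card) := by
  unfold parallelInterlaceGreedy
  rw [all_ask_bind]
  simp only [maxGain_restrict]
  rfl

theorem ex_parallelInterlaceGreedy [Nonempty U] (m : ℕ)
    (φ : (Fin ℓ → Finset U) → ℕ → ℕ → ℝ) :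
    Ex f (parallelInterlaceGreedy G m ℓ τmin ε) φ =
      Ex f (pigLoop G τmin ε m m (initState U ℓ (maxGain f G))) fun y r q =>
        φ y (r + 1) (q + (gainQueries G Finset.univ).card) := by
  unfold parallelInterlaceGreedy
  rw [ex_ask_bind]
  simp only [maxGain_restrict]
  rfl

end Loop

/-! ### The inequality satisfied by the returned solutions. -/

section Outcome

variable {U : Type} {ℓ : ℕ} {f : Finset U → ℝ} {G O : Finset U} {τmin ε : ℝ}

/-- The invariant of the while loop on which the approximation guarantee rests. -/
structure LoopInv (f : Finset U → ℝ) (G O : Finset U) (τmin ε : ℝ) (m m₀ : ℕ)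
    (st : PIGState U ℓ) : Prop where
  card_add : ∀ j ∈ st.I, (st.A j).card + m₀ = m
  card_le : ∀ j, (st.A j).card ≤ m
  thr : m₀ < m → ∀ j ∈ st.I, τmin ≤ st.τ j
  value_nonneg : ∀ j, 0 ≤ value f G st j
  le_value : ∀ j ∈ st.I, (1 - ε) * (st.A j).card * st.τ j ≤ value f G st j
  pair : ∀ h l, h < l → PairInv f G O τmin ε st h l

theorem initState_loopInv [Fintype U] (m : ℕ) (M : ℝ) :
    LoopInv f G O τmin ε m m (initState U ℓ M) where
  card_add j _ := by simp [initState]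
  card_le j := by simp [initState]
  thr h := absurd h (lt_irrefl _)
  value_nonneg j := by simp [initState, value]
  le_value j _ := by simp [initState, value]
  pair h l _ := Or.inl ⟨Finset.mem_univ _, Finset.mem_univ _, Finset.empty_subset _,
    Finset.empty_subset _, rfl⟩

theorem LoopInv.pass [Fintype U] (hf : IsSubmodular f) (hm : 0 < τmin) (h0 : 0 < ε) (h1 : ε < 1)
    {m m₀ s : ℕ} {st st₂ : PIGState U ℓ} (hst : PIGInv f G τmin ε st)
    (hst₂ : PIGInv f G τmin ε st₂) (hp : Pass f G τmin ε st st₂ s) (hs : s ≤ m₀)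
    (h : LoopInv f G O τmin ε m m₀ st) : LoopInv f G O τmin ε m (m₀ - s) st₂ where
  card_add j hj := by
    have := h.card_add j (hp.I_sub hj)
    rw [hp.card j hj]
    omega
  card_le j := by
    by_cases hj : j ∈ st₂.I
    · have := h.card_add j (hp.I_sub hj)
      rw [hp.card j hj]
      omega
    · rw [(hp.same j hj).1]
      exact h.card_le j
  thr _ := hp.active
  value_nonneg j := by
    have h2 := h.value_nonneg j
    unfold value at h2 ⊢
    by_cases hj : j ∈ st₂.I
    · have h3 := hp.gain_le j hj
      have h4 : 0 ≤ (1 - ε) * s * st₂.τ j :=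
        mul_nonneg (mul_nonneg (by linarith) (Nat.cast_nonneg _)) (hm.le.trans (hp.active j hj))
      linarith
    · rw [(hp.same j hj).2]
      exact h2
  le_value j hj := by
    have h2 := h.le_value j (hp.I_sub hj)
    have h3 := hp.gain_le j hj
    have h4 : (1 - ε) * (st.A j).card * st₂.τ j ≤ (1 - ε) * (st.A j).card * st.τ j :=
      mul_le_mul_of_nonneg_left (hp.τ_le j) (mul_nonneg (by linarith) (Nat.cast_nonneg _))
    unfold value at h2 ⊢
    rw [hp.card j hj]
    push_cast
    linarith
  pair a b hab := (h.pair a b hab).pass hf hm h0 h1 hst hst₂ hp h.value_nonneg hab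

theorem IsSubmodular.biUnion_sub_le (hf : IsSubmodular f) {ι : Type} (B : Finset U)
    (X : ι → Finset U) (s : Finset ι) (hX : ∀ i ∈ s, ∀ j ∈ s, i ≠ j → Disjoint (X i) (X j)) :
    f (B ∪ s.biUnion X) - f B ≤ ∑ i ∈ s, (f (B ∪ X i) - f B) := by
  induction s using Finset.induction_on with
  | empty => simp
  | insert i s hi ih =>
    have ih := ih fun a ha b hb =>
      hX a (Finset.mem_insert_of_mem ha) b (Finset.mem_insert_of_mem hb)
    have h2 := hf.union_sub_anti (B := B) (C := B ∪ s.biUnion X) (N := X i)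
      Finset.subset_union_left (by
        intro x hx
        obtain ⟨hx1, hx2⟩ := Finset.mem_inter.1 hx
        rcases Finset.mem_union.1 hx2 with hx2 | hx2
        · exact hx2
        · obtain ⟨j, hj, hxj⟩ := Finset.mem_biUnion.1 hx2
          have hij : i ≠ j := by rintro rfl; exact hi hj
          exact absurd hxj (Finset.disjoint_left.1 (hX i (Finset.mem_insert_self _ _) j
            (Finset.mem_insert_of_mem hj) hij) hx1))
    rw [Finset.sum_insert hi, Finset.biUnion_insert, Finset.union_comm (X i), ← Finset.union_assoc]
    linarith

variable {m : ℕ} {st : PIGState U ℓ}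

/-- What remains of the spare value at the end, in a form that is symmetric in the two solutions. -/
def endSpare (O : Finset U) (τmin ε : ℝ) (m : ℕ) (st : PIGState U ℓ) (h l : Fin ℓ) : ℝ :=
  if l ∈ st.I then ((m : ℝ) - 1 - (st.A h ∩ O).card) * price τmin ε (st.τ l)
  else -((st.A h ∩ O).card * (τmin / (1 - ε)))

variable [Fintype U]

/-- Both shifts `δ` and `-δ` are at least `-1`, so giving up one unit on each side removes the
asymmetry. If both solutions are optimal with `m` elements, the spare terms become negative and are
harmless. -/
theorem LoopInv.end_pair (hf : IsSubmodular f) (hm : 0 < τmin) (h0 : 0 < ε) (h1 : ε < 1)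
    (hst : PIGInv f G τmin ε st) (hi : LoopInv f G O τmin ε m 0 st) {h l : Fin ℓ} (hhl : h < l) :
    cross f G O st h l + cross f G O st l h + endSpare O τmin ε m st h l +
      endSpare O τmin ε m st l h ≤ ((1 - ε) ^ 2)⁻¹ * (value f G st h + value f G st l) := by
  have hΛ : 1 ≤ ((1 - ε) ^ 2)⁻¹ := (one_le_inv₀ (by nlinarith)).2 (by nlinarith)
  have hθ : ∀ j, 0 ≤ price τmin ε (st.τ j) := fun j => price_nonneg hm h1
  rcases hi.pair h l hhl with ⟨hh, hl, hhO, hlO, -⟩ | ⟨δ, hδ0, hδ1, hineq, -, -, -⟩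
  · have h2 := cross_le_value hf hst hhl.ne hhO
    have h3 := cross_le_value hf hst hhl.ne' hlO
    have h4 := le_mul_of_one_le_left (hi.value_nonneg h) hΛ
    have h5 := le_mul_of_one_le_left (hi.value_nonneg l) hΛ
    have h6 : ((st.A h ∩ O).card : ℝ) = m := by
      rw [Finset.inter_eq_left.2 hhO]
      exact_mod_cast hi.card_add h hh
    have h7 : ((st.A l ∩ O).card : ℝ) = m := by
      rw [Finset.inter_eq_left.2 hlO]
      exact_mod_cast hi.card_add l hl
    unfold endSpare
    rw [if_pos hh, if_pos hl, h6, h7]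
    linarith [hθ h, hθ l]
  · have key : ∀ a b : Fin ℓ, ∀ δ : ℝ, -1 ≤ δ →
        endSpare O τmin ε m st a b ≤ spare O τmin ε st a b δ := by
      intro a b δ hδ
      unfold endSpare spare
      split
      · rename_i hb
        have h2 : ((st.A b).card : ℝ) = m := by exact_mod_cast hi.card_add b hb
        rw [h2]
        exact mul_le_mul_of_nonneg_right (by linarith) (hθ b)
      · exact le_rfl
    have h2 := key h l δ (by linarith)
    have h3 := key l h (-δ) (by linarith)
    linarith

/-- The optimal elements outside `A l` lie in another solution or in none; the latter cost at most
the price of `l` each. -/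
theorem union_opt_sub_le (hf : IsSubmodular f) (hm : 0 < τmin) (h1 : ε < 1)
    (hst : PIGInv f G τmin ε st) (l : Fin ℓ) :
    f (G ∪ O ∪ st.A l) - f (G ∪ st.A l) ≤ ∑ h ∈ Finset.univ.erase l, cross f G O st h l +
      (O \ used st.A).card * price τmin ε (st.τ l) := by
  have h2 := hf.biUnion_sub_le (G ∪ st.A l) (fun h => st.A h ∩ O) (Finset.univ.erase l)
    fun a _ b _ hab => (hst.disj a b hab).mono Finset.inter_subset_left Finset.inter_subset_left
  have h3 := hf.union_sub_le_card_mul (B := G ∪ st.A l)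
    (C := G ∪ st.A l ∪ (Finset.univ.erase l).biUnion fun h => st.A h ∩ O)
    Finset.subset_union_left (price_nonneg (τ := st.τ l) hm h1) (O \ used st.A)
    fun x hx => hst.avail l x (Finset.mem_sdiff.1 hx).2
  have h4 : G ∪ st.A l ∪ ((Finset.univ.erase l).biUnion fun h => st.A h ∩ O) ∪ (O \ used st.A) =
      G ∪ O ∪ st.A l := by
    ext x
    simp only [Finset.mem_union, Finset.mem_biUnion, Finset.mem_erase, Finset.mem_univ,
      Finset.mem_inter, Finset.mem_sdiff, mem_used, and_true]
    constructor
    · rintro (((h | h) | ⟨a, -, -, h⟩) | ⟨h, -⟩) <;> tauto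
    · rintro ((h | h) | h)
      · tauto
      · by_cases hx : ∃ i, x ∈ st.A i
        · obtain ⟨i, hi⟩ := hx
          by_cases hil : i = l
          · subst hil; tauto
          · exact Or.inl (Or.inr ⟨i, hil, hi, h⟩)
        · exact Or.inr ⟨h, hx⟩
      · tauto
  rw [h4] at h3
  unfold cross
  linarith

theorem card_opt_eq (hst : PIGInv f G τmin ε st) :
    ∑ h, (st.A h ∩ O).card + (O \ used st.A).card = O.card := by
  rw [← Finset.card_inter_add_card_sdiff O (used st.A), ← Finset.card_biUnion]
  · congr 2
    ext x
    simp only [Finset.mem_biUnion, Finset.mem_univ, Finset.mem_inter, mem_used, true_and]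
    constructor
    · rintro ⟨a, h1, h2⟩; exact ⟨h2, a, h1⟩
    · rintro ⟨h2, a, h1⟩; exact ⟨a, h1, h2⟩
  · intro a _ b _ hab
    exact (hst.disj a b hab).mono Finset.inter_subset_left Finset.inter_subset_left

theorem LoopInv.outcome (hf : IsSubmodular f) (hf0 : ∀ S, 0 ≤ f S) (hm : 0 < τmin) (h0 : 0 < ε)
    (h1 : ε < 1) {k : ℕ} (hm1 : 0 < m) (hmk : m * ℓ ≤ k) (hℓ : 0 < ℓ) (hO : O.card ≤ k)
    (hst : PIGInv f G τmin ε st) (hi : LoopInv f G O τmin ε m 0 st) :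
    ((ℓ : ℝ) - 1) * f (G ∪ O) - ℓ * f G - ℓ * (k * (τmin / (1 - ε))) ≤
      (((1 - ε) ^ 2)⁻¹ * ((k + ℓ - 1) / m) + 1) * ∑ l, (f (G ∪ st.A' l) - f G) := by
  set Λ := ((1 - ε) ^ 2)⁻¹ with hΛdef
  set e := τmin / (1 - ε) with hedef
  have hε : 0 < 1 - ε := by linarith
  have he : 0 ≤ e := by positivity
  have hΛ0 : 0 ≤ Λ := by positivity
  have hmr : (0 : ℝ) < m := by exact_mod_cast hm1
  have hmkr : (m : ℝ) * ℓ ≤ k := by exact_mod_cast hmk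
  have hℓr : (1 : ℝ) ≤ ℓ := by exact_mod_cast hℓ
  have hm1r : (1 : ℝ) ≤ m := by exact_mod_cast hm1
  -- sum over the pairs
  have hpairs : ∑ l, ∑ h ∈ Finset.univ.erase l,
      (cross f G O st h l + endSpare O τmin ε m st h l) ≤ Λ * (ℓ - 1) * ∑ l, value f G st l := by
    have hsym : ∀ h l : Fin ℓ, h ≠ l → cross f G O st h l + endSpare O τmin ε m st h l +
        (cross f G O st l h + endSpare O τmin ε m st l h) ≤
        Λ * (value f G st h + value f G st l) := by
      intro h l hhl
      rcases lt_or_gt_of_ne hhl with hlt | hlt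
      · have := hi.end_pair hf hm h0 h1 hst hlt
        linarith
      · have := hi.end_pair hf hm h0 h1 hst hlt
        linarith
    have hswap : ∀ F : Fin ℓ → Fin ℓ → ℝ, ∑ l, ∑ h ∈ Finset.univ.erase l, F h l =
        ∑ l, ∑ h ∈ Finset.univ.erase l, F l h := by
      intro F
      have : ∀ F : Fin ℓ → Fin ℓ → ℝ, ∑ l, ∑ h ∈ Finset.univ.erase l, F h l =
          ∑ l, ∑ h, if h = l then 0 else F h l := by
        intro F
        refine Finset.sum_congr rfl fun l _ => ?_
        rw [← Finset.sum_erase_add _ _ (Finset.mem_univ l), if_pos rfl, add_zero]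
        refine Finset.sum_congr rfl fun h hh => ?_
        rw [if_neg (Finset.ne_of_mem_erase hh)]
      rw [this F, this fun a b => F b a, Finset.sum_comm]
      refine Finset.sum_congr rfl fun l _ => Finset.sum_congr rfl fun h _ => ?_
      simp only [eq_comm]
    have h2 : ∑ l, ∑ h ∈ Finset.univ.erase l,
        (cross f G O st h l + endSpare O τmin ε m st h l +
          (cross f G O st l h + endSpare O τmin ε m st l h)) ≤
        ∑ l, ∑ h ∈ Finset.univ.erase l, Λ * (value f G st h + value f G st l) :=
      Finset.sum_le_sum fun l _ => Finset.sum_le_sum fun h hh =>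
        hsym h l (Finset.ne_of_mem_erase hh)
    have h3 : ∑ l, ∑ h ∈ (Finset.univ : Finset (Fin ℓ)).erase l, value f G st l =
        (ℓ - 1) * ∑ l, value f G st l := by
      rw [Finset.mul_sum]
      refine Finset.sum_congr rfl fun l _ => ?_
      rw [Finset.sum_const, Finset.card_erase_of_mem (Finset.mem_univ l), Finset.card_univ,
        Fintype.card_fin, nsmul_eq_mul, Nat.cast_sub hℓ, Nat.cast_one]
    simp only [mul_add, Finset.sum_add_distrib, ← Finset.mul_sum] at h2
    rw [hswap fun h l => cross f G O st l h, hswap fun h l => endSpare O τmin ε m st l h,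
      hswap fun h l => value f G st h, h3] at h2
    simp only [Finset.sum_add_distrib]
    linarith
  -- one solution
  have hone : ∀ l, f (G ∪ O ∪ st.A l) - f (G ∪ st.A l) ≤
      ∑ h ∈ Finset.univ.erase l, (cross f G O st h l + endSpare O τmin ε m st h l) +
      Λ * ((k - (ℓ - 1) * (m - 1)) / m) * value f G st l + k * e := by
    intro l
    have hvl := hi.value_nonneg l
    have hb0 : 0 ≤ (k : ℝ) - (ℓ - 1) * (m - 1) := by nlinarith
    have h2 := union_opt_sub_le (O := O) hf hm h1 hst l
    have h3 : (∑ h ∈ Finset.univ.erase l, (st.A h ∩ O).card : ℝ) + (O \ used st.A).card ≤ k := by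
      have h4 := card_opt_eq (O := O) hst
      rw [← Finset.sum_erase_add _ _ (Finset.mem_univ l)] at h4
      have : ∑ h ∈ Finset.univ.erase l, (st.A h ∩ O).card + (O \ used st.A).card ≤ k := by omega
      exact_mod_cast this
    rw [Finset.sum_add_distrib]
    have hke : 0 ≤ (k : ℝ) * e := by positivity
    by_cases hl : l ∈ st.I
    · have hthr := hi.thr hm1 l hl
      have h4 : ∑ h ∈ Finset.univ.erase l, endSpare O τmin ε m st h l =
          ((ℓ - 1) * (m - 1) - ∑ h ∈ Finset.univ.erase l, ((st.A h ∩ O).card : ℝ)) *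
            price τmin ε (st.τ l) := by
        unfold endSpare
        simp only [if_pos hl]
        rw [← Finset.sum_mul, Finset.sum_sub_distrib, Finset.sum_const,
          Finset.card_erase_of_mem (Finset.mem_univ l), Finset.card_univ, Fintype.card_fin,
          nsmul_eq_mul, Nat.cast_sub hℓ, Nat.cast_one]
      -- An active solution is full, and each of its `m` elements is worth at least `1 - ε` times
      -- its final threshold.
      have h5 : price τmin ε (st.τ l) ≤ Λ * value f G st l / m := by
        have h6 := hi.le_value l hl
        have h7 : ((st.A l).card : ℝ) = m := by exact_mod_cast hi.card_add l hl
        rw [price_of_le hthr, hΛdef]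
        rw [h7] at h6
        rw [div_le_div_iff₀ hε hmr]
        have h8 : ((1 - ε) ^ 2)⁻¹ * value f G st l * (1 - ε) = value f G st l / (1 - ε) := by
          field_simp
        rw [h8, le_div_iff₀ hε]
        linarith
      have h6 := mul_le_mul_of_nonneg_left h5 hb0
      have h7 := mul_le_mul_of_nonneg_right h3 (price_nonneg (τ := st.τ l) hm h1)
      have h8 : ((k : ℝ) - (ℓ - 1) * (m - 1)) * (Λ * value f G st l / m) =
        Λ * ((k - (ℓ - 1) * (m - 1)) / m) * value f G st l := by ring
      rw [h4]
      linarith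
    · have h4 : ∑ h ∈ Finset.univ.erase l, endSpare O τmin ε m st h l =
          -((∑ h ∈ Finset.univ.erase l, ((st.A h ∩ O).card : ℝ)) * e) := by
        unfold endSpare
        simp only [if_neg hl]
        rw [Finset.sum_neg_distrib, ← Finset.sum_mul]
      have h5 : price τmin ε (st.τ l) = e := price_of_lt (hst.inactive l hl)
      have h6 : 0 ≤ Λ * ((k - (ℓ - 1) * (m - 1)) / m) * value f G st l := by positivity
      have h7 := mul_le_mul_of_nonneg_right h3 he
      rw [h4]
      rw [h5] at h2
      linarith
  have hsum := Finset.sum_le_sum fun l (_ : l ∈ Finset.univ) => hone l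
  rw [Finset.sum_sub_distrib, Finset.sum_add_distrib, Finset.sum_add_distrib, ← Finset.mul_sum,
    Finset.sum_const, Finset.card_univ, Fintype.card_fin, nsmul_eq_mul] at hsum
  have hdis := hf.sum_union_disjoint hf0 (G ∪ O) st.A Finset.univ
    fun a _ b _ hab => hst.disj a b hab
  rw [Finset.card_univ, Fintype.card_fin] at hdis
  have hA' : ∑ l, f (G ∪ st.A l) ≤ ∑ l, value f G st l + ℓ * f G := by
    have : ∑ l : Fin ℓ, (value f G st l + f G) = ∑ l, value f G st l + ℓ * f G := by
      rw [Finset.sum_add_distrib, Finset.sum_const, Finset.card_univ, Fintype.card_fin,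
        nsmul_eq_mul]
    rw [← this]
    refine Finset.sum_le_sum fun l _ => ?_
    unfold value
    linarith [hst.le l]
  -- The pairs contribute `ℓ - 1`, and the optimal elements not covered by the `(ℓ - 1) * (m - 1)`
  -- spare units contribute the rest.
  have hR : Λ * (ℓ - 1) + Λ * ((k - (ℓ - 1) * (m - 1)) / m) = Λ * (((k : ℝ) + ℓ - 1) / m) := by
    field_simp
    ring
  change _ ≤ _ * ∑ l, value f G st l
  rw [← hR]
  linarith

/-- The quality of the solutions returned by `ParallelInterlaceGreedy`. -/
theorem parallelInterlaceGreedy_spec [Nonempty U] (hf : IsSubmodular f) (hf0 : ∀ S, 0 ≤ f S)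
    (hm : 0 < τmin) (h0 : 0 < ε) (h1 : ε < 1) {k m : ℕ} (hm1 : 0 < m) (hmk : m * ℓ ≤ k)
    (hℓ : 0 < ℓ) (O : Finset U) (hO : O.card ≤ k) (G : Finset U) :
    All f (parallelInterlaceGreedy G m ℓ τmin ε) fun A' _ _ =>
      (∀ l, (A' l).card ≤ m) ∧ (∀ i j, i ≠ j → Disjoint (A' i) (A' j)) ∧
      ((ℓ : ℝ) - 1) * f (G ∪ O) - ℓ * f G - ℓ * (k * (τmin / (1 - ε))) ≤
        (((1 - ε) ^ 2)⁻¹ * ((k + ℓ - 1) / m) + 1) * ∑ l, (f (G ∪ A' l) - f G) := by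
  rw [all_parallelInterlaceGreedy]
  refine (pigLoop_all hf hm h0 h1 (Inv := LoopInv f G O τmin ε m)
    (fun m₀ st st₂ s h2 h3 h4 h5 h6 => h6.pass hf hm h0 h1 h2 h3 h4 h5) m m le_rfl _
    (initState_inv hm h0 h1 (gain_le_maxGain f G)) (initState_loopInv m _)).mono ?_
  rintro A' r q ⟨m₁, st, hst, hi, hend, rfl⟩
  -- If the loop ended because nothing is active, the clauses that mention the capacity are vacuous,
  -- so the capacity may be taken to be zero.
  have hi' : LoopInv f G O τmin ε m 0 st := by
    rcases hend with hI | rfl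
    · exact ⟨fun j hj => by simp [hI] at hj, hi.card_le, fun _ j hj => by simp [hI] at hj,
        hi.value_nonneg, fun j hj => by simp [hI] at hj, hi.pair⟩
    · exact hi
  exact ⟨fun l => (Finset.card_le_card (hst.sub l)).trans (hi.card_le l),
    fun a b hab => (hst.disj a b hab).mono (hst.sub a) (hst.sub b),
    hi'.outcome hf hf0 hm h0 h1 hm1 hmk hℓ hO hst⟩

end Outcome

/-! ### The recurrence for the expected value. -/

section Recurrence

variable {U : Type} [Fintype U] [Nonempty U] {ℓ : ℕ} {f : Finset U → ℝ} {O : Finset U}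
  {τmin ε : ℝ}

theorem pitgLoop_succ (m : ℕ) (hl : (Finset.univ : Finset (Fin ℓ)).Nonempty) (i : ℕ)
    (G : Finset U) :
    pitgLoop m ℓ τmin ε (i + 1) G =
      parallelInterlaceGreedy G m ℓ τmin ε >>= fun A' =>
        OracleAlg.sample (Fin ℓ) Finset.univ hl fun l => pitgLoop m ℓ τmin ε i (G ∪ A' l) := by
  rw [pitgLoop]
  simp only [dif_pos hl]

theorem pitgLoop_card_le (hf : IsSubmodular f) (hf0 : ∀ S, 0 ≤ f S)
    (hm : 0 < τmin) (h0 : 0 < ε) (h1 : ε < 1) (m : ℕ) (hℓ : 0 < ℓ) (i : ℕ) (G : Finset U) :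
    All f (pitgLoop m ℓ τmin ε i G) fun S _ _ => S.card ≤ G.card + i * m := by
  induction i generalizing G with
  | zero => exact (by simp : G.card ≤ G.card + 0 * m)
  | succ i ih =>
    rw [pitgLoop_succ m ⟨⟨0, hℓ⟩, Finset.mem_univ _⟩, all_bind]
    have hcard : All f (parallelInterlaceGreedy G m ℓ τmin ε) fun A' _ _ =>
        ∀ l, (A' l).card ≤ m := by
      rcases Nat.eq_zero_or_pos m with rfl | hm1
      · rw [all_parallelInterlaceGreedy]
        exact fun l => le_rfl
      · exact (parallelInterlaceGreedy_spec hf hf0 hm h0 h1 hm1 le_rfl hℓ ∅ (Nat.zero_le _)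
          G).mono fun A' r q h => h.1
    refine hcard.mono ?_
    rintro A' r q hA l _
    refine (ih (G ∪ A' l)).mono fun S _ _ hS => hS.trans ?_
    have h2 := Finset.card_union_le G (A' l)
    have h3 := hA l
    rw [Nat.add_mul]
    omega

/-- The expected value after `i` passes: with probability weights `(1 - a) ^ i` for the value of
the initial set and `(1 - u) ^ i * a * (i + x * i * (i - 1) / 2)` for the optimal value. -/
theorem pitgLoop_value (hf : IsSubmodular f) (hf0 : ∀ S, 0 ≤ f S)
    (hm : 0 < τmin) (h0 : 0 < ε) (h1 : ε < 1) {k m : ℕ} (hm1 : 0 < m) (hmk : m * ℓ ≤ k)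
    (hℓ : 2 ≤ ℓ) (hO : O.card ≤ k) {a u x : ℝ}
    (ha : a = (((1 - ε) ^ 2)⁻¹ * (((k : ℝ) + ℓ - 1) / m) + 1)⁻¹) (hu : u = (ℓ : ℝ)⁻¹)
    (hx : (1 - u) * (1 + x) = 1 - a) (hx0 : 0 ≤ x) (i : ℕ) (G : Finset U) :
    (1 - a) ^ i * f G + (1 - u) ^ i * (a * (i + x * (i * (i - 1) / 2))) * f (G ∪ O) -
      (1 - (1 - a) ^ i) * (k * (τmin / (1 - ε))) ≤
      Ex f (pitgLoop m ℓ τmin ε i G) fun S _ _ => f S := by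
  have hℓr : (2 : ℝ) ≤ ℓ := by exact_mod_cast hℓ
  have hmr : (0 : ℝ) < m := by exact_mod_cast hm1
  have hkr : (0 : ℝ) ≤ k := Nat.cast_nonneg k
  have hD : 0 ≤ ((1 - ε) ^ 2)⁻¹ * (((k : ℝ) + ℓ - 1) / m) :=
    mul_nonneg (by positivity) (div_nonneg (by linarith) hmr.le)
  have ha0 : 0 < a := by rw [ha]; positivity
  have ha1 : a ≤ 1 := by rw [ha]; exact inv_le_one_of_one_le₀ (by linarith)
  have hu0 : 0 < u := by rw [hu]; positivity
  have hu1 : u < 1 := by rw [hu]; exact inv_lt_one_of_one_lt₀ (by linarith)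
  have huℓ : u * ℓ = 1 := by rw [hu]; field_simp
  have hdiv : ∀ t : ℝ, t / ℓ = t * u := fun t => by rw [hu, div_eq_mul_inv]
  set err := (k : ℝ) * (τmin / (1 - ε))
  induction i generalizing G with
  | zero =>
    change _ ≤ f G
    simp
  | succ i ih =>
    have hl : (Finset.univ : Finset (Fin ℓ)).Nonempty := ⟨⟨0, by omega⟩, Finset.mem_univ _⟩
    rw [pitgLoop_succ m hl, ex_bind]
    refine le_ex ((parallelInterlaceGreedy_spec hf hf0 hm h0 h1 hm1 hmk (by omega) O hO G).mono ?_)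
    rintro A' r q ⟨-, hdis, hq⟩
    change _ ≤ (∑ l, Ex f (pitgLoop m ℓ τmin ε i (G ∪ A' l)) fun S _ _ => f S) /
      ((Finset.univ : Finset (Fin ℓ)).card : ℝ)
    rw [Finset.card_univ, Fintype.card_fin, hdiv]
    set b : ℝ := (1 - u) ^ i * (a * (i + x * (i * (i - 1) / 2))) with hb
    have hb0 : 0 ≤ b := by
      refine mul_nonneg (pow_nonneg (by linarith) _) (mul_nonneg ha0.le ?_)
      have : (0 : ℝ) ≤ i * (i - 1) / 2 := by
        rcases Nat.eq_zero_or_pos i with rfl | hi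
        · simp
        · have : (1 : ℝ) ≤ i := by exact_mod_cast hi
          have : 0 ≤ (i : ℝ) - 1 := by linarith
          positivity
      positivity
    have hsum : ∑ l, ((1 - a) ^ i * f (G ∪ A' l) + b * f (G ∪ A' l ∪ O) -
        (1 - (1 - a) ^ i) * err) ≤
        ∑ l, Ex f (pitgLoop m ℓ τmin ε i (G ∪ A' l)) fun S _ _ => f S :=
      Finset.sum_le_sum fun l _ => ih (G ∪ A' l)
    rw [Finset.sum_sub_distrib, Finset.sum_add_distrib, ← Finset.mul_sum, ← Finset.mul_sum,
      Finset.sum_const, Finset.card_univ, Fintype.card_fin, nsmul_eq_mul] at hsum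
    have hval : (1 - a) * f G + a * (1 - u) * f (G ∪ O) - a * err ≤
        u * ∑ l, f (G ∪ A' l) := by
      rw [Finset.sum_sub_distrib, Finset.sum_const, Finset.card_univ, Fintype.card_fin,
        nsmul_eq_mul] at hq
      have h2 := mul_le_mul_of_nonneg_left hq (mul_nonneg hu0.le ha0.le)
      have h3 : u * a * ((((1 - ε) ^ 2)⁻¹ * (((k : ℝ) + ℓ - 1) / m) + 1) *
          (∑ l, f (G ∪ A' l) - ℓ * f G)) = u * ∑ l, f (G ∪ A' l) - f G := by
        have h4 : a * (((1 - ε) ^ 2)⁻¹ * (((k : ℝ) + ℓ - 1) / m) + 1) = 1 := by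
          rw [ha]
          exact inv_mul_cancel₀ (by positivity)
        linear_combination (u * (∑ l, f (G ∪ A' l) - ℓ * f G)) * h4 - f G * huℓ
      rw [h3] at h2
      have h5 : u * a * (((ℓ : ℝ) - 1) * f (G ∪ O) - ℓ * f G - ℓ * err) =
          a * (1 - u) * f (G ∪ O) - a * f G - a * err := by
        linear_combination (a * f (G ∪ O) - a * f G - a * err) * huℓ
      rw [h5] at h2
      linarith
    -- A random one of `ℓ` disjoint extensions destroys on average at most the fraction `1/ℓ` of `f
    -- (G ∪ O)`.
    have hopt : (1 - u) * f (G ∪ O) ≤ u * ∑ l, f (G ∪ A' l ∪ O) := by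
      have h2 := hf.sum_union_disjoint hf0 (G ∪ O) A' Finset.univ fun i _ j _ => hdis i j
      simp only [Finset.union_right_comm G O] at h2
      rw [Finset.card_univ, Fintype.card_fin] at h2
      have h3 := mul_le_mul_of_nonneg_left h2 hu0.le
      have h4 : u * (((ℓ : ℝ) - 1) * f (G ∪ O)) = (1 - u) * f (G ∪ O) := by
        linear_combination f (G ∪ O) * huℓ
      linarith
    -- The recursion for the coefficient adds `(1 - u) * a * (1 - a) ^ i`. With `1 - a = (1 - u) *
    -- (1 + x)`, Bernoulli's inequality replaces `(1 + x) ^ i` by `1 + i * x`, and these sum up to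
    -- `i + x * i * (i - 1) / 2`.
    have hcoef : (1 - u) ^ (i + 1) * (a * (((i + 1 : ℕ) : ℝ) +
        x * (((i + 1 : ℕ) : ℝ) * (((i + 1 : ℕ) : ℝ) - 1) / 2))) ≤
        (1 - u) * (b + a * (1 - a) ^ i) := by
      have h2 : 1 + (i : ℝ) * x ≤ (1 + x) ^ i := one_add_mul_le_pow (by linarith) i
      have h3 : (1 - a) ^ i = (1 - u) ^ i * (1 + x) ^ i := by rw [← hx, mul_pow]
      rw [h3, hb]
      have h4 : 0 ≤ (1 - u) * a * (1 - u) ^ i := by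
        have : 0 ≤ 1 - u := by linarith
        positivity
      have h5 := mul_le_mul_of_nonneg_left h2 h4
      push_cast
      rw [pow_succ]
      linarith
    have h6 := mul_le_mul_of_nonneg_right hcoef (hf0 (G ∪ O))
    have h7 := mul_le_mul_of_nonneg_left hval (pow_nonneg (by linarith : 0 ≤ 1 - a) i)
    have h8 := mul_le_mul_of_nonneg_left hopt hb0
    have h9 := mul_le_mul_of_nonneg_right hsum hu0.le
    have h10 : (ℓ : ℝ) * ((1 - (1 - a) ^ i) * err) * u = (1 - (1 - a) ^ i) * err := by
      linear_combination ((1 - (1 - a) ^ i) * err) * huℓ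
    rw [pow_succ (1 - a)]
    linarith

end Recurrence

/-! ### Numerical inequalities behind the loss `ε`. -/

section Constants

/-- For `p = ε/2` and `y = e * ε/4 - 1/ℓ`. The quotient of the last factor on the left by the right
side bounds `D/ℓ` in `step_factor` and is `1 + 3.36 * p + y` to first order, so the loss `7/2 * p +
y` has `0.14 * p` to spare; the factor `1 - 7/10 * p` trims it to second order for `value_tradeoff`.
The constants round up: `23/125` exceeds `1/(2e)` and `34/25` exceeds `e/2`. -/
theorem threshold_tradeoff {p y : ℝ} (hp : 0 ≤ p) (hp' : p ≤ 23 / 125) (hy : 0 ≤ y)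
    (hy' : y ≤ 34 / 25 * p) :
    (1 - (7 / 2 * p + y) * (1 - 7 / 10 * p)) *
      (1 - 2 * p + y + (34 / 25 * p - y) * ((1 - 2 * p) * (1 - 2 * p - y))) ≤
      (1 - 2 * p) * (1 - 2 * p - y) := by
  -- In the coordinates `p` and `h` the constraints form a box, and the difference of the sides is
  -- `p` times a polynomial with positive constant term.
  obtain ⟨h, rfl⟩ : ∃ h, y = p * h := by
    rcases hp.eq_or_lt with rfl | h
    · exact ⟨0, by simp at hy'; linarith⟩
    · exact ⟨y / p, by field_simp⟩
  rcases hp.eq_or_lt with rfl | hp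
  · simp
  have hh : 0 ≤ h := by by_contra hc; nlinarith
  have hh' : h ≤ 34 / 25 := by by_contra hc; nlinarith
  have hd : 0 ≤ 23 / 125 - p := by linarith
  have hk : 0 ≤ 34 / 25 - h := by linarith
  suffices hs : 0 ≤ 0.14 + p * (4.75 - 1.98 * h - h ^ 2) +
      p ^ 2 * (-22.912 + 5.528 * h + 8.14 * h ^ 2 + h ^ 3) +
      p ^ 3 * (32.368 - 1.7 * h - 12.578 * h ^ 2 - 2.7 * h ^ 3) +
      p ^ 4 * (-13.328 - 0.672 * h + 5.796 * h ^ 2 + 1.4 * h ^ 3) by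
    have := mul_nonneg hp.le hs
    linarith
  nlinarith [mul_nonneg hp.le hd, mul_nonneg hp.le hk, mul_nonneg hh hk,
    mul_nonneg (mul_nonneg hp.le hd) hk, mul_nonneg (mul_nonneg hp.le hd) hh,
    mul_nonneg (mul_nonneg hp.le hh) hk, mul_nonneg (mul_nonneg hp.le hd) (mul_nonneg hh hk),
    mul_nonneg (mul_nonneg hp.le hd) (mul_nonneg hp.le hk)]

/-- The difference of the sides is affine in `e` with nonnegative slope (`h2`), so `e = 2.718` is
the worst case; there it is `p` times a polynomial beginning with `1.218 + h`. -/
theorem value_tradeoff {p y e w : ℝ} (hp : 0 ≤ p) (hp' : p ≤ 23 / 125) (hy : 0 ≤ y)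
    (hy' : y ≤ 34 / 25 * p) (he : 2.718 ≤ e) (hw : w = (7 / 2 * p + y) * (1 - 7 / 10 * p)) :
    2 * ((e - 1 + (e * p / 2 - y) - w) * p + (1 - 2 * e * p) * (1 - p)) ≤
      (2 - w - w ^ 2) * (1 - (e * p / 2 - y)) * (1 - p) := by
  obtain ⟨h, rfl⟩ : ∃ h, y = p * h := by
    rcases hp.eq_or_lt with rfl | h
    · exact ⟨0, by simp at hy'; linarith⟩
    · exact ⟨y / p, by field_simp⟩
  rcases hp.eq_or_lt with rfl | hp
  · simp at hw
    simp [hw]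
  have hh : 0 ≤ h := by by_contra hc; nlinarith
  have hh' : h ≤ 34 / 25 := by by_contra hc; nlinarith
  have hs : 0 ≤ 1.218 + h - p * (5.4155 + 5.441 * h + 2 * h ^ 2) +
      p ^ 2 * (30.6117 + 15.6027 * h - 1.541 * h ^ 2 - h ^ 3) +
      p ^ 3 * (-59.77755 - 8.1599 * h + 10.9484 * h ^ 2 + 2.4 * h ^ 3) +
      p ^ 4 * (37.4667475 - 1.74293 * h - 10.17149 * h ^ 2 - 1.89 * h ^ 3) +
      p ^ 5 * (-8.1573975 + 1.34113 * h + 2.76409 * h ^ 2 + 0.49 * h ^ 3) := by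
    have a2 : h ^ 2 ≤ 1.36 * h := by nlinarith
    have a3 : h ^ 3 ≤ 1.8496 * h := by nlinarith [mul_nonneg hh hh]
    have b3 : p ^ 3 ≤ 0.184 * p ^ 2 := by nlinarith [sq_nonneg p]
    have b5 : p ^ 5 ≤ 0.0339 * p ^ 3 := by nlinarith [pow_nonneg hp.le 3, pow_nonneg hp.le 4]
    have c1 : p * (2 * h ^ 2) ≤ p * (2.72 * h) := mul_le_mul_of_nonneg_left (by linarith) hp.le
    have c2 : p ^ 2 * (4 * h - 1.541 * h ^ 2 - h ^ 3) ≥ 0 :=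
      mul_nonneg (sq_nonneg p) (by linarith)
    have c3 : 0 ≤ p ^ 3 * (10.9484 * h ^ 2 + 2.4 * h ^ 3) := by positivity
    have c3' : p ^ 3 * h ≤ 0.184 * p ^ 2 * h := mul_le_mul_of_nonneg_right b3 hh
    have c4 : 0 ≤ p ^ 4 * (37.4667475 - 1.74293 * h - 10.17149 * h ^ 2 - 1.89 * h ^ 3) :=
      mul_nonneg (by positivity) (by linarith)
    have c5 : 0 ≤ p ^ 5 * (1.34113 * h + 2.76409 * h ^ 2 + 0.49 * h ^ 3) := by positivity
    have d1 : p * h ≤ 0.184 * h := mul_le_mul_of_nonneg_right (by linarith) hh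
    have d2 : 0 ≤ p ^ 2 * h := by positivity
    have d3 := sq_nonneg (p - 0.14)
    linarith
  have h1 := mul_nonneg hp.le hs
  have hw0 : 0 ≤ w := by rw [hw]; exact mul_nonneg (by nlinarith) (by linarith)
  have h2 : 0 ≤ (e - 2.718) * p * ((2 - 5 * p) - (2 - w - w ^ 2) * (1 - p) / 2) := by
    refine mul_nonneg (mul_nonneg (by linarith) hp.le) ?_
    have h3 := mul_nonneg (mul_nonneg hw0 hw0) (by linarith : 0 ≤ 1 - p)
    have h4 := mul_nonneg hw0 (by linarith : 0 ≤ 1 - p)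
    linarith
  rw [← sub_nonneg]
  have h3 : (2 - w - w ^ 2) * (1 - (e * p / 2 - p * h)) * (1 - p) -
      2 * ((e - 1 + (e * p / 2 - p * h) - w) * p + (1 - 2 * e * p) * (1 - p)) =
      p * (1.218 + h - p * (5.4155 + 5.441 * h + 2 * h ^ 2) +
        p ^ 2 * (30.6117 + 15.6027 * h - 1.541 * h ^ 2 - h ^ 3) +
        p ^ 3 * (-59.77755 - 8.1599 * h + 10.9484 * h ^ 2 + 2.4 * h ^ 3) +
        p ^ 4 * (37.4667475 - 1.74293 * h - 10.17149 * h ^ 2 - 1.89 * h ^ 3) +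
        p ^ 5 * (-8.1573975 + 1.34113 * h + 2.76409 * h ^ 2 + 0.49 * h ^ 3)) +
      (e - 2.718) * p * ((2 - 5 * p) - (2 - w - w ^ 2) * (1 - p) / 2) := by
    rw [hw]; ring
  rw [h3]
  exact add_nonneg h1 h2

/-- The balance of the expected value and the error caused by the smallest threshold. -/
theorem final_tradeoff {p y E u w w' : ℝ} (hp0 : 0 < p) (hp1 : p ≤ 23 / 125) (hy0 : 0 ≤ y)
    (hyle : y + u ≤ 34 / 25 * p) (hu0 : 0 ≤ u) (he : 2.718 ≤ E) (hy : E * p / 2 - y = u)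
    (hw' : w' = (7 / 2 * p + y) * (1 - 7 / 10 * p)) (hw0 : 0 ≤ w) (hww' : w ≤ w') :
    1 / E - 2 * p ≤ (1 - u) / E * ((1 - w) * (1 + w / 2)) -
      (1 - ((1 - u) + w) / E) * (p / (1 - p)) := by
  have h5 := value_tradeoff (e := E) hp0.le hp1 hy0 (by linarith : y ≤ 34 / 25 * p) he hw'
  rw [hy] at h5
  have hp2 : 0 < 1 - p := by linarith
  have hE : 0 < E := by linarith
  have h7 : 2 * ((E - 1 + u - w) * p + (1 - 2 * E * p) * (1 - p)) ≤
      (2 - w - w ^ 2) * (1 - u) * (1 - p) := by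
    -- The balance decreases in the loss, so it is enough to know it at the upper bound `w'`.
    have h8 : 0 ≤ (w' - w) * ((1 + w + w') * ((1 - u) * (1 - p)) - 2 * p) := by
      refine mul_nonneg (by linarith) ?_
      have h9 : 1 / 2 ≤ (1 - u) * (1 - p) := by nlinarith
      have h10 : 0 ≤ (w + w') * ((1 - u) * (1 - p)) := mul_nonneg (by linarith) (by linarith)
      linarith
    linarith
  rw [← sub_nonneg]
  have h8 : (1 - u) / E * ((1 - w) * (1 + w / 2)) - (1 - ((1 - u) + w) / E) * (p / (1 - p)) -
      (1 / E - 2 * p) = ((2 - w - w ^ 2) * (1 - u) * (1 - p) -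
        2 * ((E - 1 + u - w) * p + (1 - 2 * E * p) * (1 - p))) / (2 * E * (1 - p)) := by
    field_simp
    ring
  rw [h8]
  exact div_nonneg (by linarith) (by positivity)

/-- With `n = ℓ - 1`, the remaining power is `(1 + 1/n) ^ n` inverted, and `(1 + 1/n) ^ n ≤ e`. -/
theorem one_sub_inv_pow_ge {ℓ : ℕ} (hℓ : 2 ≤ ℓ) :
    (1 - (ℓ : ℝ)⁻¹) / Real.exp 1 ≤ (1 - (ℓ : ℝ)⁻¹) ^ ℓ := by
  obtain ⟨n, rfl⟩ : ∃ n, ℓ = n + 1 := ⟨ℓ - 1, by omega⟩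
  have hn : (0 : ℝ) < n := by exact_mod_cast (by omega : 0 < n)
  have h1 : 1 - ((n + 1 : ℕ) : ℝ)⁻¹ = (1 + 1 / (n : ℝ))⁻¹ := by
    push_cast
    field_simp
    ring
  have h2 : (1 + 1 / (n : ℝ)) ^ n ≤ Real.exp 1 := by
    have h3 : 1 + 1 / (n : ℝ) ≤ Real.exp (1 / n) := by
      linarith [Real.add_one_le_exp (1 / (n : ℝ))]
    calc (1 + 1 / (n : ℝ)) ^ n ≤ Real.exp (1 / n) ^ n := by gcongr
      _ = Real.exp 1 := by rw [← Real.exp_nat_mul]; congr 1; field_simp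
  rw [h1, pow_succ', div_eq_mul_inv, inv_pow]
  gcongr

end Constants

/-! ### The degenerate case, the parameters and the approximation guarantee. -/

section TopLevel

variable {U : Type} [Fintype U] [Nonempty U] {f : Finset U → ℝ}

/-- The largest value of a singleton. -/
def maxSingle (f : Finset U → ℝ) : ℝ :=
  Finset.univ.sup' Finset.univ_nonempty fun x : U => f {x}

theorem maxSingle_restrict (f : Finset U → ℝ) :
    (Finset.univ.sup' Finset.univ_nonempty fun x : U =>
      (fun S => if S ∈ Finset.univ.image (fun x : U => ({x} : Finset U)) then f S else 0) {x}) =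
      maxSingle f := by
  unfold maxSingle
  congr 1
  funext x
  exact if_pos (Finset.mem_image_of_mem _ (Finset.mem_univ x))

theorem all_parallelInterpolatedGreedy (k ℓ : ℕ) (ε : ℝ) (P : Finset U → ℕ → ℕ → Prop) :
    All f (parallelInterpolatedGreedy U k ℓ ε) P ↔
      All f (pitgLoop (k / ℓ) ℓ (ε / 2 * maxSingle f / k) (ε / 2) ℓ (∅ : Finset U)) fun y r q =>
        P y (r + 1) (q + (Finset.univ.image fun x : U => ({x} : Finset U)).card) := by
  unfold parallelInterpolatedGreedy
  rw [all_ask_bind]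
  simp only [maxSingle_restrict]

theorem ex_parallelInterpolatedGreedy (k ℓ : ℕ) (ε : ℝ) (φ : Finset U → ℕ → ℕ → ℝ) :
    Ex f (parallelInterpolatedGreedy U k ℓ ε) φ =
      Ex f (pitgLoop (k / ℓ) ℓ (ε / 2 * maxSingle f / k) (ε / 2) ℓ (∅ : Finset U)) fun y r q =>
        φ y (r + 1) (q + (Finset.univ.image fun x : U => ({x} : Finset U)).card) := by
  unfold parallelInterpolatedGreedy
  rw [ex_ask_bind]
  simp only [maxSingle_restrict]

theorem maxSingle_nonneg (hf0 : ∀ S, 0 ≤ f S) : 0 ≤ maxSingle f := by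
  obtain ⟨x⟩ := ‹Nonempty U›
  exact (hf0 {x}).trans (Finset.le_sup' (fun x => f {x}) (Finset.mem_univ x))

theorem maxSingle_le {k : ℕ} (hk : 1 ≤ k) {O : Finset U} (hO : IsOptimal f k O) :
    maxSingle f ≤ f O :=
  Finset.sup'_le _ _ fun x _ => hO.2 _ (by simpa using hk)

/-- For the degenerate case `τmin = 0`, in which the number of threshold steps is no longer
controlled. -/
theorem IsSubmodular.eq_zero_of_maxSingle (hf : IsSubmodular f) (hf0 : ∀ S, 0 ≤ f S)
    (hM : maxSingle f = 0) {S : Finset U} (hS : S.Nonempty) : f S = 0 := by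
  have h1 : ∀ x, f {x} = 0 := fun x => le_antisymm
    ((Finset.le_sup' (fun x => f {x}) (Finset.mem_univ x)).trans_eq hM) (hf0 _)
  induction hS using Finset.Nonempty.cons_induction with
  | singleton x => exact h1 x
  | cons x S hx _ ih =>
    have h2 := hf {x} S
    have h3 := hf0 ({x} ∩ S)
    rw [Finset.cons_eq_insert, Finset.insert_eq]
    have h4 := hf0 ({x} ∪ S)
    rw [h1, ih] at h2
    linarith

variable {ℓ : ℕ} {ε : ℝ}

/-- If no singleton has positive value, nothing is ever added. -/
theorem parallelInterlaceGreedy_stop (hM : maxGain f (∅ : Finset U) < 0) (m : ℕ) :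
    All f (parallelInterlaceGreedy (∅ : Finset U) m ℓ 0 ε) fun A' r _ =>
      (∀ l, A' l = ∅) ∧ r ≤ 2 := by
  rw [all_parallelInterlaceGreedy]
  cases m with
  | zero => exact ⟨fun l => rfl, by norm_num⟩
  | succ n =>
    rw [pigLoop_succ]
    split
    · exact ⟨fun l => rfl, by norm_num⟩
    · rw [all_bind]
      unfold update
      rw [all_ask_bind]
      have h1 : stepsBelow 0 ε (maxGain f (∅ : Finset U)) = 0 := stepsBelow_of_lt hM
      have h2 : ((initState U ℓ (maxGain f ∅)).I.sup fun j =>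
          stepsBelow 0 ε ((initState U ℓ (maxGain f ∅)).τ j)) = 0 := by
        refine Nat.le_zero.1 (Finset.sup_le fun j _ => ?_)
        exact h1.le
      rw [h2, lowerLoop, all_pure]
      rw [dif_neg]
      · exact ⟨fun l => rfl, by norm_num⟩
      · rw [Finset.not_nonempty_iff_eq_empty]
        refine Finset.filter_eq_empty_iff.2 fun j _ => ?_
        exact not_le.2 hM

theorem pitgLoop_stop (hM : maxGain f (∅ : Finset U) < 0) (hℓ : 0 < ℓ) (m i : ℕ) :
    All f (pitgLoop m ℓ 0 ε i (∅ : Finset U)) fun S r _ => S = ∅ ∧ r ≤ 2 * i := by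
  induction i with
  | zero => exact ⟨rfl, le_rfl⟩
  | succ i ih =>
    rw [pitgLoop_succ m ⟨⟨0, hℓ⟩, Finset.mem_univ _⟩, all_bind]
    refine (parallelInterlaceGreedy_stop hM m).mono ?_
    rintro A' r q ⟨hA, hr⟩ l _
    change All f (pitgLoop m ℓ 0 ε i (∅ ∪ A' l)) _
    rw [hA l, Finset.union_empty]
    refine ih.mono fun S r' q' hS => ⟨hS.1, ?_⟩
    have := hS.2
    omega

theorem maxGain_empty_neg (hf : IsSubmodular f) (hf0 : ∀ S, 0 ≤ f S) (hne : ∃ S, f S ≠ 0)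
    (hM : maxSingle f = 0) : maxGain f (∅ : Finset U) < 0 := by
  obtain ⟨S, hS⟩ := hne
  have hS0 : S = ∅ := by
    by_contra hc
    exact hS (hf.eq_zero_of_maxSingle hf0 hM (Finset.nonempty_iff_ne_empty.2 hc))
  subst hS0
  have h1 : 0 < f ∅ := lt_of_le_of_ne (hf0 _) (Ne.symm hS)
  unfold maxGain
  rw [Finset.sup'_lt_iff]
  intro x _
  have : f {x} = 0 := hf.eq_zero_of_maxSingle hf0 hM (Finset.singleton_nonempty x)
  simp only [gain, insert_empty_eq, this]
  linarith

/-- Consequences of the conditions on `k`, `ℓ` and `ε`. -/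
theorem parameters {k ℓ : ℕ} {ε : ℝ} (hε0 : 0 < ε)
    (hℓ : 4 / (Real.exp 1 * ε) ≤ ℓ)
    (hk : (2 - ε) ^ 2 * (ℓ : ℝ) ^ 2 ≤ k * (Real.exp 1 * ε * ℓ - 4)) (hε1 : ε < 1) :
    (1 : ℝ) < ℓ ∧ 0 < Real.exp 1 * ε / 4 - (ℓ : ℝ)⁻¹ ∧
      (1 - ε / 2) ^ 2 * ℓ ≤ k * (Real.exp 1 * ε / 4 - (ℓ : ℝ)⁻¹) ∧ 1 ≤ k := by
  have he := Real.exp_one_lt_d9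
  have he' := Real.exp_pos 1
  have hℓ1 : (1 : ℝ) < ℓ := by
    refine lt_of_lt_of_le ?_ hℓ
    rw [lt_div_iff₀ (by positivity)]
    nlinarith
  have hℓ0 : (0 : ℝ) < ℓ := by linarith
  have h1 : k * (Real.exp 1 * ε * ℓ - 4) =
      4 * ℓ * (k * (Real.exp 1 * ε / 4 - (ℓ : ℝ)⁻¹)) := by field_simp
  have h2 : (1 - ε / 2) ^ 2 * ℓ ≤ k * (Real.exp 1 * ε / 4 - (ℓ : ℝ)⁻¹) := by
    rw [h1] at hk
    have h3 : 4 * ℓ * ((1 - ε / 2) ^ 2 * ℓ) ≤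
        4 * ℓ * (k * (Real.exp 1 * ε / 4 - (ℓ : ℝ)⁻¹)) := by
      refine le_trans (le_of_eq ?_) hk
      ring
    exact le_of_mul_le_mul_left h3 (by positivity)
  have h3 : 0 < (1 - ε / 2) ^ 2 * ℓ := by
    have : 0 < 1 - ε / 2 := by linarith
    positivity
  have hkr : (0 : ℝ) ≤ k := Nat.cast_nonneg k
  have h4 : 0 < (k : ℝ) * (Real.exp 1 * ε / 4 - (ℓ : ℝ)⁻¹) := h3.trans_le h2
  have h5 : (k : ℝ) ≠ 0 := by rintro h; rw [h] at h4; simp at h4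
  refine ⟨hℓ1, ?_, h2, Nat.one_le_iff_ne_zero.2 (by exact_mod_cast h5)⟩
  exact (pos_iff_pos_of_mul_pos h4).1 (lt_of_le_of_ne hkr (Ne.symm h5))

/-- The factor for one interpolation step, relative to its ideal value `1 / ℓ`. -/
theorem step_factor {k ℓ : ℕ} {p : ℝ} (hp : 0 < p) (hp' : p ≤ 23 / 125) (hℓ : (1 : ℝ) < ℓ)
    (hy0 : 0 < Real.exp 1 * p / 2 - (ℓ : ℝ)⁻¹)
    (hk : (1 - p) ^ 2 * ℓ ≤ k * (Real.exp 1 * p / 2 - (ℓ : ℝ)⁻¹)) :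
    0 < k / ℓ ∧
    (ℓ : ℝ) ≤ ((1 - p) ^ 2)⁻¹ * (((k : ℝ) + ℓ - 1) / ((k / ℓ : ℕ) : ℝ)) + 1 ∧
    (1 - (7 / 2 * p + (Real.exp 1 * p / 2 - (ℓ : ℝ)⁻¹)) * (1 - 7 / 10 * p)) *
      (((1 - p) ^ 2)⁻¹ * (((k : ℝ) + ℓ - 1) / ((k / ℓ : ℕ) : ℝ)) + 1) ≤ ℓ := by
  have he := Real.exp_one_lt_d9
  set y := Real.exp 1 * p / 2 - (ℓ : ℝ)⁻¹ with hy
  have hℓ0 : (0 : ℝ) < ℓ := by linarith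
  have hu : 0 < (ℓ : ℝ)⁻¹ := by positivity
  have hyle : y + (ℓ : ℝ)⁻¹ ≤ 34 / 25 * p := by
    rw [hy]
    nlinarith
  have hA0 : 0 < 1 - 2 * p := by linarith
  have hAy : 0 < 1 - 2 * p - y := by linarith
  have hA : 1 - 2 * p ≤ (1 - p) ^ 2 := by nlinarith
  have hk' : (1 - 2 * p) * ℓ ≤ k * y := (mul_le_mul_of_nonneg_right hA hℓ0.le).trans hk
  have hkr : (0 : ℝ) ≤ k := Nat.cast_nonneg k
  have hkℓ : (ℓ : ℝ) < k := by
    have h2 : (k : ℝ) * y ≤ k * (34 / 25 * p) := mul_le_mul_of_nonneg_left (by linarith) hkr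
    nlinarith
  have hℓn : 0 < ℓ := by exact_mod_cast hℓ0
  have hm0 : 0 < k / ℓ := Nat.div_pos (by exact_mod_cast hkℓ.le) hℓn
  have hmr : (0 : ℝ) < ((k / ℓ : ℕ) : ℝ) := by exact_mod_cast hm0
  have hmul : ((k / ℓ : ℕ) : ℝ) * ℓ ≤ k := by exact_mod_cast Nat.div_mul_le_self k ℓ
  have hlow : (k : ℝ) - ℓ ≤ ((k / ℓ : ℕ) : ℝ) * ℓ := by
    have := Nat.lt_div_mul_add (a := k) hℓn
    have h2 : (k : ℝ) < ((k / ℓ : ℕ) : ℝ) * ℓ + ℓ := by exact_mod_cast this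
    linarith
  refine ⟨hm0, ?_, ?_⟩
  · have h2 : (ℓ : ℝ) ≤ ((k : ℝ) + ℓ - 1) / ((k / ℓ : ℕ) : ℝ) := by
      rw [le_div_iff₀ hmr]
      linarith
    have h3 : 1 ≤ ((1 - p) ^ 2)⁻¹ := (one_le_inv₀ (by nlinarith)).2 (by nlinarith)
    nlinarith
  · have hΛ : ((1 - p) ^ 2)⁻¹ ≤ (1 - 2 * p)⁻¹ := inv_anti₀ hA0 hA
    have hR : ((k : ℝ) + ℓ - 1) / ((k / ℓ : ℕ) : ℝ) ≤
        ℓ * ((1 - 2 * p + y) / (1 - 2 * p - y)) := by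
      rw [div_le_iff₀ hmr]
      -- By `hk'` the ratio `ℓ/k` is at most `y / (1 - 2 * p)`, and `(k + ℓ) / (k - ℓ)` increases
      -- with this ratio.
      have h2 : ((k : ℝ) + ℓ) ≤ (1 - 2 * p + y) / (1 - 2 * p - y) * (k - ℓ) := by
        rw [div_mul_eq_mul_div, le_div_iff₀ hAy]
        nlinarith
      have h3 : 0 ≤ (1 - 2 * p + y) / (1 - 2 * p - y) := div_nonneg (by linarith) hAy.le
      have h4 := mul_le_mul_of_nonneg_left hlow h3
      linarith
    have hR0 : 0 ≤ ((k : ℝ) + ℓ - 1) / ((k / ℓ : ℕ) : ℝ) := div_nonneg (by linarith) hmr.le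
    have hD : ((1 - p) ^ 2)⁻¹ * (((k : ℝ) + ℓ - 1) / ((k / ℓ : ℕ) : ℝ)) + 1 ≤
        ℓ * ((1 - 2 * p + y + (34 / 25 * p - y) * ((1 - 2 * p) * (1 - 2 * p - y))) /
          ((1 - 2 * p) * (1 - 2 * p - y))) := by
      have h2 := mul_le_mul hΛ hR hR0 (by positivity)
      have h3 : (1 - 2 * p)⁻¹ * (ℓ * ((1 - 2 * p + y) / (1 - 2 * p - y))) + ℓ * (34 / 25 * p - y) =
          ℓ * ((1 - 2 * p + y + (34 / 25 * p - y) * ((1 - 2 * p) * (1 - 2 * p - y))) /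
          ((1 - 2 * p) * (1 - 2 * p - y))) := by
        field_simp
      -- The summand `1` of the step factor is absorbed, since `ℓ⁻¹ = e * p / 2 - y`.
      have h4 : (1 : ℝ) ≤ ℓ * (34 / 25 * p - y) := by
        have h5 := mul_le_mul_of_nonneg_left (by linarith : (ℓ : ℝ)⁻¹ ≤ 34 / 25 * p - y) hℓ0.le
        rwa [mul_inv_cancel₀ hℓ0.ne'] at h5
      linarith
    have hw : 0 ≤ 1 - (7 / 2 * p + y) * (1 - 7 / 10 * p) := by nlinarith
    refine (mul_le_mul_of_nonneg_left hD hw).trans ?_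
    have h5 := threshold_tradeoff hp.le hp' hy0.le (by linarith : y ≤ 34 / 25 * p)
    rw [mul_left_comm, ← mul_div_assoc]
    refine mul_le_of_le_one_right hℓ0.le ?_
    rw [div_le_one (by positivity)]
    exact h5

/-- The approximation guarantee. -/
theorem approximation (hf0 : ∀ S, 0 ≤ f S) (hf : IsSubmodular f) (hne : ∃ S, f S ≠ 0)
    {k ℓ : ℕ} {ε : ℝ} (hε0 : 0 < ε) (hε1 : ε < 1) (hℓ : 4 / (Real.exp 1 * ε) ≤ ℓ)
    (hk : (2 - ε) ^ 2 * (ℓ : ℝ) ^ 2 ≤ k * (Real.exp 1 * ε * ℓ - 4)) {O : Finset U}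
    (hO : IsOptimal f k O) :
    (1 / Real.exp 1 - ε) * f O ≤ (parallelInterpolatedGreedy U k ℓ ε).expectedValue f := by
  rw [expectedValue_eq_ex]
  have hE0 := Real.exp_pos 1
  -- For `ε ≥ 1/e` the guarantee is void. Otherwise `p = ε/2` is below `23/125`.
  rcases le_or_gt (1 / Real.exp 1) ε with hε | hε
  · refine le_trans ?_ (le_ex (all_of_forall (fun S _ _ => hf0 S) _))
    exact mul_nonpos_of_nonpos_of_nonneg (by linarith) (hf0 O)
  obtain ⟨hℓ1, hy0, hky, hk1⟩ := parameters hε0 hℓ hk hε1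
  have hℓ0 : (0 : ℝ) < ℓ := by linarith
  have hℓ2 : 2 ≤ ℓ := by
    have : 1 < ℓ := by exact_mod_cast hℓ1
    omega
  rw [ex_parallelInterpolatedGreedy]
  rcases (maxSingle_nonneg hf0).eq_or_lt with hM | hM
  · rw [← hM]
    have h1 := pitgLoop_stop (ε := ε / 2) (maxGain_empty_neg hf hf0 hne hM.symm)
      (by omega : 0 < ℓ) (k / ℓ) ℓ
    simp only [mul_zero, zero_div]
    refine le_ex (h1.mono ?_)
    rintro S r q ⟨rfl, -⟩
    have h2 : f O ≤ f ∅ := by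
      rcases O.eq_empty_or_nonempty with rfl | hO'
      · exact le_rfl
      · rw [hf.eq_zero_of_maxSingle hf0 hM.symm hO']
        exact hf0 _
    have h3 : 1 / Real.exp 1 ≤ 1 := by
      rw [div_le_one hE0]
      linarith [Real.add_one_le_exp 1]
    have := hf0 O
    nlinarith
  have he := Real.exp_one_lt_d9
  have he' := Real.exp_one_gt_d9
  set E := Real.exp 1
  obtain ⟨p, rfl⟩ : ∃ p, ε = 2 * p := ⟨ε / 2, by ring⟩
  have hp0 : 0 < p := by linarith
  have hp1 : p ≤ 23 / 125 := by
    rw [lt_div_iff₀ hE0] at hε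
    nlinarith
  have hpp : 2 * p / 2 = p := by ring
  have hyy : E * (2 * p) / 4 = E * p / 2 := by ring
  rw [hyy] at hy0 hky
  rw [hpp] at hky ⊢
  obtain ⟨hm0, hDℓ, hDw⟩ := step_factor hp0 hp1 hℓ1 hy0 hky
  set D := ((1 - p) ^ 2)⁻¹ * (((k : ℝ) + ℓ - 1) / ((k / ℓ : ℕ) : ℝ)) + 1 with hDdef
  set u := (ℓ : ℝ)⁻¹ with hu
  set y := E * p / 2 - u with hy
  set w' := (7 / 2 * p + y) * (1 - 7 / 10 * p) with hw'
  have hu0 : 0 < u := by positivity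
  have hu1 : u < 1 := inv_lt_one_of_one_lt₀ hℓ1
  have huℓ : u * ℓ = 1 := inv_mul_cancel₀ hℓ0.ne'
  have hD0 : 0 < D := by linarith
  have hyle : y + u ≤ 34 / 25 * p := by
    rw [hy]
    nlinarith
  have hkr : (0 : ℝ) < k := by exact_mod_cast hk1
  have hau : D⁻¹ ≤ u := inv_anti₀ hℓ0 hDℓ
  -- `x` measures how far a step falls short of the ideal fraction `1/ℓ`; over `ℓ` steps this adds
  -- up to the loss `w = 1 - ℓ * D⁻¹`.
  obtain ⟨x, hx⟩ : ∃ x, x = (u - D⁻¹) / (1 - u) := ⟨_, rfl⟩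
  have hx0 : 0 ≤ x := by rw [hx]; exact div_nonneg (by linarith) (by linarith)
  have hu1' : 1 - u ≠ 0 := by linarith
  have hxu : (1 - u) * x = u - D⁻¹ := by rw [hx]; field_simp
  have hxa : (1 - u) * (1 + x) = 1 - D⁻¹ := by linarith
  have hval := pitgLoop_value (τmin := p * maxSingle f / k) (ε := p) hf hf0 (by positivity) hp0
    (by linarith) hm0 (Nat.div_mul_le_self k ℓ) hℓ2 hO.1 (a := D⁻¹) (u := u) (x := x)
    rfl rfl hxa hx0 ℓ ∅
  refine le_trans ?_ hval
  -- the three terms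
  obtain ⟨w, hw⟩ : ∃ w, w = 1 - ℓ * D⁻¹ := ⟨_, rfl⟩
  have hz : (ℓ : ℝ) * D⁻¹ = 1 - w := by linarith
  have hww' : w ≤ w' := by
    have : 1 - w' ≤ ℓ * D⁻¹ := by
      rw [← div_eq_mul_inv, le_div_iff₀ hD0]
      exact hDw
    linarith
  have hw0 : 0 ≤ w := by
    have : ℓ * D⁻¹ ≤ 1 := by
      rw [← div_eq_mul_inv, div_le_one hD0]
      exact hDℓ
    linarith
  have hw1 : w ≤ 1 := by
    have : 0 ≤ ℓ * D⁻¹ := by positivity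
    linarith
  have hpow := one_sub_inv_pow_ge hℓ2
  rw [← hu] at hpow
  have hpowu : 0 ≤ (1 - u) ^ ℓ := pow_nonneg (by linarith) _
  have hcoef : D⁻¹ * (ℓ + x * (ℓ * (ℓ - 1) / 2)) = (1 - w) * (1 + w / 2) := by
    have h1 : (ℓ : ℝ) * x * (1 - u) = w := by
      rw [mul_assoc, mul_comm x, hxu, mul_sub, mul_comm, huℓ, hz]
      ring
    have h2 : x * (ℓ * (ℓ - 1) / 2) = w * ℓ / 2 := by
      rw [← h1]
      linear_combination (x * ℓ / 2) * huℓ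
    rw [h2, ← hz]
    ring
  -- Needed to shrink the coefficient of the threshold error: shorter steps also accumulate less
  -- error, which partly offsets the loss.
  have hpa : ((1 - u) + w) / E ≤ (1 - D⁻¹) ^ ℓ := by
    have h1 : (ℓ : ℝ) * x * (1 - u) = w := by
      rw [mul_assoc, mul_comm x, hxu, mul_sub, mul_comm, huℓ, hz]
      ring
    have h2 : 1 + (ℓ : ℝ) * x ≤ (1 + x) ^ ℓ := one_add_mul_le_pow (by linarith) ℓ
    have h3 : 0 ≤ 1 + (ℓ : ℝ) * x := by positivity
    calc ((1 - u) + w) / E = (1 - u) / E * (1 + ℓ * x) := by rw [← h1]; ring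
      _ ≤ (1 - u) ^ ℓ * (1 + x) ^ ℓ := mul_le_mul hpow h2 h3 hpowu
      _ = (1 - D⁻¹) ^ ℓ := by rw [← mul_pow, hxa]
  have hMO := maxSingle_le hk1 hO
  have herr : (k : ℝ) * (p * maxSingle f / k / (1 - p)) ≤ p / (1 - p) * f O := by
    have h1 : (k : ℝ) * (p * maxSingle f / k / (1 - p)) = p / (1 - p) * maxSingle f := by
      field_simp
    rw [h1]
    exact mul_le_mul_of_nonneg_left hMO (div_nonneg hp0.le (by linarith))
  have hpa1 : 0 ≤ 1 - (1 - D⁻¹) ^ ℓ := by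
    have : (1 - D⁻¹) ^ ℓ ≤ 1 := pow_le_one₀ (by linarith) (by linarith [inv_pos.2 hD0])
    linarith
  rw [Finset.empty_union, hcoef]
  have h1 : 0 ≤ (1 - D⁻¹) ^ ℓ * f ∅ := mul_nonneg (pow_nonneg (by linarith) _) (hf0 _)
  have h2 : (1 - u) / E * ((1 - w) * (1 + w / 2)) * f O ≤
      (1 - u) ^ ℓ * ((1 - w) * (1 + w / 2)) * f O :=
    mul_le_mul_of_nonneg_right (mul_le_mul_of_nonneg_right hpow
      (mul_nonneg (by linarith) (by linarith))) (hf0 O)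
  have h3 : (1 - (1 - D⁻¹) ^ ℓ) * (k * (p * maxSingle f / k / (1 - p))) ≤
      (1 - ((1 - u) + w) / E) * (p / (1 - p) * f O) :=
    mul_le_mul (by linarith) herr (by
      have := hM.le
      have : 0 < 1 - p := by linarith
      positivity) (by linarith)
  have h4 := final_tradeoff (E := E) hp0 hp1 hy0.le hyle hu0.le (by linarith) (by rw [hy]; ring)
    hw' hw0 hww'
  have h5 := mul_le_mul_of_nonneg_right h4 (hf0 O)
  linarith

/-- The size constraint. -/
theorem card_output_le (hf0 : ∀ S, 0 ≤ f S) (hf : IsSubmodular f) (hne : ∃ S, f S ≠ 0)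
    {k ℓ : ℕ} {ε : ℝ} (hε0 : 0 < ε) (hε1 : ε < 1) (hk1 : 1 ≤ k) (hℓ : 0 < ℓ) :
    All f (parallelInterpolatedGreedy U k ℓ ε) fun S _ _ => S.card ≤ k := by
  rw [all_parallelInterpolatedGreedy]
  rcases (maxSingle_nonneg hf0).eq_or_lt with hM | hM
  · rw [← hM]
    simp only [mul_zero, zero_div]
    refine (pitgLoop_stop (ε := ε / 2) (maxGain_empty_neg hf hf0 hne hM.symm) hℓ (k / ℓ) ℓ).mono ?_
    rintro S r q ⟨rfl, -⟩
    simp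
  · have hkr : (0 : ℝ) < k := by exact_mod_cast hk1
    refine (pitgLoop_card_le hf hf0 (by positivity) (by linarith) (by linarith) (k / ℓ) hℓ ℓ
      ∅).mono ?_
    intro S r q hS
    refine hS.trans ?_
    rw [Finset.card_empty, zero_add]
    exact Nat.mul_div_le k ℓ

end TopLevel

/-! ### Averages over random orderings. -/

section RandomOrder

variable {α : Type}

/-- The average of `φ` over the orderings of `R`. -/
def permAvg (R : Finset α) (φ : List α → ℝ) : ℝ :=
  (∑ p ∈ R.toList.permutations.toFinset, φ p) / R.toList.permutations.toFinset.card

theorem permAvg_mono {R : Finset α} {φ χ : List α → ℝ} (h : ∀ p, φ p ≤ χ p) :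
    permAvg R φ ≤ permAvg R χ :=
  div_le_div_of_nonneg_right (Finset.sum_le_sum fun p _ => h p) (Nat.cast_nonneg _)

theorem permAvg_const (R : Finset α) (c : ℝ) : permAvg R (fun _ => c) = c := by
  unfold permAvg
  rw [Finset.sum_const, nsmul_eq_mul, mul_div_cancel_left₀]
  exact_mod_cast (orderings_nonempty R).card_pos.ne'

theorem permAvg_add (R : Finset α) (φ χ : List α → ℝ) :
    permAvg R (fun p => φ p + χ p) = permAvg R φ + permAvg R χ := by
  unfold permAvg
  rw [Finset.sum_add_distrib, add_div]

theorem permAvg_empty (φ : List α → ℝ) : permAvg ∅ φ = φ [] := by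
  unfold permAvg
  simp

theorem permAvg_comm (R S : Finset α) (φ : List α → List α → ℝ) :
    permAvg R (fun p => permAvg S (φ p)) = permAvg S (fun q => permAvg R fun p => φ p q) := by
  unfold permAvg
  rw [← Finset.sum_div, ← Finset.sum_div, Finset.sum_comm, div_right_comm]

theorem mem_orderings_iff {R : Finset α} {p : List α} :
    p ∈ R.toList.permutations.toFinset ↔ p.Nodup ∧ p.toFinset = R := by
  rw [mem_orderings]
  constructor
  · intro h
    exact ⟨h.nodup_iff.2 (Finset.nodup_toList R), by
      rw [List.toFinset_eq_of_perm _ _ h, Finset.toList_toFinset]⟩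
  · rintro ⟨h, rfl⟩
    exact List.perm_of_nodup_nodup_toFinset_eq h (Finset.nodup_toList _)
      (Finset.toList_toFinset _).symm

theorem card_orderings (R : Finset α) :
    R.toList.permutations.toFinset.card = R.card.factorial := by
  rw [List.toFinset_card_of_nodup (List.nodup_permutations _ (Finset.nodup_toList R)),
    List.length_permutations, Finset.length_toList]

/-- A random ordering starts with a random element. -/
theorem permAvg_eq_sum {R : Finset α} (hR : R.Nonempty) (φ : List α → ℝ) :
    permAvg R φ = (∑ v ∈ R, permAvg (R.erase v) fun p => φ (v :: p)) / R.card := by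
  have hset : R.toList.permutations.toFinset =
      R.biUnion fun v => (R.erase v).toList.permutations.toFinset.image (v :: ·) := by
    ext p
    simp only [Finset.mem_biUnion, Finset.mem_image, mem_orderings_iff]
    constructor
    · rintro ⟨h1, h2⟩
      cases p with
      | nil => simp at h2; simp [← h2] at hR
      | cons v p =>
        rw [List.nodup_cons] at h1
        rw [List.toFinset_cons] at h2
        refine ⟨v, by rw [← h2]; simp, p, ⟨h1.2, ?_⟩, rfl⟩
        rw [← h2, Finset.erase_insert]
        simpa using h1.1
    · rintro ⟨v, hv, p, ⟨h1, h2⟩, rfl⟩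
      refine ⟨List.nodup_cons.2 ⟨?_, h1⟩, ?_⟩
      · rw [← List.mem_toFinset, h2]
        simp
      · rw [List.toFinset_cons, h2, Finset.insert_erase hv]
  unfold permAvg
  rw [card_orderings]
  conv_lhs => rw [hset]
  rw [Finset.sum_biUnion]
  · have h1 : ∀ v ∈ R, (∑ p ∈ (R.erase v).toList.permutations.toFinset, φ (v :: p)) /
        ((R.erase v).toList.permutations.toFinset.card : ℝ) =
        (∑ p ∈ (R.erase v).toList.permutations.toFinset.image (v :: ·), φ p) /
          ((R.card - 1).factorial : ℝ) := fun v hv => by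
      rw [card_orderings, Finset.card_erase_of_mem hv, Finset.sum_image]
      intro p _ q _ hpq
      exact (List.cons_injective hpq)
    rw [Finset.sum_congr rfl h1, ← Finset.sum_div, div_div]
    congr 1
    have := Nat.mul_factorial_pred (Finset.card_pos.2 hR).ne'
    rw [mul_comm]
    exact_mod_cast this.symm
  · intro v _ w _ hvw
    simp only [Function.onFun]
    rw [Finset.disjoint_left]
    intro p hp hq
    obtain ⟨a, -, rfl⟩ := Finset.mem_image.1 hp
    obtain ⟨b, -, hb⟩ := Finset.mem_image.1 hq
    exact hvw (List.cons_eq_cons.1 hb).1.symm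

end RandomOrder

/-! ### Misses in a random ordering of one candidate set. -/

section Prefix

variable {U : Type} {f : Finset U → ℝ}

/-- The elements of `V` whose marginal gain over `T` is below `τ`. -/
def spoiled (f : Finset U → ℝ) (V : Finset U) (τ : ℝ) (T : Finset U) : Finset U :=
  V.filter fun x => gain f x T < τ

theorem spoiled_mono (hf : IsSubmodular f) {V : Finset U} {τ : ℝ} (hτ : 0 < τ) {T T' : Finset U}
    (h : T ⊆ T') : spoiled f V τ T ⊆ spoiled f V τ T' := by
  intro x hx
  obtain ⟨h1, h2⟩ := Finset.mem_filter.1 hx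
  refine Finset.mem_filter.2 ⟨h1, ?_⟩
  by_contra hc
  exact absurd (hf.le_gain_of_le h hτ (not_lt.1 hc)) (not_le.2 h2)

/-- The number of spoiled elements, relative to `d`. -/
def spoilRate (f : Finset U → ℝ) (V : Finset U) (τ : ℝ) (d : ℕ) (T : Finset U) : ℝ :=
  (spoiled f V τ T).card / d

theorem spoilRate_nonneg (V : Finset U) (τ : ℝ) (d : ℕ) (T : Finset U) :
    0 ≤ spoilRate f V τ d T := by
  unfold spoilRate
  positivity

theorem spoilRate_mono (hf : IsSubmodular f) (V : Finset U) {τ : ℝ} (hτ : 0 < τ) (d : ℕ)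
    {T T' : Finset U} (h : T ⊆ T') : spoilRate f V τ d T ≤ spoilRate f V τ d T' :=
  div_le_div_of_nonneg_right (by exact_mod_cast Finset.card_le_card (spoiled_mono hf hτ h))
    (Nat.cast_nonneg _)

/-- The number of entries that are not `good`. -/
def missCount (f : Finset U → ℝ) (τ : ℝ) : Finset U → List U → ℕ
  | _, [] => 0
  | T, v :: L => (if gain f v T < τ then 1 else 0) + missCount f τ (insert v T) L

theorem goodCount_add_missCount (τ : ℝ) (T : Finset U) (L : List U) :
    goodCount (markList f τ T L) + missCount f τ T L = L.length := by
  induction L generalizing T with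
  | nil => rfl
  | cons v L ih =>
    have ih := ih (insert v T)
    unfold goodCount at ih ⊢
    rw [markList, missCount, List.countP_cons, List.length_cons]
    by_cases h : τ ≤ f (insert v T) - f T
    · have h' : ¬ gain f v T < τ := not_lt.2 h
      simp only [if_pos h, if_neg h', decide_true, if_true]
      omega
    · have h' : gain f v T < τ := not_le.1 h
      simp only [if_neg h, if_pos h']
      by_cases h2 : f (insert v T) - f T < 0
      · simp only [if_pos h2]
        simp
        omega
      · simp only [if_neg h2]
        simp
        omega

/-- The spoil rate of the longest prefix of length at most `i` all of whose entries are `good`. -/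
def goodRate (f : Finset U → ℝ) (V : Finset U) (τ : ℝ) (d : ℕ) : Finset U → List U → ℕ → ℝ
  | T, _, 0 => spoilRate f V τ d T
  | T, [], _ + 1 => spoilRate f V τ d T
  | T, v :: L, i + 1 =>
      if gain f v T < τ then spoilRate f V τ d T else goodRate f V τ d (insert v T) L i

theorem goodRate_zero (V : Finset U) (τ : ℝ) (d : ℕ) (T : Finset U) (L : List U) :
    goodRate f V τ d T L 0 = spoilRate f V τ d T := by
  cases L <;> rfl

theorem goodRate_cons_of_lt {V : Finset U} {τ : ℝ} {d : ℕ} {T : Finset U} {v : U}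
    (hv : gain f v T < τ) (L : List U) (i : ℕ) :
    goodRate f V τ d T (v :: L) i = spoilRate f V τ d T := by
  cases i with
  | zero => rfl
  | succ i => exact if_pos hv

theorem goodRate_cons_succ {V : Finset U} {τ : ℝ} {d : ℕ} {T : Finset U} {v : U}
    (hv : ¬ gain f v T < τ) (L : List U) (i : ℕ) :
    goodRate f V τ d T (v :: L) (i + 1) = goodRate f V τ d (insert v T) L i := if_neg hv

theorem goodRate_nonneg (V : Finset U) (τ : ℝ) (d : ℕ) (T : Finset U) (L : List U) (i : ℕ) :
    0 ≤ goodRate f V τ d T L i := by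
  induction L generalizing T i with
  | nil => cases i <;> exact spoilRate_nonneg _ _ _ _
  | cons v L ih =>
    cases i with
    | zero => exact spoilRate_nonneg _ _ _ _
    | succ i =>
      rw [goodRate]
      split
      · exact spoilRate_nonneg _ _ _ _
      · exact ih _ _

theorem spoilRate_le_goodRate (hf : IsSubmodular f) (V : Finset U) {τ : ℝ} (hτ : 0 < τ) (d : ℕ)
    (T : Finset U) (L : List U) (i : ℕ) :
    spoilRate f V τ d T ≤ goodRate f V τ d T L i := by
  induction L generalizing T i with
  | nil => cases i <;> exact le_rfl
  | cons v L ih =>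
    cases i with
    | zero => exact le_rfl
    | succ i =>
      rw [goodRate]
      split
      · exact le_rfl
      · exact (spoilRate_mono hf V hτ d (Finset.subset_insert v T)).trans (ih _ _)

theorem goodRate_mono (hf : IsSubmodular f) (V : Finset U) {τ : ℝ} (hτ : 0 < τ) (d : ℕ)
    (T : Finset U) (L : List U) : Monotone (goodRate f V τ d T L) := by
  refine monotone_nat_of_le_succ fun i => ?_
  induction i generalizing T L with
  | zero =>
    rw [goodRate_zero]
    exact spoilRate_le_goodRate hf V hτ d T L 1
  | succ i ih =>
    cases L with
    | nil => exact le_rfl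
    | cons v L =>
      rw [goodRate, goodRate]
      split
      · exact le_rfl
      · exact ih _ _

/-- `goodRate` is the spoil rate of a prefix of good entries. -/
theorem exists_goodRate_eq (V : Finset U) (τ : ℝ) (d : ℕ) (T : Finset U) (L : List U) (i : ℕ) :
    ∃ n, n ≤ i ∧ missCount f τ T (L.take n) = 0 ∧
      goodRate f V τ d T L i = spoilRate f V τ d (T ∪ (L.take n).toFinset) := by
  induction L generalizing T i with
  | nil => exact ⟨0, Nat.zero_le _, rfl, by cases i <;> simp [goodRate]⟩
  | cons v L ih =>
    cases i with
    | zero => exact ⟨0, le_rfl, rfl, by simp [goodRate]⟩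
    | succ i =>
      by_cases hv : gain f v T < τ
      · exact ⟨0, Nat.zero_le _, rfl, by rw [goodRate_cons_of_lt hv]; simp⟩
      · obtain ⟨n, h1, h2, h3⟩ := ih (insert v T) i
        refine ⟨n + 1, by omega, ?_, ?_⟩
        · rw [List.take_succ_cons, missCount, if_neg hv, h2]
        · rw [goodRate_cons_succ hv, h3, List.take_succ_cons, List.toFinset_cons,
            Finset.insert_union, Finset.union_insert]

/-- After a first miss, some prefix has too many misses although few elements are spoiled. -/
def LateViol (f : Finset U → ℝ) (V : Finset U) (τ ε : ℝ) (d : ℕ) :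
    Finset U → ℕ → ℕ → List U → Prop
  | _, _, _, [] => False
  | T, t, S, v :: L =>
      (spoilRate f V τ d T < ε / 4 ∧
        ε * (t + 1) < (S + (if gain f v T < τ then 1 else 0) : ℕ)) ∨
      LateViol f V τ ε d (insert v T) (t + 1) (S + (if gain f v T < τ then 1 else 0)) L

theorem LateViol.rate_lt (hf : IsSubmodular f) {V : Finset U} {τ : ℝ} (hτ : 0 < τ) {ε : ℝ} {d : ℕ}
    {T : Finset U} {t S : ℕ} {L : List U} (h : LateViol f V τ ε d T t S L) :
    spoilRate f V τ d T < ε / 4 := by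
  induction L generalizing T t S with
  | nil => exact h.elim
  | cons v L ih =>
    rcases h with h | h
    · exact h.1
    · exact (spoilRate_mono hf V hτ d (Finset.subset_insert v T)).trans_lt (ih h)

theorem lateViol_of_missCount {V : Finset U} {τ ε : ℝ} {d : ℕ} {T : Finset U} {t S : ℕ}
    {L : List U} {i : ℕ} (hi : i < L.length)
    (hb : spoilRate f V τ d (T ∪ (L.take i).toFinset) < ε / 4)
    (hmiss : ε * (t + i + 1) < (S + missCount f τ T (L.take (i + 1)) : ℕ)) :
    LateViol f V τ ε d T t S L := by
  induction L generalizing T t S i with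
  | nil => simp at hi
  | cons v L ih =>
    cases i with
    | zero =>
      refine Or.inl ⟨by simpa using hb, ?_⟩
      simpa [missCount] using hmiss
    | succ i =>
      refine Or.inr (ih (i := i) ?_ ?_ ?_)
      · simpa using hi
      · rw [List.take_succ_cons, List.toFinset_cons, Finset.union_insert,
          ← Finset.insert_union] at hb
        exact hb
      · rw [List.take_succ_cons, missCount, ← Nat.add_assoc] at hmiss
        refine lt_of_eq_of_lt ?_ hmiss
        push_cast
        ring

/-- Some prefix has too many misses although few elements are spoiled, also when the other
solutions are taken into account by `ψ`. -/
def EarlyViol (f : Finset U → ℝ) (V : Finset U) (τ ε κ : ℝ) (d : ℕ) (ψ : ℕ → ℝ) :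
    Finset U → ℕ → List U → Prop
  | _, _, [] => False
  | T, t, v :: L =>
      if gain f v T < τ then
        ψ t + spoilRate f V τ d T < κ ∧
          ((spoilRate f V τ d T < ε / 4 ∧ ε * (t + 1) < 1) ∨
            LateViol f V τ ε d (insert v T) (t + 1) 1 L)
      else EarlyViol f V τ ε κ d ψ (insert v T) (t + 1) L

/-- Monotonicity of `ψ` carries the smallness of the total rate from the violating position `i` back
to the first miss, where `goodRate` stops growing. -/
theorem earlyViol_of_missCount {V : Finset U} {τ ε κ : ℝ} (h0 : 0 < ε) {d : ℕ} {ψ : ℕ → ℝ}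
    (hψ : Monotone ψ) {T : Finset U} {t : ℕ} {L : List U} {i : ℕ} (hi : i < L.length)
    (hb : spoilRate f V τ d (T ∪ (L.take i).toFinset) < ε / 4)
    (hrate : ψ (t + i) + goodRate f V τ d T L i < κ)
    (hmiss : ε * (t + i + 1) < missCount f τ T (L.take (i + 1))) :
    EarlyViol f V τ ε κ d ψ T t L := by
  induction L generalizing T t i with
  | nil => simp at hi
  | cons v L ih =>
    rw [EarlyViol]
    by_cases hv : gain f v T < τ
    · rw [if_pos hv]
      rw [goodRate_cons_of_lt hv] at hrate
      refine ⟨lt_of_le_of_lt (by linarith [hψ (Nat.le_add_right t i)]) hrate, ?_⟩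
      rw [List.take_succ_cons, missCount, if_pos hv] at hmiss
      cases i with
      | zero =>
        refine Or.inl ⟨by simpa using hb, ?_⟩
        simpa [missCount] using hmiss
      | succ i =>
        refine Or.inr (lateViol_of_missCount (i := i) (by simpa using hi) ?_ ?_)
        · rw [List.take_succ_cons, List.toFinset_cons, Finset.union_insert,
            ← Finset.insert_union] at hb
          exact hb
        · refine lt_of_eq_of_lt ?_ hmiss
          push_cast
          ring
    · rw [if_neg hv]
      rw [List.take_succ_cons, missCount, if_neg hv, Nat.zero_add] at hmiss
      cases i with
      | zero =>
        exfalso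
        simp only [List.take_zero, missCount, Nat.cast_zero] at hmiss
        have : (0 : ℝ) ≤ ε * (t + 0 + 1) := by positivity
        linarith
      | succ i =>
        refine ih (i := i) (by simpa using hi) ?_ ?_ ?_
        · rw [List.take_succ_cons, List.toFinset_cons, Finset.union_insert,
            ← Finset.insert_union] at hb
          exact hb
        · rw [goodRate_cons_succ hv] at hrate
          rwa [Nat.add_right_comm, Nat.add_assoc]
        · refine lt_of_eq_of_lt ?_ hmiss
          push_cast
          ring

/-- The situation after `t` elements have been drawn: `R` are the remaining ones. -/
structure Drawn (V : Finset U) (d : ℕ) (R T : Finset U) (t : ℕ) : Prop where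
  sub : R ⊆ V
  disj : Disjoint R T
  le : t ≤ (V ∩ T).card
  card : R.card + t = d

theorem Drawn.next {V : Finset U} {d : ℕ} {R T : Finset U} {t : ℕ} (h : Drawn V d R T t) {v : U}
    (hv : v ∈ R) : Drawn V d (R.erase v) (insert v T) (t + 1) where
  sub := (Finset.erase_subset _ _).trans h.sub
  disj := by
    rw [Finset.disjoint_insert_right]
    exact ⟨Finset.notMem_erase _ _, h.disj.mono_left (Finset.erase_subset _ _)⟩
  le := by
    rw [Finset.inter_insert_of_mem (h.sub hv), Finset.card_insert_of_notMem]
    · exact Nat.add_le_add_right h.le 1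
    · exact fun hc => Finset.disjoint_left.1 h.disj hv (Finset.mem_inter.1 hc).2
  card := by
    have := h.card
    have := Finset.card_pos.2 ⟨v, hv⟩
    rw [Finset.card_erase_of_mem hv]
    omega

/-- The probability that the next element is a miss. -/
theorem Drawn.card_miss_le {V : Finset U} {d : ℕ} {R T : Finset U} {t : ℕ} (h : Drawn V d R T t)
    {τ : ℝ} (hτ : 0 < τ) (hR : R.Nonempty) (hb : spoilRate f V τ d T ≤ 1) :
    ((R.filter fun v => gain f v T < τ).card : ℝ) ≤ R.card * spoilRate f V τ d T := by
  have hd : (0 : ℝ) < d := by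
    have := h.card
    have := Finset.card_pos.2 hR
    exact_mod_cast (by omega : 0 < d)
  -- The `t` elements drawn before are spoiled as well, having gain zero. With rate `b ≤ 1` the
  -- misses number at most `b * d - t ≤ b * (d - t)`, so drawing without replacement does no harm.
  have h1 : (R.filter fun v => gain f v T < τ).card + t ≤ (spoiled f V τ T).card := by
    have h2 : Disjoint (R.filter fun v => gain f v T < τ) (V ∩ T) :=
      h.disj.mono (Finset.filter_subset _ _) Finset.inter_subset_right
    refine (Nat.add_le_add_left h.le _).trans ?_
    rw [← Finset.card_union_of_disjoint h2]
    refine Finset.card_le_card (Finset.union_subset ?_ ?_)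
    · exact Finset.filter_subset_filter _ h.sub
    · intro x hx
      obtain ⟨h3, h4⟩ := Finset.mem_inter.1 hx
      exact Finset.mem_filter.2 ⟨h3, by rw [gain_of_mem h4]; exact hτ⟩
  unfold spoilRate at hb ⊢
  rw [div_le_one hd] at hb
  rw [mul_div_assoc', le_div_iff₀ hd]
  have h2 : ((R.filter fun v => gain f v T < τ).card : ℝ) + t ≤ (spoiled f V τ T).card := by
    exact_mod_cast h1
  have h3 : (R.card : ℝ) + t = d := by exact_mod_cast h.card
  have h4 : (0 : ℝ) ≤ t := Nat.cast_nonneg t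
  have h5 : (0 : ℝ) ≤ R.card := Nat.cast_nonneg _
  rw [← h3] at hb ⊢
  nlinarith

/-- `exp (misses - ε * t / 2)` is a supermartingale while the spoil rate is below `ε/4`: a further
draw multiplies the expectation of `exp (misses)` by at most `1 + (e - 1) * ε / 4 ≤ exp (ε / 2)`. -/
theorem permAvg_lateViol_le (hf : IsSubmodular f) {V : Finset U} {τ : ℝ} (hτ : 0 < τ) {ε : ℝ}
    (h0 : 0 < ε) (h1 : ε < 1) {d : ℕ} {R T : Finset U} {t S : ℕ} (h : Drawn V d R T t) :
    permAvg R (fun L => if LateViol f V τ ε d T t S L then 1 else 0) ≤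
      Real.exp (S - ε * t / 2) := by
  induction hn : R.card generalizing R T t S with
  | zero =>
    rw [Finset.card_eq_zero.1 hn, permAvg_empty, if_neg (by exact fun h => h)]
    exact (Real.exp_pos _).le
  | succ n ih =>
    have hR : R.Nonempty := Finset.card_pos.1 (by omega)
    have hRr : (0 : ℝ) < R.card := by exact_mod_cast Finset.card_pos.2 hR
    by_cases hb : spoilRate f V τ d T < ε / 4
    · rw [permAvg_eq_sum hR, div_le_iff₀ hRr]
      set X := Real.exp (S - ε * (t + 1) / 2) with hX
      have hX0 : 0 < X := Real.exp_pos _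
      have hstep : ∀ v ∈ R, permAvg (R.erase v)
          (fun p => if LateViol f V τ ε d T t S (v :: p) then (1 : ℝ) else 0) ≤
          X + if gain f v T < τ then (Real.exp 1 - 1) * X else 0 := by
        intro v hv
        have hS : Real.exp ((S + (if gain f v T < τ then 1 else 0) : ℕ) - ε * (t + 1 : ℕ) / 2) =
            X + if gain f v T < τ then (Real.exp 1 - 1) * X else 0 := by
          split
          · push_cast
            rw [show ((S : ℝ) + 1 - ε * (t + 1) / 2) = 1 + (S - ε * (t + 1) / 2) by ring,
              Real.exp_add]
            ring
          · push_cast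
            rw [add_zero, add_zero]
        rw [← hS]
        -- At a violation the exponent is positive, so the bound is at least `1`.
        by_cases hnow : ε * (t + 1) < (S + (if gain f v T < τ then 1 else 0) : ℕ)
        · refine le_trans (permAvg_mono (χ := fun _ => 1) fun p => ?_) ?_
          · split <;> norm_num
          · rw [permAvg_const]
            refine Real.one_le_exp ?_
            have : 0 < ε * ((t : ℝ) + 1) := by positivity
            push_cast at hnow ⊢
            linarith
        · refine le_trans (permAvg_mono fun p => ?_) (ih (S := S + if gain f v T < τ then 1 else 0)
            (h.next hv) (by rw [Finset.card_erase_of_mem hv]; omega))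
          have : LateViol f V τ ε d T t S (v :: p) ↔ LateViol f V τ ε d (insert v T) (t + 1)
              (S + if gain f v T < τ then 1 else 0) p :=
            or_iff_right fun hc => hnow hc.2
          simp only [this]
          exact le_rfl
      refine (Finset.sum_le_sum hstep).trans ?_
      rw [Finset.sum_add_distrib, Finset.sum_const, nsmul_eq_mul, ← Finset.sum_filter,
        Finset.sum_const, nsmul_eq_mul]
      have hmiss := h.card_miss_le (f := f) hτ hR (by linarith)
      have he := Real.exp_one_lt_d9
      have he' : (0 : ℝ) < Real.exp 1 - 1 := by linarith [Real.exp_one_gt_d9]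
      have h2 : X * (1 + (Real.exp 1 - 1) * (ε / 4)) ≤ Real.exp (S - ε * t / 2) := by
        have h3 : 1 + (Real.exp 1 - 1) * (ε / 4) ≤ Real.exp (ε / 2) := by
          have := Real.add_one_le_exp (ε / 2)
          nlinarith
        calc X * (1 + (Real.exp 1 - 1) * (ε / 4)) ≤ X * Real.exp (ε / 2) := by gcongr
          _ = Real.exp (S - ε * t / 2) := by
            rw [hX, ← Real.exp_add]
            congr 1
            ring
      have h3 : ((R.filter fun v => gain f v T < τ).card : ℝ) ≤ R.card * (ε / 4) :=
        hmiss.trans (mul_le_mul_of_nonneg_left hb.le hRr.le)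
      have h4 := mul_le_mul_of_nonneg_right h3 (mul_nonneg he'.le hX0.le)
      have h5 := mul_le_mul_of_nonneg_right h2 hRr.le
      linarith
    · refine le_trans (permAvg_mono (χ := fun _ => 0) fun p => ?_) ?_
      · rw [if_neg fun hc => hb (LateViol.rate_lt hf hτ hc)]
      · rw [permAvg_const]
        exact (Real.exp_pos _).le

/-- The accumulated hazard of a first miss that is followed by a violation. -/
def hazard (f : Finset U → ℝ) (V : Finset U) (τ ε κ : ℝ) (d : ℕ) (ψ : ℕ → ℝ) (T : Finset U)
    (t : ℕ) (L : List U) : ℝ :=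
  ∑ i ∈ Finset.range L.length,
    if ψ (t + i) + goodRate f V τ d T L i < κ then
      goodRate f V τ d T L i * Real.exp (1 - ε * (t + i + 1) / 2) else 0

theorem hazard_nonneg (V : Finset U) (τ ε κ : ℝ) (d : ℕ) (ψ : ℕ → ℝ) (T : Finset U)
    (t : ℕ) (L : List U) : 0 ≤ hazard f V τ ε κ d ψ T t L := by
  refine Finset.sum_nonneg fun i _ => ?_
  split
  · exact mul_nonneg (goodRate_nonneg _ _ _ _ _ _) (Real.exp_pos _).le
  · exact le_rfl

theorem le_hazard_cons (V : Finset U) (τ ε κ : ℝ) (d : ℕ) (ψ : ℕ → ℝ) (T : Finset U)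
    (t : ℕ) (v : U) (L : List U) :
    (if ψ t + spoilRate f V τ d T < κ then
      spoilRate f V τ d T * Real.exp (1 - ε * (t + 1) / 2) else 0) +
      (if gain f v T < τ then 0 else hazard f V τ ε κ d ψ (insert v T) (t + 1) L) ≤
      hazard f V τ ε κ d ψ T t (v :: L) := by
  unfold hazard
  rw [List.length_cons, Finset.sum_range_succ', goodRate_zero, add_comm]
  simp only [Nat.cast_zero, add_zero]
  refine add_le_add ?_ le_rfl
  split
  · refine Finset.sum_nonneg fun i _ => ?_
    split
    · exact mul_nonneg (goodRate_nonneg _ _ _ _ _ _) (Real.exp_pos _).le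
    · exact le_rfl
  · rename_i hv
    refine Finset.sum_le_sum fun i _ => le_of_eq ?_
    rw [goodRate_cons_succ hv, Nat.add_right_comm t 1 i, ← Nat.add_assoc]
    push_cast
    rw [add_right_comm (t : ℝ) 1 i, ← add_assoc (t : ℝ) i 1]

/-- Decompose by the position of the first miss. Up to there all entries are good, so `goodRate`
bounds the chance of missing at that position; given the miss, a violation has chance at most the
exponential factor, by `permAvg_lateViol_le` with one miss on the count. The hazard adds up these
products. -/
theorem permAvg_earlyViol_le (hf : IsSubmodular f) {V : Finset U} {τ : ℝ} (hτ : 0 < τ) {ε κ : ℝ}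
    (h0 : 0 < ε) (h1 : ε < 1) (hκ : κ ≤ 1) {d : ℕ} {ψ : ℕ → ℝ} (hψ : ∀ i, 0 ≤ ψ i)
    {R T : Finset U} {t : ℕ} (h : Drawn V d R T t) :
    permAvg R (fun L => if EarlyViol f V τ ε κ d ψ T t L then 1 else 0) ≤
      permAvg R (hazard f V τ ε κ d ψ T t) := by
  induction hn : R.card generalizing R T t with
  | zero =>
    rw [Finset.card_eq_zero.1 hn, permAvg_empty, permAvg_empty, if_neg (by exact fun h => h)]
    exact hazard_nonneg _ _ _ _ _ _ _ _ _
  | succ n ih =>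
    have hR : R.Nonempty := Finset.card_pos.1 (by omega)
    rw [permAvg_eq_sum hR, permAvg_eq_sum hR]
    refine div_le_div_of_nonneg_right ?_ (Nat.cast_nonneg _)
    set Y := if ψ t + spoilRate f V τ d T < κ then Real.exp (1 - ε * (t + 1) / 2) else 0 with hY
    have hY0 : 0 ≤ Y := by
      rw [hY]
      split
      · exact (Real.exp_pos _).le
      · exact le_rfl
    have hcons : ∀ v, Y * spoilRate f V τ d T + permAvg (R.erase v) (fun L =>
        if gain f v T < τ then 0 else hazard f V τ ε κ d ψ (insert v T) (t + 1) L) ≤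
        permAvg (R.erase v) (fun L => hazard f V τ ε κ d ψ T t (v :: L)) := by
      intro v
      rw [← permAvg_const (R.erase v) (Y * spoilRate f V τ d T), ← permAvg_add]
      refine permAvg_mono fun L => le_trans (le_of_eq ?_) (le_hazard_cons V τ ε κ d ψ T t v L)
      congr 1
      rw [hY]
      split
      · ring
      · ring
    refine le_trans ?_ (Finset.sum_le_sum fun v _ => hcons v)
    rw [Finset.sum_add_distrib, Finset.sum_const, nsmul_eq_mul]
    have hmiss : ((R.filter fun v => gain f v T < τ).card : ℝ) * Y ≤
        R.card * (Y * spoilRate f V τ d T) := by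
      by_cases hc : ψ t + spoilRate f V τ d T < κ
      · have := h.card_miss_le (f := f) hτ hR (by linarith [hψ t])
        have := mul_le_mul_of_nonneg_right this hY0
        linarith
      · rw [hY, if_neg hc]
        simp
    have hstep : ∀ v ∈ R, permAvg (R.erase v)
        (fun p => if EarlyViol f V τ ε κ d ψ T t (v :: p) then (1 : ℝ) else 0) ≤
        (if gain f v T < τ then Y else 0) + permAvg (R.erase v) (fun L =>
          if gain f v T < τ then 0 else hazard f V τ ε κ d ψ (insert v T) (t + 1) L) := by
      intro v hv
      by_cases hg : gain f v T < τ
      · simp only [if_pos hg, EarlyViol, permAvg_const, add_zero]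
        by_cases hc : ψ t + spoilRate f V τ d T < κ
        · rw [hY, if_pos hc]
          by_cases hnow : ε * ((t : ℝ) + 1) < 1
          · refine le_trans (permAvg_mono (χ := fun _ => 1) fun p => ?_) ?_
            · split <;> norm_num
            · rw [permAvg_const]
              refine Real.one_le_exp ?_
              have : 0 < ε * ((t : ℝ) + 1) := by positivity
              linarith
          · have hl := permAvg_lateViol_le (S := 1) hf hτ h0 h1 (h.next hv)
            push_cast at hl
            refine le_trans (permAvg_mono fun p => ?_) hl
            simp only [hc, hnow, and_false, false_or, true_and]
            exact le_rfl
        · rw [hY, if_neg hc]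
          simp only [hc, false_and, if_false, permAvg_const]
          exact le_rfl
      · simp only [if_neg hg, EarlyViol, zero_add]
        exact ih (h.next hv) (by rw [Finset.card_erase_of_mem hv]; omega)
    refine (Finset.sum_le_sum hstep).trans ?_
    rw [Finset.sum_add_distrib, ← Finset.sum_filter, Finset.sum_const, nsmul_eq_mul]
    linarith

end Prefix

/-! ### Violations in all solutions together. -/

section Violation

variable {U : Type} {ℓ : ℕ} {f : Finset U → ℝ}

theorem ex_permuteAll_cons (D : Fin ℓ → Finset U) (j : Fin ℓ) (js : List (Fin ℓ))
    (φ : (Fin ℓ → List U) → ℝ) :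
    Ex f (permuteAll D (j :: js)) (fun L _ _ => φ L) =
      Ex f (permuteAll D js) fun L _ _ => permAvg (D j) fun p => φ (Function.update L j p) := by
  rw [permuteAll, ex_bind]
  congr 1
  funext L r q
  rw [ex_bind, ex_pick (orderings_nonempty _)]
  rfl

/-- The orderings are independent. -/
theorem ex_permuteAll_le {D : Fin ℓ → Finset U} {js : List (Fin ℓ)} {j : Fin ℓ} (hj : j ∈ js)
    {φ χ : (Fin ℓ → List U) → ℝ}
    (h : ∀ L, permAvg (D j) (fun p => φ (Function.update L j p)) ≤
      permAvg (D j) fun p => χ (Function.update L j p)) :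
    Ex f (permuteAll D js) (fun L _ _ => φ L) ≤ Ex f (permuteAll D js) fun L _ _ => χ L := by
  induction js generalizing φ χ with
  | nil => simp at hj
  | cons i js ih =>
    rw [ex_permuteAll_cons, ex_permuteAll_cons]
    by_cases hij : j = i
    · subst hij
      exact ex_le_ex (all_of_forall (fun L _ _ => h L) _)
    · refine ih (List.mem_of_ne_of_mem hij hj) fun L => ?_
      rw [permAvg_comm, permAvg_comm (D j)]
      refine permAvg_mono fun p => ?_
      simp only [Function.update_comm hij]
      exact h _

theorem sum_exp_le {ε : ℝ} (h0 : 0 < ε) (N : ℕ) :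
    ∑ i ∈ Finset.range N, Real.exp (1 - ε * (i + 1) / 2) ≤
      Real.exp 1 * (2 / ε) * (1 - Real.exp (-(ε * N / 2))) := by
  induction N with
  | zero => simp
  | succ N ih =>
    rw [Finset.sum_range_succ]
    set X := Real.exp (-(ε * (N + 1 : ℕ) / 2)) with hX
    have hX0 : 0 < X := Real.exp_pos _
    have h1 : Real.exp (1 - ε * (N + 1) / 2) = Real.exp 1 * X := by
      rw [hX, ← Real.exp_add]
      congr 1
      push_cast
      ring
    have h2 : X * (1 + ε / 2) ≤ Real.exp (-(ε * N / 2)) := by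
      calc X * (1 + ε / 2) ≤ X * Real.exp (ε / 2) := by
            gcongr
            linarith [Real.add_one_le_exp (ε / 2)]
        _ = Real.exp (-(ε * N / 2)) := by
          rw [hX, ← Real.exp_add]
          congr 1
          push_cast
          ring
    rw [h1]
    have h3 : Real.exp 1 * X = Real.exp 1 * (2 / ε) * (X * (ε / 2)) := by
      field_simp
    have h4 : 0 ≤ Real.exp 1 * (2 / ε) := by positivity
    have h5 := mul_le_mul_of_nonneg_left h2 h4
    rw [h3]
    linarith

/-- The good rate of the ordering of solution `j`. -/
def blockRate (f : Finset U → ℝ) (G : Finset U) (st : PIGState U ℓ) (D : Fin ℓ → Finset U)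
    (L : Fin ℓ → List U) (j : Fin ℓ) (i : ℕ) : ℝ :=
  goodRate f (st.V j) (st.τ j) (D j).card (G ∪ st.A j) (L j) i

/-- The ordering of solution `j` has a prefix with too many misses. -/
def BlockViol (f : Finset U → ℝ) (G : Finset U) (ε : ℝ) (st : PIGState U ℓ)
    (D : Fin ℓ → Finset U) (L : Fin ℓ → List U) (j : Fin ℓ) : Prop :=
  EarlyViol f (st.V j) (st.τ j) ε (ε / 12) (D j).card
    (fun i => ∑ l ∈ st.I.erase j, blockRate f G st D L l i) (G ∪ st.A j) 0 (L j)

variable {G : Finset U} {ε : ℝ} {st : PIGState U ℓ} {D : Fin ℓ → Finset U}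

theorem blockRate_nonneg (L : Fin ℓ → List U) (j : Fin ℓ) (i : ℕ) :
    0 ≤ blockRate f G st D L j i := goodRate_nonneg _ _ _ _ _ _

/-- The sum over the solutions is taken first: at each position the counted rates total less than
`ε/12`, so the union bound costs no factor `ℓ`. The positions then give `ε/12 * e * 2/ε = e/6 <
1/2`. -/
theorem sum_hazard_le (h0 : 0 < ε) (L : Fin ℓ → List U) :
    ∑ j ∈ st.I, hazard f (st.V j) (st.τ j) ε (ε / 12) (D j).card
      (fun i => ∑ l ∈ st.I.erase j, blockRate f G st D L l i) (G ∪ st.A j) 0 (L j) ≤ 1 / 2 := by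
  set N := ∑ j, (L j).length with hN
  have hlen : ∀ j, (L j).length ≤ N := fun j =>
    Finset.single_le_sum (f := fun j => (L j).length) (fun _ _ => Nat.zero_le _)
      (Finset.mem_univ j)
  have h1 : ∀ j ∈ st.I, hazard f (st.V j) (st.τ j) ε (ε / 12) (D j).card
      (fun i => ∑ l ∈ st.I.erase j, blockRate f G st D L l i) (G ∪ st.A j) 0 (L j) ≤
      ∑ i ∈ Finset.range N, if ∑ l ∈ st.I, blockRate f G st D L l i < ε / 12 then
        blockRate f G st D L j i * Real.exp (1 - ε * (i + 1) / 2) else 0 := by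
    intro j hj
    unfold hazard
    refine le_trans (Finset.sum_le_sum_of_subset_of_nonneg
      (Finset.range_subset_range.2 (hlen j)) fun i _ _ => ?_) (Finset.sum_le_sum fun i _ => ?_)
    · split
      · exact mul_nonneg (goodRate_nonneg _ _ _ _ _ _) (Real.exp_pos _).le
      · exact le_rfl
    · have h2 : ∑ l ∈ st.I.erase j, blockRate f G st D L l (0 + i) +
          goodRate f (st.V j) (st.τ j) (D j).card (G ∪ st.A j) (L j) i =
          ∑ l ∈ st.I, blockRate f G st D L l i := by
        rw [Nat.zero_add]
        exact Finset.sum_erase_add _ (fun l => blockRate f G st D L l i) hj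
      rw [h2]
      simp only [Nat.cast_zero, zero_add]
      exact le_rfl
  refine (Finset.sum_le_sum h1).trans ?_
  rw [Finset.sum_comm]
  have h2 : ∀ i : ℕ, (∑ j ∈ st.I, if ∑ l ∈ st.I, blockRate f G st D L l i < ε / 12 then
        blockRate f G st D L j i * Real.exp (1 - ε * (i + 1) / 2) else 0) ≤
      ε / 12 * Real.exp (1 - ε * (i + 1) / 2) := by
    intro i
    by_cases hc : ∑ l ∈ st.I, blockRate f G st D L l i < ε / 12
    · simp only [if_pos hc]
      rw [← Finset.sum_mul]
      exact mul_le_mul_of_nonneg_right hc.le (Real.exp_pos _).le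
    · simp only [if_neg hc, Finset.sum_const_zero]
      positivity
  refine (Finset.sum_le_sum fun i _ => h2 i).trans ?_
  rw [← Finset.mul_sum]
  have h3 := mul_le_mul_of_nonneg_left (sum_exp_le h0 N) (by positivity : 0 ≤ ε / 12)
  refine h3.trans ?_
  have h4 : ε / 12 * (Real.exp 1 * (2 / ε) * (1 - Real.exp (-(ε * N / 2)))) =
      Real.exp 1 / 6 * (1 - Real.exp (-(ε * N / 2))) := by
    field_simp
    ring
  rw [h4]
  have h5 := Real.exp_pos (-(ε * N / 2))
  have h6 := Real.exp_one_lt_d9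
  have h7 := Real.exp_pos 1
  nlinarith

/-- With probability at least one half there is no violation. -/
theorem ex_blockViol_le (hf : IsSubmodular f) (h0 : 0 < ε) (h1 : ε < 1)
    (hdraw : ∀ j ∈ st.I, 0 < st.τ j ∧ Drawn (st.V j) (D j).card (D j) (G ∪ st.A j) 0)
    {js : List (Fin ℓ)} (hjs : ∀ j ∈ st.I, j ∈ js) :
    Ex f (permuteAll D js)
      (fun L _ _ => if ∃ j ∈ st.I, BlockViol f G ε st D L j then 1 else 0) ≤ 1 / 2 := by
  have hunion : ∀ L : Fin ℓ → List U,
      (if ∃ j ∈ st.I, BlockViol f G ε st D L j then (1 : ℝ) else 0) ≤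
        ∑ j ∈ st.I, if BlockViol f G ε st D L j then (1 : ℝ) else 0 := by
    intro L
    split
    · rename_i h
      obtain ⟨j, hj, hv⟩ := h
      refine le_trans ?_ (Finset.single_le_sum
        (f := fun j => if BlockViol f G ε st D L j then (1 : ℝ) else 0) (fun i _ => ?_) hj)
      · simp only [if_pos hv]
        exact le_rfl
      · split <;> norm_num
    · exact Finset.sum_nonneg fun i _ => by split <;> norm_num
  refine (ex_le_ex (all_of_forall (fun L _ _ => hunion L) _)).trans ?_
  rw [ex_sum]
  refine le_trans (Finset.sum_le_sum fun j hj => ?_)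
    ((ex_sum (f := f) st.I (permuteAll D js) fun j L _ _ =>
      hazard f (st.V j) (st.τ j) ε (ε / 12) (D j).card
      (fun i => ∑ l ∈ st.I.erase j, blockRate f G st D L l i) (G ∪ st.A j) 0 (L j)).symm.le.trans
      (ex_le (all_of_forall (fun L _ _ => sum_hazard_le h0 L) _)))
  refine ex_permuteAll_le (hjs j hj)
    (φ := fun L => if BlockViol f G ε st D L j then (1 : ℝ) else 0)
    (χ := fun L => hazard f (st.V j) (st.τ j) ε (ε / 12) (D j).card
      (fun i => ∑ l ∈ st.I.erase j, blockRate f G st D L l i) (G ∪ st.A j) 0 (L j)) fun L => ?_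
  -- `ψ` depends on the other orderings only, so by independence they may be fixed while that of `j`
  -- is averaged.
  have hψ : ∀ p, (fun i => ∑ l ∈ st.I.erase j, blockRate f G st D (Function.update L j p) l i) =
      fun i => ∑ l ∈ st.I.erase j, blockRate f G st D L l i := fun p => by
    funext i
    refine Finset.sum_congr rfl fun l hl => ?_
    unfold blockRate
    rw [Function.update_of_ne (Finset.ne_of_mem_erase hl)]
  unfold BlockViol
  simp only [hψ, Function.update_self]
  exact permAvg_earlyViol_le hf (hdraw j hj).1 h0 h1 (by linarith)
    (fun i => Finset.sum_nonneg fun l _ => blockRate_nonneg L l i) (hdraw j hj).2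

end Violation

/-! ### Without a violation a block step makes progress. -/

section Progress

variable {U : Type} {ℓ : ℕ} {f : Finset U → ℝ}

theorem good_of_missCount_eq_zero {τ : ℝ} {T : Finset U} {L : List U}
    (h : missCount f τ T L = 0) : ∀ p ∈ markList f τ T L, p.2 = Mark.good := by
  have h1 := goodCount_add_missCount (f := f) τ T L
  rw [h, Nat.add_zero, ← length_markList f τ T L] at h1
  unfold goodCount at h1
  rw [List.countP_eq_length] at h1
  simpa using h1

namespace BlockReady

variable {G : Finset U} {τmin ε : ℝ} {st : PIGState U ℓ} {m₀ : ℕ} {hI : st.I.Nonempty}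
  {D : Fin ℓ → Finset U} {L : Fin ℓ → List U}

theorem drawn (hm : 0 < τmin) (h : BlockReady f G τmin ε st m₀ hI D L) {j : Fin ℓ}
    (hj : j ∈ st.I) : Drawn (st.V j) (D j).card (D j) (G ∪ st.A j) 0 where
  sub := h.split.sub j hj
  disj := Finset.disjoint_left.2 fun _ hx => (h.not_mem hm hj ((h.mem_iff hj).2 hx)).1
  le := Nat.zero_le _
  card := Nat.add_zero _

theorem card_V_le (h : BlockReady f G τmin ε st m₀ hI D L) {j : Fin ℓ} (hj : j ∈ st.I) :
    (st.V j).card ≤ 2 * ℓ * (D j).card := by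
  have h1 := h.two_le_card hj
  have h2 : st.I.card ≤ ℓ := (Finset.card_le_univ st.I).trans_eq (Fintype.card_fin ℓ)
  have h3 := Nat.lt_div_mul_add (a := (st.V j).card) (Finset.card_pos.2 hI)
  rw [← h.split.card j hj] at h3
  have h4 : (D j).card * st.I.card ≤ (D j).card * ℓ := Nat.mul_le_mul_left _ h2
  have h5 : 1 * ℓ ≤ (D j).card * ℓ := Nat.mul_le_mul_right _ (by omega)
  have h6 : 2 * ℓ * (D j).card = 2 * ((D j).card * ℓ) := by ring
  omega

/-- Prefixes of good entries are selected. -/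
theorem take_subset_blockSet (h : BlockReady f G τmin ε st m₀ hI D L) {j : Fin ℓ}
    (hj : j ∈ st.I) {n : ℕ} (hn : n ≤ blockLen f G ε st hI (blockSize m₀ st.I hI D) L)
    (hmiss : missCount f (st.τ j) (G ∪ st.A j) ((L j).take n) = 0) :
    ((L j).take n).toFinset ⊆ blockSet f G ε st hI (blockSize m₀ st.I hI D) L j := by
  set s := blockSize m₀ st.I hI D
  have hlen := h.len_le hj s
  have hps := prefixLength_le ε s (blockMarks f G st s L j)
  have h1 : ((blockMarks f G st s L j).take
      (prefixLength ε s (blockMarks f G st s L j))).take n =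
      markList f (st.τ j) (G ∪ st.A j) ((L j).take n) := by
    rw [List.take_take, min_eq_left (hn.trans hlen)]
    exact (h.marks_take hj (hn.trans (hlen.trans hps))).1
  have h2 := take_subset_threePass hn (b := (blockMarks f G st s L j).take
    (prefixLength ε s (blockMarks f G st s L j))) (by
      rw [h1]; exact good_of_missCount_eq_zero hmiss)
  rw [h1] at h2
  intro x hx
  rw [List.mem_toFinset, ← map_fst_markList f (st.τ j) (G ∪ st.A j) ((L j).take n),
    List.mem_map] at hx
  obtain ⟨p, hp, rfl⟩ := hx
  unfold blockSet blockSel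
  rw [List.mem_toFinset]
  exact List.mem_map_of_mem (h2 hp)

/-- The solution whose prefix is shortest takes exactly this prefix. -/
theorem take_subset_blockSet_of_eq (h : BlockReady f G τmin ε st m₀ hI D L) {j : Fin ℓ}
    (hj : j ∈ st.I) (hmin : blockLen f G ε st hI (blockSize m₀ st.I hI D) L =
      prefixLength ε (blockSize m₀ st.I hI D)
        (blockMarks f G st (blockSize m₀ st.I hI D) L j)) :
    ((L j).take (blockLen f G ε st hI (blockSize m₀ st.I hI D) L)).toFinset ⊆
      blockSet f G ε st hI (blockSize m₀ st.I hI D) L j := by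
  set s := blockSize m₀ st.I hI D
  have hps := prefixLength_le ε s (blockMarks f G st s L j)
  obtain ⟨h1, h2⟩ := h.marks_take hj hps
  intro x hx
  rw [List.mem_toFinset, hmin, ← map_fst_markList f (st.τ j) (G ∪ st.A j) ((L j).take
    (prefixLength ε s (blockMarks f G st s L j))), List.mem_map] at hx
  obtain ⟨p, hp, rfl⟩ := hx
  unfold blockSet blockSel
  rw [List.mem_toFinset, hmin, h1]
  refine List.mem_map_of_mem ?_
  have h3 : (markList f (st.τ j) (G ∪ st.A j) ((L j).take (prefixLength ε s
      (blockMarks f G st s L j)))).length = prefixLength ε s (blockMarks f G st s L j) := by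
    rw [length_markList, h2]
  have h4 := mem_threePass_length.2 hp
  rwa [h3] at h4

variable [Fintype U]

/-- Spoiled elements lower the weight of the solution. -/
theorem weight_drop (hf : IsSubmodular f) (hm : 0 < τmin)
    (hc : ∀ j ∈ st.I, st.V j = cand f G st.A j (st.τ j))
    (h : BlockReady f G τmin ε st m₀ hI D L) {j : Fin ℓ} (hj : j ∈ st.I)
    {B : Fin ℓ → Finset U} (hB : ∀ i, st.A i ⊆ B i) {T : Finset U} (hT : T ⊆ G ∪ B j) :
    weight f G τmin ε B j (st.τ j) +
      spoilRate f (st.V j) (st.τ j) (D j).card T / (2 * ℓ) ≤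
      weight f G τmin ε st.A j (st.τ j) := by
  have hτ : 0 < st.τ j := hm.trans_le (h.thr j hj)
  have hℓ : 0 < ℓ := j.pos
  have hd := h.two_le_card hj
  have hV : 0 < (st.V j).card := by
    have := h.big j hj
    omega
  have h1 : (cand f G B j (st.τ j)).card + (spoiled f (st.V j) (st.τ j) T).card ≤
      (st.V j).card := by
    rw [← Finset.card_union_of_disjoint]
    · refine Finset.card_le_card (Finset.union_subset ?_ (Finset.filter_subset _ _))
      rw [hc j hj]
      exact cand_anti hf hB j _
    · rw [Finset.disjoint_left]
      intro x hx hx'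
      have h2 := hf.le_gain_of_le hT hτ (mem_cand.1 hx).2
      exact absurd h2 (not_le.2 (Finset.mem_filter.1 hx').2)
  have h2 := pot_add_le hV (N' := (cand f G B j (st.τ j)).card)
    (d := (spoiled f (st.V j) (st.τ j) T).card) (by exact_mod_cast h1)
  -- The factor `2 * ℓ` converts a share of `D j` into a share of `V j`.
  have h3 : spoilRate f (st.V j) (st.τ j) (D j).card T / (2 * ℓ) ≤
      (spoiled f (st.V j) (st.τ j) T).card / (st.V j).card := by
    unfold spoilRate
    rw [div_div]
    refine div_le_div_of_nonneg_left (Nat.cast_nonneg _) (by exact_mod_cast hV) ?_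
    have := h.card_V_le hj
    have h4 : ((st.V j).card : ℝ) ≤ 2 * ℓ * (D j).card := by exact_mod_cast this
    linarith
  unfold weight
  rw [← hc j hj]
  linarith

theorem potential_drop (hf : IsSubmodular f) (hm : 0 < τmin)
    (hc : ∀ j ∈ st.I, st.V j = cand f G st.A j (st.τ j))
    (h : BlockReady f G τmin ε st m₀ hI D L) (T : Fin ℓ → Finset U)
    (hT : ∀ j ∈ st.I, T j ⊆ G ∪ (st.A j ∪ blockSet f G ε st hI (blockSize m₀ st.I hI D) L j)) :
    potential f G τmin ε (blockNext f G ε st hI (blockSize m₀ st.I hI D) L) +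
      (∑ j ∈ st.I, spoilRate f (st.V j) (st.τ j) (D j).card (T j)) / (2 * ℓ) ≤
      potential f G τmin ε st := by
  set st₂ := blockNext f G ε st hI (blockSize m₀ st.I hI D) L with hst₂
  have hI₂ : st₂.I = st.I := rfl
  have hA : ∀ j ∈ st.I, st₂.A j = st.A j ∪ blockSet f G ε st hI (blockSize m₀ st.I hI D) L j :=
    fun j hj => if_pos hj
  have hsub : ∀ j, st.A j ⊆ st₂.A j := fun j => by
    by_cases hj : j ∈ st.I
    · rw [hA j hj]; exact Finset.subset_union_left
    · exact (if_neg hj : st₂.A j = st.A j).symm.subset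
  rw [potential_eq_sum st₂ hI₂.subset, potential_eq_sum st subset_rfl, Finset.sum_div,
    ← Finset.sum_add_distrib]
  refine Finset.sum_le_sum fun j hj => ?_
  have h1 := h.weight_drop hf hm hc hj hsub (T := T j) (by rw [hA j hj]; exact hT j hj)
  unfold stWeight
  rw [if_pos hj, if_pos (hI₂ ▸ hj)]
  exact h1

theorem potential_drop_single (hf : IsSubmodular f) (hm : 0 < τmin)
    (hc : ∀ j ∈ st.I, st.V j = cand f G st.A j (st.τ j))
    (h : BlockReady f G τmin ε st m₀ hI D L) {j : Fin ℓ} (hj : j ∈ st.I) {T : Finset U}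
    (hT : T ⊆ G ∪ (st.A j ∪ blockSet f G ε st hI (blockSize m₀ st.I hI D) L j)) {c : ℝ}
    (hrate : c ≤ spoilRate f (st.V j) (st.τ j) (D j).card T) :
    potential f G τmin ε (blockNext f G ε st hI (blockSize m₀ st.I hI D) L) + c / (2 * ℓ) ≤
      potential f G τmin ε st := by
  have h1 := h.potential_drop hf hm hc (Function.update (fun _ => (∅ : Finset U)) j T) fun i hi => by
    by_cases hij : i = j
    · subst hij; simpa using hT
    · rw [Function.update_of_ne hij]; exact Finset.empty_subset _
  have h2 : c ≤ ∑ i ∈ st.I, spoilRate f (st.V i) (st.τ i) (D i).card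
      (Function.update (fun _ => (∅ : Finset U)) j T i) := by
    refine le_trans ?_ (Finset.single_le_sum (f := fun i => spoilRate f (st.V i) (st.τ i)
      (D i).card (Function.update (fun _ => (∅ : Finset U)) j T i)) (fun i _ => spoilRate_nonneg _ _ _ _) hj)
    simpa using hrate
  have h3 : c / (2 * ℓ) ≤ (∑ i ∈ st.I, spoilRate f (st.V i) (st.τ i) (D i).card
      (Function.update (fun _ => (∅ : Finset U)) j T i)) / (2 * ℓ) :=
    div_le_div_of_nonneg_right h2 (by positivity)
  linarith

/-- Without a violation, the pass ends the loop or lowers the potential. -/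
theorem progress (hf : IsSubmodular f) (hm : 0 < τmin) (h0 : 0 < ε) (h1 : ε < 1)
    (hc : ∀ j ∈ st.I, st.V j = cand f G st.A j (st.τ j))
    (h : BlockReady f G τmin ε st m₀ hI D L)
    (hviol : ¬ ∃ j ∈ st.I, BlockViol f G ε st D L j) :
    blockLen f G ε st hI (blockSize m₀ st.I hI D) L = m₀ ∨
    potential f G τmin ε (blockNext f G ε st hI (blockSize m₀ st.I hI D) L) + ε / (24 * ℓ) ≤
      potential f G τmin ε st := by
  set s := blockSize m₀ st.I hI D with hs
  set n := blockLen f G ε st hI s L with hn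
  have hℓ : (0 : ℝ) < ℓ := by
    obtain ⟨j, -⟩ := hI
    exact_mod_cast j.pos
  have hweak : ∀ c : ℝ, ε / 12 ≤ c → ε / (24 * ℓ) ≤ c / (2 * ℓ) := fun c hc => by
    rw [div_le_div_iff₀ (by positivity) (by positivity)]
    nlinarith
  rcases (h.len_le_size s).eq_or_lt with hfull | hlt
  · rcases le_or_gt m₀ s with hm₀ | hm₀
    · left
      exact le_antisymm (hfull.le.trans (min_le_left _ _)) (hm₀.trans hfull.symm.le)
    · right
      -- Capacity is left, so the block was limited by a set `D j` that has been used up; all its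
      -- elements are spoiled now.
      obtain ⟨j, hj, hjd⟩ := Finset.exists_mem_eq_inf' hI fun j => (D j).card
      have hsd : s = (D j).card := by
        rw [← hjd]
        rcases min_choice m₀ (st.I.inf' hI fun j => (D j).card) with hmin | hmin
        · exact absurd (hs.trans hmin) hm₀.ne
        · exact hs.trans hmin
      have hset : blockSet f G ε st hI s L j = D j :=
        Finset.eq_of_subset_of_card_le (h.blockSet_subset hj) (by
          rw [h.card_blockSet hj]
          exact (hsd.symm.trans hfull.symm).le)
      have hrate : 1 ≤ spoilRate f (st.V j) (st.τ j) (D j).card (D j) := by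
        have hd := h.two_le_card hj
        unfold spoilRate
        rw [le_div_iff₀ (by exact_mod_cast (by omega : 0 < (D j).card)), one_mul]
        refine Nat.cast_le.2 (Finset.card_le_card fun x hx => Finset.mem_filter.2
          ⟨h.split.sub j hj hx, ?_⟩)
        rw [gain_of_mem hx]
        exact hm.trans_le (h.thr j hj)
      have h2 := h.potential_drop_single hf hm hc hj (T := D j) (by
        rw [← hs, hset]
        exact Finset.subset_union_right.trans Finset.subset_union_right) hrate
      have h3 := hweak 1 (by linarith)
      rw [← hs] at h2
      linarith
  · right
    -- Some `j` stopped the block: its prefix of length `n + 1` has more than `ε * (n + 1)` misses.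
    -- If moreover few elements are spoiled, both by this prefix and by the good prefixes of all
    -- solutions together, this is a violation.
    obtain ⟨j, hj, hjn⟩ := Finset.exists_mem_eq_inf' hI fun j =>
      prefixLength ε s (blockMarks f G st s L j)
    have hmin : n = prefixLength ε s (blockMarks f G st s L j) := hjn
    by_cases hb : spoilRate f (st.V j) (st.τ j) (D j).card
        (G ∪ st.A j ∪ ((L j).take n).toFinset) < ε / 4
    · by_cases hΨ : ∑ l ∈ st.I, blockRate f G st D L l n < ε / 12
      · exfalso
        refine hviol ⟨j, hj, ?_⟩
        refine earlyViol_of_missCount (i := n) h0 ?_ ?_ hb ?_ ?_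
        · intro a b hab
          refine Finset.sum_le_sum fun l hl => ?_
          exact goodRate_mono hf _ (hm.trans_le (h.thr l (Finset.mem_of_mem_erase hl))) _ _ _ hab
        · rw [h.length_eq hj]
          exact hlt.trans_le (h.size_le hj)
        · rw [Nat.zero_add]
          refine lt_of_eq_of_lt ?_ hΨ
          exact Finset.sum_erase_add _ (fun l => blockRate f G st D L l n) hj
        · obtain ⟨h2, h3⟩ := h.marks_take hj (n := n + 1) hlt
          have h4 : ¬ (1 - ε) * ((n + 1 : ℕ) : ℝ) ≤
              goodCount ((blockMarks f G st s L j).take (n + 1)) := fun hc => by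
            have := le_prefixLength hlt hc
            omega
          have h5 := goodCount_add_missCount (f := f) (st.τ j) (G ∪ st.A j) ((L j).take (n + 1))
          rw [← hs] at h2
          rw [h2] at h4
          rw [h3] at h5
          have h6 : (goodCount (markList f (st.τ j) (G ∪ st.A j) ((L j).take (n + 1))) : ℝ) +
              missCount f (st.τ j) (G ∪ st.A j) ((L j).take (n + 1)) = (n + 1 : ℕ) := by
            exact_mod_cast h5
          push_cast at h4 h6 ⊢
          rw [not_le] at h4
          linarith
      · have hex : ∀ l, ∃ i, i ≤ n ∧
            missCount f (st.τ l) (G ∪ st.A l) ((L l).take i) = 0 ∧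
            blockRate f G st D L l n = spoilRate f (st.V l) (st.τ l) (D l).card
              (G ∪ st.A l ∪ ((L l).take i).toFinset) := fun l => exists_goodRate_eq _ _ _ _ _ _
        choose i hi1 hi2 hi3 using hex
        have h2 := h.potential_drop hf hm hc
          (fun l => G ∪ st.A l ∪ ((L l).take (i l)).toFinset) fun l hl => by
          rw [← Finset.union_assoc]
          exact Finset.union_subset_union_right (h.take_subset_blockSet hl (hi1 l) (hi2 l))
        rw [← Finset.sum_congr rfl fun l _ => hi3 l, ← hs] at h2
        have h3 := hweak _ (not_lt.1 hΨ)
        linarith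
    · have h2 := h.potential_drop_single hf hm hc hj
        (T := G ∪ st.A j ∪ ((L j).take n).toFinset) (by
          rw [← Finset.union_assoc]
          exact Finset.union_subset_union_right (h.take_subset_blockSet_of_eq hj hmin))
        (not_lt.1 hb)
      have h3 := hweak (ε / 4) (by linarith)
      rw [← hs] at h2
      linarith

end BlockReady

end Progress

/-! ### The exponential moment of the number of rounds. -/

namespace OracleAlg

variable {U α β : Type} {f : Finset U → ℝ}

/-- The exponential moment of the number of rounds that bounds its upper tail. -/
def roundMoment (f : Finset U → ℝ) (a : OracleAlg U α) : ℝ :=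
  Ex f a fun _ r _ => Real.exp (r / 20)

theorem roundMoment_pure (a : α) : roundMoment f (pure a : OracleAlg U α) = 1 := by
  unfold roundMoment
  simp

theorem roundMoment_bind (a : OracleAlg U α) (g : α → OracleAlg U β) :
    roundMoment f (a >>= g) = Ex f a fun x r _ => Real.exp (r / 20) * roundMoment f (g x) := by
  unfold roundMoment
  rw [ex_bind]
  congr 1
  funext x r q
  rw [← ex_mul_left]
  congr 1
  funext y r' q'
  rw [← Real.exp_add]
  congr 1
  push_cast
  ring

end OracleAlg

/-! ### The moment for one call of the subroutine. -/

section LoopMoment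

variable {U : Type} [Fintype U] {ℓ : ℕ} {f : Finset U → ℝ} {G : Finset U} {τmin ε : ℝ}

theorem weightPred_add_le (A : Fin ℓ → Finset U) (j : Fin ℓ) (τ : ℝ) :
    weightPred f G τmin ε A j τ + 1 / (cand f G A j τ).card ≤ weight f G τmin ε A j τ := by
  unfold weightPred weight
  rcases Nat.eq_zero_or_pos (cand f G A j τ).card with h | h
  · simp [h]
  · have h1 : (((cand f G A j τ).card - 1 : ℕ) : ℝ) + 1 ≤ (cand f G A j τ).card := by
      exact_mod_cast (Nat.sub_add_cancel h).le
    have := pot_add_le h h1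
    linarith

theorem potential_eq_sum_weight {st : PIGState U ℓ} :
    potential f G τmin ε st = ∑ j ∈ st.I, weight f G τmin ε st.A j (st.τ j) := by
  rw [potential_eq_sum st subset_rfl]
  exact Finset.sum_congr rfl fun j hj => if_pos hj

theorem Ready.sum_weightPred_le {st : PIGState U ℓ} (hst : Ready f G τmin ε st)
    (hsmall : ∃ i ∈ st.I, (st.V i).card < 2 * ℓ) :
    ∑ j ∈ st.I, weightPred f G τmin ε st.A j (st.τ j) + 1 / (2 * ℓ) ≤
      potential f G τmin ε st := by
  obtain ⟨i, hi, hlt⟩ := hsmall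
  have hpos := (hst.nonempty i hi).card_pos
  rw [hst.cand_eq i hi] at hlt hpos
  have h1 : (1 : ℝ) / (2 * ℓ) ≤ 1 / (cand f G st.A i (st.τ i)).card :=
    one_div_le_one_div_of_le (by exact_mod_cast hpos) (by exact_mod_cast hlt.le)
  have h2 : (1 : ℝ) / (cand f G st.A i (st.τ i)).card ≤
      ∑ j ∈ st.I, 1 / ((cand f G st.A j (st.τ j)).card : ℝ) :=
    Finset.single_le_sum (f := fun j => 1 / ((cand f G st.A j (st.τ j)).card : ℝ))
      (fun _ _ => by positivity) hi
  have h3 := Finset.sum_le_sum fun j (_ : j ∈ st.I) =>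
    weightPred_add_le (f := f) (G := G) (τmin := τmin) (ε := ε) st.A j (st.τ j)
  rw [Finset.sum_add_distrib] at h3
  rw [potential_eq_sum_weight]
  linarith

theorem Ready.one_le_potential {st : PIGState U ℓ} (hst : Ready f G τmin ε st)
    (hI : st.I.Nonempty) : 1 ≤ potential f G τmin ε st := by
  obtain ⟨j, hj⟩ := hI
  have h1 := one_le_pot (hst.nonempty j hj).card_pos
  rw [hst.cand_eq j hj] at h1
  rw [potential_eq_sum_weight]
  refine le_trans ?_ (Finset.single_le_sum (f := fun j => weight f G τmin ε st.A j (st.τ j))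
    (fun i _ => weight_nonneg _ _ _ _ _ _) hj)
  have := log_card_nonneg (U := U)
  unfold weight
  have h2 : 0 ≤ (stepsBelow τmin ε (st.τ j) : ℝ) * (Real.log (Fintype.card U) + 2) := by positivity
  linarith

/-- Whatever `distribute` returns, the orderings alone keep the chance of a violation, and so the
weight of the surcharge `c`, at one half. -/
theorem ex_addBlock_le (hf : IsSubmodular f) (hm : 0 < τmin) (h0 : 0 < ε) (h1 : ε < 1)
    {st : PIGState U ℓ} (hst : Ready f G τmin ε st) {m₀ : ℕ} (hm₀ : 0 < m₀) (hI : st.I.Nonempty)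
    (hbig : ∀ j ∈ st.I, 2 * ℓ ≤ (st.V j).card) {φ : PIGState U ℓ × ℕ → ℕ → ℝ} {a c : ℝ}
    (hc : 0 ≤ c)
    (hP : ∀ D L, BlockReady f G τmin ε st m₀ hI D L →
      φ (blockNext f G ε st hI (blockSize m₀ st.I hI D) L,
        blockLen f G ε st hI (blockSize m₀ st.I hI D) L) 1 ≤
        a + c * if ∃ j ∈ st.I, BlockViol f G ε st D L j then 1 else 0) :
    Ex f (addBlock G ε m₀ st hI) (fun p r _ => φ p r) ≤ a + c / 2 := by
  rw [addBlock_eq, ex_bind]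
  refine ex_le ((distribute_spec st.I st.V).mono ?_)
  rintro D r q ⟨hD, rfl⟩
  rw [ex_bind]
  have hdraw : ∀ j ∈ st.I, 0 < st.τ j ∧ Drawn (st.V j) (D j).card (D j) (G ∪ st.A j) 0 := by
    intro j hj
    have hord : IsOrdering D (st.I.sort (· ≤ ·)) fun j => (D j).toList :=
      fun _ _ => List.Perm.refl _
    exact ⟨hm.trans_le (hst.thr j hj), (hst.block hm₀ hI hbig hD hord).drawn hm hj⟩
  refine (ex_le_ex (ψ := fun L _ _ => a + c * if ∃ j ∈ st.I, BlockViol f G ε st D L j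
    then 1 else 0) ((permuteAll_spec D _).mono ?_)).trans ?_
  · rintro L r q ⟨hL, rfl⟩
    rw [ex_ask_bind, ex_pure, blockNext_restrict, blockLen_restrict]
    exact hP D L (hst.block hm₀ hI hbig hD hL)
  · rw [ex_add, ex_const, ex_mul_left]
    have := ex_blockViol_le hf h0 h1 hdraw (js := st.I.sort (· ≤ ·))
      fun j hj => (Finset.mem_sort _).2 hj
    nlinarith

theorem pigLoop_zero_capacity (n : ℕ) (st : PIGState U ℓ) :
    pigLoop G τmin ε n 0 st = pure st.A' := by
  cases n with
  | zero => rfl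
  | succ n => rw [pigLoop_succ, if_pos (Or.inr rfl)]

theorem exp_contraction : Real.exp (1 / 10) * ((1 + Real.exp (-(1 / 2))) / 2) ≤ 1 := by
  have h1 : Real.exp (1 / 10) ≤ 10 / 9 := by
    have := Real.add_one_le_exp (-(1 / 10 : ℝ))
    rw [Real.exp_neg] at this
    have h2 := Real.exp_pos (1 / 10)
    have h3 : Real.exp (1 / 10) * (-(1 / 10) + 1) ≤ 1 := by
      calc _ ≤ Real.exp (1 / 10) * (Real.exp (1 / 10))⁻¹ := by gcongr
        _ = 1 := mul_inv_cancel₀ h2.ne'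
    linarith
  have h2 : Real.exp (-(1 / 2)) ≤ 2 / 3 := by
    have := Real.add_one_le_exp (1 / 2 : ℝ)
    rw [Real.exp_neg, inv_le_comm₀ (Real.exp_pos _) (by norm_num)]
    linarith
  have h3 := Real.exp_pos (-(1 / 2))
  have h4 := Real.exp_pos (1 / 10)
  nlinarith

/-- With `μ ≥ 12 * ℓ / ε` a potential drop of `ε / (24 * ℓ)` lowers the exponent by `1/2`. It
happens with probability at least one half or the loop ends, and by `exp_contraction` this offsets
`exp (1/10)`: `1/20` for the block's own round and `1/20` from the induction hypothesis. The bound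
`μ ≥ (ℓ + 1) ^ 2` makes the drop `1 / (2 * ℓ)` of a single step pay for its up to `ℓ + 1` unpaid
rounds. The constant `1/20` in the exponent covers a final update that lowers nothing. -/
theorem roundMoment_pigLoop_le (hf : IsSubmodular f) (hm : 0 < τmin) (h0 : 0 < ε) (h1 : ε < 1)
    {μ : ℝ} (hμ : 12 * ℓ / ε ≤ μ) (hμ' : ((ℓ : ℝ) + 1) ^ 2 ≤ μ) (n m₀ : ℕ) (st : PIGState U ℓ)
    (hst : PIGInv f G τmin ε st) :
    roundMoment f (pigLoop G τmin ε n m₀ st) ≤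
      Real.exp (1 / 20 + μ * potential f G τmin ε st) := by
  have hμ1 : 1 ≤ μ := le_trans (by nlinarith [Nat.cast_nonneg (α := ℝ) ℓ]) hμ'
  have hhalt : ∀ st : PIGState U ℓ, 1 ≤ Real.exp (1 / 20 + μ * potential f G τmin ε st) :=
    fun st => Real.one_le_exp (by
      have := potential_nonneg (f := f) (G := G) (τmin := τmin) (ε := ε) st
      positivity)
  induction n generalizing m₀ st with
  | zero => exact (roundMoment_pure st.A').trans_le (hhalt st)
  | succ n ih =>
    rw [pigLoop_succ]
    split
    · exact (roundMoment_pure st.A').trans_le (hhalt st)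
    · rename_i hgo
      have hm₀ : 0 < m₀ := Nat.pos_of_ne_zero (not_or.1 hgo).2
      rw [roundMoment_bind]
      refine ex_le ((update_ready hm h0 h1 hst).mono ?_)
      rintro p r q ⟨hr, hτ, hcost, hle⟩
      set Φ := potential f G τmin ε st
      set st₁ := afterUpdate τmin st p with hst₁
      set Φ₁ := potential f G τmin ε st₁ with hΦ₁
      have hΦ₁0 : 0 ≤ Φ₁ := potential_nonneg _
      split
      · rename_i hI
        have hℓ : (0 : ℝ) < ℓ := by
          obtain ⟨j, -⟩ := hI
          exact_mod_cast j.pos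
        suffices h : ∀ a : OracleAlg U (Fin ℓ → Finset U),
            roundMoment f a ≤ Real.exp (1 / 20 + μ * Φ - r / 20) →
            Real.exp (r / 20) * roundMoment f a ≤ Real.exp (1 / 20 + μ * Φ) by
          refine h _ ?_
          split
          · rename_i hsmall
            rw [roundMoment_bind]
            refine ex_le ((addOneEach_ready hf hm h0 h1 hr).mono ?_)
            rintro st₂ r' q' ⟨hi₂, -, hc₂, hl₂⟩
            set Φ₂ := potential f G τmin ε st₂
            have hs := hr.sum_weightPred_le hsmall
            rw [Finset.sum_add_distrib, Finset.sum_const, nsmul_eq_mul, mul_one] at hc₂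
            have hcard : (st₁.I.card : ℝ) ≤ ℓ := by
              exact_mod_cast (Finset.card_le_univ st₁.I).trans_eq (Fintype.card_fin ℓ)
            refine (mul_le_mul_of_nonneg_left (ih (m₀ - 1) st₂ hi₂) (Real.exp_pos _).le).trans ?_
            rw [← Real.exp_add, Real.exp_le_exp]
            have h3 : 0 < 1 / (2 * (ℓ : ℝ)) := by positivity
            have hd : 1 / (2 * ℓ) ≤ Φ - Φ₂ := by linarith
            have hr' : (r : ℝ) + r' ≤ 1 + ℓ + (Φ - Φ₂) := by linarith
            have h4 : (μ - 1 / 20) * (1 / (2 * ℓ)) ≤ (μ - 1 / 20) * (Φ - Φ₂) :=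
              mul_le_mul_of_nonneg_left hd (by linarith)
            have h5 : (1 + ℓ : ℝ) / 20 ≤ (μ - 1 / 20) * (1 / (2 * ℓ)) := by
              rw [mul_one_div, le_div_iff₀ (by positivity)]
              nlinarith
            linarith
          · rename_i hbig
            push Not at hbig
            rw [roundMoment_bind]
            set X := Real.exp (1 / 10 + μ * Φ₁) with hX
            have hX0 : 0 < X := Real.exp_pos _
            have hhalf : Real.exp (-(1 / 2)) ≤ 1 := Real.exp_le_one_iff.2 (by norm_num)
            refine (ex_addBlock_le (a := X * Real.exp (-(1 / 2)))
              (c := X * (1 - Real.exp (-(1 / 2))))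
              (φ := fun b r => Real.exp (r / 20) * roundMoment f
                (pigLoop G τmin ε n (m₀ - b.2) b.1)) hf hm h0 h1 hr hm₀ hI hbig
              (mul_nonneg hX0.le (by linarith)) ?_).trans ?_
            · intro D L hB
              have hi₂ := hB.next_inv hf hm h0 h1 hr.inv
              have hih := ih (m₀ - blockLen f G ε st₁ hI (blockSize m₀ st₁.I hI D) L) _ hi₂
              have hanti := hB.potential_drop hf hm hr.cand_eq (fun _ => ∅)
                fun _ _ => Finset.empty_subset _
              have hsp : 0 ≤ (∑ j ∈ st₁.I, spoilRate f (st₁.V j) (st₁.τ j) (D j).card ∅) /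
                  (2 * ℓ) :=
                div_nonneg (Finset.sum_nonneg fun j _ => spoilRate_nonneg _ _ _ _) (by positivity)
              set Φ₂ := potential f G τmin ε
                (blockNext f G ε st₁ hI (blockSize m₀ st₁.I hI D) L)
              have hX' : Real.exp ((1 : ℕ) / 20) * Real.exp (1 / 20 + μ * Φ₂) =
                  Real.exp (1 / 10 + μ * Φ₂) := by
                rw [← Real.exp_add]
                congr 1
                push_cast
                ring
              have hmul := mul_le_mul_of_nonneg_left hih (Real.exp_pos ((1 : ℕ) / 20)).le
              rw [hX'] at hmul
              by_cases hviol : ∃ j ∈ st₁.I, BlockViol f G ε st₁ D L j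
              · rw [if_pos hviol]
                refine hmul.trans ?_
                have : Real.exp (1 / 10 + μ * Φ₂) ≤ X := Real.exp_le_exp.2 (by nlinarith)
                linarith
              · rw [if_neg hviol, mul_zero, add_zero, hX, ← Real.exp_add]
                rcases hB.progress hf hm h0 h1 hr.cand_eq hviol with hlen | hdrop
                · dsimp only
                  rw [hlen, Nat.sub_self, pigLoop_zero_capacity, roundMoment_pure, mul_one,
                    Real.exp_le_exp]
                  -- When the block fills the capacity, the potential need not drop, but it is at
                  -- least one, and none of it is needed any more.
                  have := hr.one_le_potential hI
                  push_cast
                  nlinarith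
                · refine hmul.trans (Real.exp_le_exp.2 ?_)
                  have h4 : 1 / 2 ≤ μ * (ε / (24 * ℓ)) := by
                    calc (1 : ℝ) / 2 = 12 * ℓ / ε * (ε / (24 * ℓ)) := by field_simp; norm_num
                      _ ≤ _ := mul_le_mul_of_nonneg_right hμ (by positivity)
                  have h5 : μ * (Φ₂ + ε / (24 * ℓ)) ≤ μ * Φ₁ :=
                    mul_le_mul_of_nonneg_left hdrop (by linarith)
                  linarith
            · calc X * Real.exp (-(1 / 2)) + X * (1 - Real.exp (-(1 / 2))) / 2
                  = Real.exp (μ * Φ₁) *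
                    (Real.exp (1 / 10) * ((1 + Real.exp (-(1 / 2))) / 2)) := by
                    rw [hX, Real.exp_add]; ring
                _ ≤ Real.exp (μ * Φ₁) * 1 :=
                    mul_le_mul_of_nonneg_left exp_contraction (Real.exp_pos _).le
                _ ≤ Real.exp (1 / 20 + μ * Φ - r / 20) := by
                    rw [mul_one, Real.exp_le_exp]
                    nlinarith
        intro a ha
        calc Real.exp (r / 20) * roundMoment f a
            ≤ Real.exp (r / 20) * Real.exp (1 / 20 + μ * Φ - r / 20) :=
              mul_le_mul_of_nonneg_left ha (Real.exp_pos _).le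
          _ = Real.exp (1 / 20 + μ * Φ) := by
              rw [← Real.exp_add]
              congr 1
              ring
      · rw [roundMoment_pure, mul_one, Real.exp_le_exp]
        have : 0 ≤ Φ := hΦ₁0.trans hle
        nlinarith

end LoopMoment

/-! ### From the exponential moment to a tail bound. -/

namespace OracleAlg

variable {U α : Type} {f : Finset U → ℝ}

theorem roundMoment_sample {β : Type} {s : Finset β} (hs : s.Nonempty)
    {next : β → OracleAlg U α} {c : ℝ} (h : ∀ b ∈ s, roundMoment f (next b) ≤ c) :
    roundMoment f (OracleAlg.sample β s hs next) ≤ c := by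
  change (∑ b ∈ s, roundMoment f (next b)) / s.card ≤ c
  rw [div_le_iff₀ (by exact_mod_cast hs.card_pos), mul_comm, ← nsmul_eq_mul]
  exact Finset.sum_le_card_nsmul _ _ _ h

/-- Few rounds, with few queries each, are likely if the exponential moment is small. -/
theorem one_sub_exp_le_prob {a : OracleAlg U α} {B : ℕ} (hB : QueriesLE B a) {x T : ℝ}
    (hx : roundMoment f a ≤ Real.exp x) {E : Set (Outcome α)}
    (hE : ∀ o : Outcome α, (o.rounds : ℝ) ≤ T → o.queries ≤ o.rounds * B → o ∈ E) :
    1 - Real.exp (x - T / 20) ≤ a.prob f E := by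
  rw [prob_eq_ex]
  calc 1 - Real.exp (x - T / 20)
      ≤ 1 + -Real.exp (-(T / 20)) * roundMoment f a := by
        rw [sub_eq_add_neg x, Real.exp_add]
        nlinarith [Real.exp_pos (-(T / 20))]
    _ = Ex f a fun _ r _ => 1 + -Real.exp (-(T / 20)) * Real.exp (r / 20) := by
        rw [ex_add, ex_const, ex_mul_left]
        rfl
    _ ≤ _ := by
        refine ex_le_ex ((hB.all (f := f)).mono fun y r q hq => ?_)
        rw [neg_mul, ← Real.exp_add]
        rcases le_or_gt (r : ℝ) T with hr | hr
        · rw [if_pos (hE ⟨y, r, q⟩ hr hq)]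
          linarith [Real.exp_pos (-(T / 20) + r / 20)]
        · have h1 : 1 ≤ Real.exp (-(T / 20) + r / 20) := Real.one_le_exp (by linarith)
          split <;> linarith

end OracleAlg

/-! ### Queries per round. -/

section Queries

variable {U : Type} [Fintype U] {ℓ : ℕ}

theorem queriesLE_pigLoop (G : Finset U) (τmin ε : ℝ) (n m₀ : ℕ) (st : PIGState U ℓ) :
    QueriesLE (ℓ * (Fintype.card U + 1)) (pigLoop G τmin ε n m₀ st) := by
  induction n generalizing m₀ st with
  | zero => exact queriesLE_pure _ _
  | succ n ih =>
    rw [pigLoop_succ]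
    split
    · exact queriesLE_pure _ _
    · refine (queriesLE_update _ _ _ _ _ _ _).bind fun p => ?_
      split
      · split
        · exact (queriesLE_addOneEach _ _ _ _ _).bind fun st₂ => ih _ _
        · exact (queriesLE_addBlock _ _ _ _ _).bind fun b => ih _ _
      · exact queriesLE_pure _ _

theorem queriesLE_parallelInterlaceGreedy [Nonempty U] (hℓ : 0 < ℓ) (G : Finset U) (m : ℕ)
    (τmin ε : ℝ) :
    QueriesLE (ℓ * (Fintype.card U + 1)) (parallelInterlaceGreedy G m ℓ τmin ε) := by
  unfold parallelInterlaceGreedy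
  refine (queriesLE_ask ?_).bind fun ans => queriesLE_pigLoop _ _ _ _ _ _
  refine le_trans ?_ (Nat.le_mul_of_pos_left _ hℓ)
  exact (Finset.card_insert_le _ _).trans (Nat.succ_le_succ Finset.card_image_le)

theorem queriesLE_pitgLoop [Nonempty U] (hℓ : 0 < ℓ) (m : ℕ) (τmin ε : ℝ) (i : ℕ)
    (G : Finset U) :
    QueriesLE (ℓ * (Fintype.card U + 1)) (pitgLoop m ℓ τmin ε i G) := by
  induction i generalizing G with
  | zero => exact queriesLE_pure _ _
  | succ i ih =>
    rw [pitgLoop_succ m ⟨⟨0, hℓ⟩, Finset.mem_univ _⟩]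
    exact (queriesLE_parallelInterlaceGreedy hℓ _ _ _ _).bind fun A' l _ => ih _

theorem queriesLE_parallelInterpolatedGreedy [Nonempty U] (hℓ : 0 < ℓ) (k : ℕ) (ε : ℝ) :
    QueriesLE (ℓ * (Fintype.card U + 1)) (parallelInterpolatedGreedy U k ℓ ε) := by
  unfold parallelInterpolatedGreedy
  refine (queriesLE_ask ?_).bind fun ans => queriesLE_pitgLoop hℓ _ _ _ _ _
  refine le_trans ?_ (Nat.le_mul_of_pos_left _ hℓ)
  exact Finset.card_image_le.trans (Nat.le_succ _)

end Queries

/-! ### The moment for the whole algorithm. -/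

section Moments

/-- From `1 - ε ≤ exp (-ε)`. It is applied with `K = k / (ε / 2)`, the ratio of the largest
singleton value to the smallest threshold. -/
theorem stepsBelow_le {τmin ε τ K : ℝ} (hm : 0 < τmin) (h0 : 0 < ε) (h1 : ε < 1) (hK : 1 ≤ K)
    (hτ : τ ≤ K * τmin) : (stepsBelow τmin ε τ : ℝ) ≤ Real.log K / ε + 1 := by
  have hK0 : 0 < K := by linarith
  have hlog : 0 ≤ Real.log K / ε := div_nonneg (Real.log_nonneg hK) h0.le
  set i := ⌊Real.log K / ε⌋₊ + 1 with hi
  have hle : stepsBelow τmin ε τ ≤ i := by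
    refine Nat.sInf_le ?_
    change (1 - ε) ^ i * τ < τmin
    rcases le_or_gt τ 0 with hτ0 | hτ0
    · exact (mul_nonpos_of_nonneg_of_nonpos (pow_nonneg (by linarith) _) hτ0).trans_lt hm
    · have h2 : (1 - ε) ^ i < K⁻¹ := by
        calc (1 - ε) ^ i ≤ Real.exp (-ε) ^ i :=
              pow_le_pow_left₀ (by linarith) (by linarith [Real.add_one_le_exp (-ε)]) _
          _ = Real.exp (-(ε * i)) := by rw [← Real.exp_nat_mul]; congr 1; ring
          _ < Real.exp (-Real.log K) := by
              rw [Real.exp_lt_exp, neg_lt_neg_iff, mul_comm, ← div_lt_iff₀ h0, hi]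
              push_cast
              exact Nat.lt_floor_add_one _
          _ = K⁻¹ := by rw [Real.exp_neg, Real.exp_log hK0]
      calc (1 - ε) ^ i * τ < K⁻¹ * τ := by gcongr
        _ ≤ K⁻¹ * (K * τmin) := by gcongr
        _ = τmin := by field_simp
  calc (stepsBelow τmin ε τ : ℝ) ≤ (i : ℝ) := by exact_mod_cast hle
    _ ≤ Real.log K / ε + 1 := by
        rw [hi]
        push_cast
        linarith [Nat.floor_le hlog]

variable {U : Type} [Fintype U] [Nonempty U] {ℓ : ℕ} {f : Finset U → ℝ} {τmin ε : ℝ}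

theorem maxGain_le_maxSingle (hf : IsSubmodular f) (hf0 : ∀ S, 0 ≤ f S) (G : Finset U) :
    maxGain f G ≤ maxSingle f := by
  refine Finset.sup'_le _ _ fun x _ => ?_
  by_cases hx : x ∈ G
  · rw [gain_of_mem hx]
    exact maxSingle_nonneg hf0
  · refine (hf.gain_anti (Finset.empty_subset G) (Or.inr hx)).trans ?_
    have h1 : f {x} ≤ maxSingle f := Finset.le_sup' (fun x => f {x}) (Finset.mem_univ x)
    have h2 := hf0 ∅
    unfold gain
    rw [LawfulSingleton.insert_empty_eq]
    linarith

omit [Nonempty U] in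
theorem potential_initState_le (G : Finset U) {M s : ℝ} (hs : (stepsBelow τmin ε M : ℝ) ≤ s) :
    potential f G τmin ε (initState U ℓ M) ≤
      ℓ * (s * (Real.log (Fintype.card U) + 2) + (Real.log (Fintype.card U) + 1)) := by
  have h1 : ∀ j ∈ (Finset.univ : Finset (Fin ℓ)), stWeight f G τmin ε (initState U ℓ M) j ≤
      s * (Real.log (Fintype.card U) + 2) + (Real.log (Fintype.card U) + 1) := fun j _ => by
    have h2 := log_card_nonneg (U := U)
    unfold stWeight
    rw [if_pos (show j ∈ (initState U ℓ M).I from Finset.mem_univ j)]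
    exact add_le_add (mul_le_mul_of_nonneg_right hs (by linarith)) (pot_card_le _)
  have := Finset.sum_le_card_nsmul _ _ _ h1
  rwa [Finset.card_univ, Fintype.card_fin, nsmul_eq_mul] at this

theorem roundMoment_pitgLoop_le (hf : IsSubmodular f) (hm : 0 < τmin) (h0 : 0 < ε) (h1 : ε < 1)
    (hℓ : 0 < ℓ) {μ P : ℝ} (hμ : 12 * ℓ / ε ≤ μ) (hμ' : ((ℓ : ℝ) + 1) ^ 2 ≤ μ)
    (hP : ∀ G, potential f G τmin ε (initState U ℓ (maxGain f G)) ≤ P) (m i : ℕ)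
    (G : Finset U) :
    roundMoment f (pitgLoop m ℓ τmin ε i G) ≤ Real.exp (i * (1 / 10 + μ * P)) := by
  have hμ0 : 0 ≤ μ := (sq_nonneg _).trans hμ'
  have hpig : ∀ G, roundMoment f (parallelInterlaceGreedy G m ℓ τmin ε) ≤
      Real.exp (1 / 10 + μ * P) := fun G => by
    have h2 := roundMoment_pigLoop_le hf hm h0 h1 hμ hμ' m m _
      (initState_inv (ℓ := ℓ) hm h0 h1 (gain_le_maxGain f G))
    unfold roundMoment at h2 ⊢
    rw [ex_parallelInterlaceGreedy]
    have h3 : ∀ r : ℕ, Real.exp (((r + 1 : ℕ) : ℝ) / 20) =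
        Real.exp (1 / 20) * Real.exp (r / 20) := fun r => by
      rw [← Real.exp_add]
      congr 1
      push_cast
      ring
    simp only [h3]
    rw [ex_mul_left]
    refine (mul_le_mul_of_nonneg_left h2 (Real.exp_pos _).le).trans ?_
    rw [← Real.exp_add, Real.exp_le_exp]
    have := mul_le_mul_of_nonneg_left (hP G) hμ0
    linarith
  induction i generalizing G with
  | zero =>
    refine (roundMoment_pure G).trans_le ?_
    simp
  | succ i ih =>
    rw [pitgLoop_succ m ⟨⟨0, hℓ⟩, Finset.mem_univ _⟩, roundMoment_bind]
    calc _ ≤ Ex f (parallelInterlaceGreedy G m ℓ τmin ε) fun _ r _ =>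
          Real.exp (i * (1 / 10 + μ * P)) * Real.exp (r / 20) := by
          refine ex_le_ex (all_of_forall (fun A' r q => ?_) _)
          rw [mul_comm]
          exact mul_le_mul_of_nonneg_right (roundMoment_sample _ fun l _ => ih _)
            (Real.exp_pos _).le
      _ = Real.exp (i * (1 / 10 + μ * P)) *
          roundMoment f (parallelInterlaceGreedy G m ℓ τmin ε) := ex_mul_left _ _ _
      _ ≤ Real.exp (i * (1 / 10 + μ * P)) * Real.exp (1 / 10 + μ * P) :=
          mul_le_mul_of_nonneg_left (hpig G) (Real.exp_pos _).le
      _ = _ := by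
          rw [← Real.exp_add]
          congr 1
          push_cast
          ring

/-- The bound on the potential of the initial states. -/
def potentialBound (n k ℓ : ℕ) (ε : ℝ) : ℝ :=
  ℓ * ((Real.log (k / (ε / 2)) / (ε / 2) + 1) * (Real.log n + 2) + (Real.log n + 1))

theorem roundMoment_parallelInterpolatedGreedy_le (hf0 : ∀ S, 0 ≤ f S) (hf : IsSubmodular f)
    (hne : ∃ S, f S ≠ 0) {k : ℕ} (hε0 : 0 < ε) (hε1 : ε < 1) (hk : 1 ≤ k) (hℓ : 0 < ℓ) :
    roundMoment f (parallelInterpolatedGreedy U k ℓ ε) ≤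
      Real.exp (1 / 20 + ℓ * (1 / 10 +
        (24 * ℓ / ε + ((ℓ : ℝ) + 1) ^ 2) * potentialBound (Fintype.card U) k ℓ ε)) := by
  have hk0 : (1 : ℝ) ≤ k := by exact_mod_cast hk
  have hK : 1 ≤ k / (ε / 2) := by
    rw [le_div_iff₀ (by linarith)]
    linarith
  have hlogK : 0 ≤ Real.log (k / (ε / 2)) / (ε / 2) :=
    div_nonneg (Real.log_nonneg hK) (by linarith)
  have hlog := log_card_nonneg (U := U)
  have hP0 : 0 ≤ potentialBound (Fintype.card U) k ℓ ε := by
    unfold potentialBound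
    positivity
  have hμ0 : 0 ≤ 24 * ℓ / ε + ((ℓ : ℝ) + 1) ^ 2 := by positivity
  unfold roundMoment
  rw [ex_parallelInterpolatedGreedy]
  rcases (maxSingle_nonneg hf0).eq_or_lt with hM | hM
  · rw [← hM]
    simp only [mul_zero, zero_div]
    refine ex_le ((pitgLoop_stop (ε := ε / 2) (maxGain_empty_neg hf hf0 hne hM.symm) hℓ
      (k / ℓ) ℓ).mono ?_)
    rintro S r q ⟨-, hr⟩
    rw [Real.exp_le_exp]
    have h2 : (r : ℝ) ≤ 2 * ℓ := by exact_mod_cast hr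
    have h3 : 0 ≤ (ℓ : ℝ) * ((24 * ℓ / ε + ((ℓ : ℝ) + 1) ^ 2) *
        potentialBound (Fintype.card U) k ℓ ε) := by positivity
    push_cast
    linarith
  · set τ := ε / 2 * maxSingle f / k with hτ
    have hτ0 : 0 < τ := by positivity
    have hP : ∀ G, potential f G τ (ε / 2) (initState U ℓ (maxGain f G)) ≤
        potentialBound (Fintype.card U) k ℓ ε := fun G => by
      refine potential_initState_le G (stepsBelow_le hτ0 (by linarith) (by linarith) hK ?_)
      refine (maxGain_le_maxSingle hf hf0 G).trans_eq ?_
      rw [hτ]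
      field_simp
    have h2 := roundMoment_pitgLoop_le hf hτ0 (half_pos hε0) (by linarith) hℓ
      (μ := 24 * ℓ / ε + ((ℓ : ℝ) + 1) ^ 2) (by
        have : 12 * (ℓ : ℝ) / (ε / 2) = 24 * ℓ / ε := by field_simp; norm_num
        rw [this]
        nlinarith) (by
        have : 0 ≤ 24 * (ℓ : ℝ) / ε := by positivity
        linarith) hP (k / ℓ) ℓ ∅
    have h3 : ∀ r : ℕ, Real.exp (((r + 1 : ℕ) : ℝ) / 20) =
        Real.exp (1 / 20) * Real.exp (r / 20) := fun r => by
      rw [← Real.exp_add]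
      congr 1
      push_cast
      ring
    simp only [h3]
    rw [ex_mul_left, Real.exp_add]
    exact mul_le_mul_of_nonneg_left h2 (Real.exp_pos _).le

end Moments

/-! ### Absorbing all parameters into the stated form. -/

section Parameters

/-- With `z = e * ε * ℓ`, `z - 4 ≤ z ^ 2 / 16` turns the condition on `k` into `16 ≤ k * (e * ε) ^
2`, free of `ℓ`. The result absorbs `log (1/ε)` into `log k`. -/
theorem two_div_le {k ℓ : ℕ} {ε : ℝ} (hε0 : 0 < ε) (hε1 : ε < 1) (hℓ : (1 : ℝ) < ℓ)
    (hk : (2 - ε) ^ 2 * (ℓ : ℝ) ^ 2 ≤ k * (Real.exp 1 * ε * ℓ - 4)) :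
    2 / ε ≤ k ∧ (3 : ℝ) ≤ k := by
  have he := Real.exp_one_lt_d9
  have he0 := Real.exp_pos 1
  have hk0 : (0 : ℝ) ≤ k := Nat.cast_nonneg k
  have h1 : (ℓ : ℝ) ^ 2 * 16 ≤ ℓ ^ 2 * (k * (Real.exp 1 * ε) ^ 2) := by
    have h2 : (ℓ : ℝ) ^ 2 ≤ (2 - ε) ^ 2 * ℓ ^ 2 := by
      have : 1 ≤ (2 - ε) ^ 2 := by nlinarith
      nlinarith [sq_nonneg (ℓ : ℝ)]
    have h3 : k * (Real.exp 1 * ε * ℓ - 4) ≤ k * ((Real.exp 1 * ε * ℓ) ^ 2 / 16) :=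
      mul_le_mul_of_nonneg_left (by nlinarith [sq_nonneg (Real.exp 1 * ε * ℓ - 8)]) hk0
    nlinarith
  have h2 : 16 ≤ k * (Real.exp 1 * ε) ^ 2 := le_of_mul_le_mul_left h1 (by positivity)
  have h3 : 2 < k * ε ^ 2 := by
    have h4 : Real.exp 1 ^ 2 < 8 := by nlinarith
    have h5 : k * (Real.exp 1 * ε) ^ 2 = Real.exp 1 ^ 2 * (k * ε ^ 2) := by ring
    have h6 : 0 ≤ k * ε ^ 2 := by positivity
    by_contra hc
    nlinarith
  have h4 : (2 : ℝ) < k := by nlinarith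
  have h5 : (3 : ℝ) ≤ k := by
    have : 2 < k := by exact_mod_cast h4
    exact_mod_cast this
  refine ⟨?_, h5⟩
  rw [div_le_iff₀ hε0]
  by_contra hc
  nlinarith [mul_nonneg hk0 hε0.le]

/-- Powers of `ε⁻¹`: one from the `ℓ` calls, two from `μ`, two from the potential. Since `log n *
log k ≥ 1/2`, constants are absorbed: `22 = 2 + 20` for the start and `log n`, `4 * c` for the
calls, and `560 = 20 * 28` for the potential. -/
theorem exponent_le {n k ℓ : ℕ} {ε c : ℝ} (hn : 2 ≤ n) (hε0 : 0 < ε) (hε1 : ε < 1)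
    (hℓ : (1 : ℝ) < ℓ) (hℓc : (ℓ : ℝ) ≤ c / ε) (hk : 2 / ε ≤ k) (hk3 : (3 : ℝ) ≤ k) :
    20 * (1 / 20 + ℓ * (1 / 10 + (24 * ℓ / ε + ((ℓ : ℝ) + 1) ^ 2) * potentialBound n k ℓ ε) +
      Real.log n) ≤
    (22 + 4 * c + 560 * c ^ 2 * (24 * c + (c + 1) ^ 2)) * ε⁻¹ ^ 5 * Real.log n * Real.log k := by
  set a := ε⁻¹ with ha
  have ha1 : 1 ≤ a := (one_le_inv₀ hε0).2 hε1.le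
  have hℓa : (ℓ : ℝ) ≤ c * a := by rwa [div_eq_mul_inv] at hℓc
  have hc : 0 < c := by
    by_contra hc
    nlinarith
  have hLn : 1 / 2 ≤ Real.log n := by
    have h1 := Real.log_two_gt_d9
    have h2 : Real.log 2 ≤ Real.log n := Real.log_le_log (by norm_num) (by exact_mod_cast hn)
    linarith
  have hLk : 1 ≤ Real.log k := by
    rw [Real.le_log_iff_exp_le (by linarith)]
    linarith [Real.exp_one_lt_d9]
  have hlogK : Real.log (k / (ε / 2)) / (ε / 2) ≤ 4 * Real.log k * a := by
    have h1 : Real.log (k / (ε / 2)) ≤ 2 * Real.log k := by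
      have h2 : (k : ℝ) / (ε / 2) = k * (2 / ε) := by field_simp
      rw [h2, Real.log_mul (by linarith) (by positivity)]
      have := Real.log_le_log (by positivity) hk
      linarith
    have h3 : Real.log (k / (ε / 2)) / (ε / 2) = Real.log (k / (ε / 2)) * (2 * a) := by
      rw [ha]
      field_simp
    rw [h3]
    nlinarith
  set x := Real.log n
  set y := Real.log k
  have hxy : 1 / 2 ≤ x * y := by nlinarith
  have hxya : x * y ≤ a * (x * y) := by nlinarith
  have hP : potentialBound n k ℓ ε ≤ c * a * (28 * (a * (x * y))) := by
    unfold potentialBound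
    have h1 : (Real.log (k / (ε / 2)) / (ε / 2) + 1) * (x + 2) ≤ (5 * y * a) * (5 * x) := by
      refine mul_le_mul (by nlinarith) (by linarith) (by linarith) (by positivity)
    have h2 : x + 1 ≤ 3 * (a * (x * y)) := by nlinarith
    refine mul_le_mul hℓa (by linarith) ?_ (by positivity)
    have h4 : 0 ≤ Real.log (k / (ε / 2)) / (ε / 2) := by
      refine div_nonneg (Real.log_nonneg ?_) (by linarith)
      rw [le_div_iff₀ (by linarith)]
      linarith
    have : 0 ≤ x + 2 := by linarith
    positivity
  have hμ : 24 * ℓ / ε + ((ℓ : ℝ) + 1) ^ 2 ≤ (24 * c + (c + 1) ^ 2) * a ^ 2 := by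
    have h1 : 24 * (ℓ : ℝ) / ε = 24 * ℓ * a := div_eq_mul_inv _ _
    have h2 : (ℓ : ℝ) + 1 ≤ (c + 1) * a := by nlinarith
    have h3 : ((ℓ : ℝ) + 1) ^ 2 ≤ ((c + 1) * a) ^ 2 := pow_le_pow_left₀ (by positivity) h2 2
    rw [h1]
    nlinarith
  have hprod : (24 * ℓ / ε + ((ℓ : ℝ) + 1) ^ 2) * potentialBound n k ℓ ε ≤
      (24 * c + (c + 1) ^ 2) * a ^ 2 * (c * a * (28 * (a * (x * y)))) :=
    mul_le_mul_of_nonneg hμ hP (by positivity) (by positivity)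
  have hz : (0 : ℝ) < x * y := by linarith
  have ha5 : a ≤ a ^ 5 := le_self_pow₀ ha1 (by norm_num)
  have ha51 : 1 ≤ a ^ 5 := one_le_pow₀ ha1
  have hbig : ℓ * (1 / 10 + (24 * ℓ / ε + ((ℓ : ℝ) + 1) ^ 2) * potentialBound n k ℓ ε) ≤
      c * a * (1 / 10 + (24 * c + (c + 1) ^ 2) * a ^ 2 * (c * a * (28 * (a * (x * y))))) := by
    calc _ ≤ (ℓ : ℝ) * (1 / 10 + (24 * c + (c + 1) ^ 2) * a ^ 2 *
          (c * a * (28 * (a * (x * y))))) := by gcongr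
      _ ≤ _ := by gcongr
  have h1 : c * a ≤ c * (2 * (a ^ 5 * (x * y))) := by
    refine mul_le_mul_of_nonneg_left ?_ hc.le
    nlinarith
  have h2 : 1 ≤ 2 * (a ^ 5 * (x * y)) := by nlinarith
  have h3 : x ≤ a ^ 5 * (x * y) := by
    have : x * 1 ≤ x * y := by gcongr
    nlinarith
  have h4 : (22 + 4 * c + 560 * c ^ 2 * (24 * c + (c + 1) ^ 2)) * a ^ 5 * x * y =
      22 * (a ^ 5 * (x * y)) + 2 * (c * (2 * (a ^ 5 * (x * y)))) +
      20 * (c * a * ((24 * c + (c + 1) ^ 2) * a ^ 2 * (c * a * (28 * (a * (x * y)))))) := by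
    ring
  rw [h4]
  linarith

end Parameters

/-! ### The bound on rounds and queries. -/

section Complexity

variable {U : Type} [Fintype U] [Nonempty U] {f : Finset U → ℝ}

/-- The constant in the bounds on the numbers of rounds and queries. -/
def complexityConst (c : ℝ) : ℝ :=
  (22 + 4 * c + 560 * c ^ 2 * (24 * c + (c + 1) ^ 2)) * (1 + 2 * c)

theorem complexity (hf0 : ∀ S, 0 ≤ f S) (hf : IsSubmodular f) (hne : ∃ S, f S ≠ 0)
    {k ℓ : ℕ} {ε c : ℝ} (hε0 : 0 < ε) (hε1 : ε < 1) (hℓ : 4 / (Real.exp 1 * ε) ≤ ℓ)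
    (hℓc : (ℓ : ℝ) ≤ c / ε)
    (hk : (2 - ε) ^ 2 * (ℓ : ℝ) ^ 2 ≤ k * (Real.exp 1 * ε * ℓ - 4)) (hc : 0 < c) :
    1 - complexityConst c / (ε * Fintype.card U) ≤
      (parallelInterpolatedGreedy U k ℓ ε).prob f
        {o | (o.rounds : ℝ) ≤
              complexityConst c * ε⁻¹ ^ 5 * Real.log (Fintype.card U) * Real.log k ∧
            (o.queries : ℝ) ≤ complexityConst c * ε⁻¹ ^ 6 * Fintype.card U *
              Real.log (Fintype.card U) * Real.log k} := by
  obtain ⟨hℓ1, -, -, hk1⟩ := parameters hε0 hℓ hk hε1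
  obtain ⟨hkε, hk3⟩ := two_div_le hε0 hε1 hℓ1 hk
  have hℓ0 : 0 < ℓ := by
    have : (0 : ℝ) < ℓ := by linarith
    exact_mod_cast this
  set n := Fintype.card U with hn
  have hn0 : 0 < n := Fintype.card_pos
  set C₁ := 22 + 4 * c + 560 * c ^ 2 * (24 * c + (c + 1) ^ 2) with hC₁
  have hC₁1 : 1 ≤ C₁ := by
    have : 0 ≤ 4 * c + 560 * c ^ 2 * (24 * c + (c + 1) ^ 2) := by positivity
    linarith
  have hC : complexityConst c = C₁ * (1 + 2 * c) := rfl
  have hC1 : C₁ ≤ complexityConst c := by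
    rw [hC]
    nlinarith
  have hCn : 1 / (n : ℝ) ≤ complexityConst c / (ε * n) := by
    have : (0 : ℝ) < n := by exact_mod_cast hn0
    rw [div_le_div_iff₀ this (by positivity)]
    nlinarith
  rcases eq_or_lt_of_le (Nat.one_le_iff_ne_zero.2 hn0.ne') with h1 | h2
  -- For `n = 1` the logarithm makes the claimed bounds zero, but then the claimed probability is
  -- not positive.
  · refine le_trans ?_ ENNReal.toReal_nonneg
    rw [← h1] at hCn ⊢
    norm_num at hCn ⊢
    linarith
  set T := C₁ * ε⁻¹ ^ 5 * Real.log n * Real.log k with hT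
  have hLn : 0 ≤ Real.log n := Real.log_natCast_nonneg n
  have hLk : 0 ≤ Real.log k := Real.log_natCast_nonneg k
  have hT0 : 0 ≤ T := by positivity
  have hexp := exponent_le (n := n) h2 hε0 hε1 hℓ1 hℓc hkε hk3
  rw [← hC₁, ← hT] at hexp
  refine le_trans ?_ (one_sub_exp_le_prob (queriesLE_parallelInterpolatedGreedy hℓ0 k ε)
    (T := T) (roundMoment_parallelInterpolatedGreedy_le hf0 hf hne hε0 hε1 hk1 hℓ0) ?_)
  · have hnr : (0 : ℝ) < n := by exact_mod_cast hn0
    refine sub_le_sub_left (le_trans ?_ hCn) 1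
    calc _ ≤ Real.exp (-Real.log n) := Real.exp_le_exp.2 (by linarith)
      _ = 1 / n := by rw [Real.exp_neg, Real.exp_log hnr, one_div]
  · intro o hr hq
    refine ⟨hr.trans ?_, ?_⟩
    · rw [hT]
      gcongr
    · have hq' : (o.queries : ℝ) ≤ o.rounds * (ℓ * (n + 1)) := by exact_mod_cast hq
      have h3 : (n : ℝ) + 1 ≤ 2 * n := by
        have : (1 : ℝ) ≤ n := by exact_mod_cast hn0
        linarith
      have h4 : (ℓ : ℝ) ≤ c * ε⁻¹ := by rwa [div_eq_mul_inv] at hℓc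
      calc (o.queries : ℝ) ≤ o.rounds * (ℓ * (n + 1)) := hq'
        _ ≤ T * (c * ε⁻¹ * (2 * n)) := by gcongr
        _ = C₁ * (2 * c) * (ε⁻¹ ^ 6 * n * Real.log n * Real.log k) := by rw [hT]; ring
        _ ≤ C₁ * (1 + 2 * c) * (ε⁻¹ ^ 6 * n * Real.log n * Real.log k) := by
            gcongr
            linarith
        _ = _ := by rw [hC]; ring

end Complexity

end

theorem mainTheorem2 (c : ℝ) :
    ∃ C : ℝ, 0 < C ∧
      ∀ (U : Type) [Fintype U] [Nonempty U] (f : Finset U → ℝ) (k ℓ : ℕ) (ε : ℝ),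
        (∀ S : Finset U, 0 ≤ f S) → IsSubmodular f → (∃ S : Finset U, f S ≠ 0) →
        0 < ε → ε < 1 →
        4 / (Real.exp 1 * ε) ≤ ℓ → (ℓ : ℝ) ≤ c / ε →
        (2 - ε) ^ 2 * (ℓ : ℝ) ^ 2 ≤ k * (Real.exp 1 * ε * ℓ - 4) →
        (∀ o ∈ ((parallelInterpolatedGreedy U k ℓ ε).run f).support, o.output.card ≤ k) ∧
        (∀ O : Finset U, IsOptimal f k O →
          (1 / Real.exp 1 - ε) * f O ≤ (parallelInterpolatedGreedy U k ℓ ε).expectedValue f) ∧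
        1 - C / (ε * Fintype.card U) ≤
          (parallelInterpolatedGreedy U k ℓ ε).prob f
            {o | (o.rounds : ℝ) ≤
                  C * ε⁻¹ ^ 5 * Real.log (Fintype.card U) * Real.log k ∧
                (o.queries : ℝ) ≤
                  C * ε⁻¹ ^ 6 * Fintype.card U * Real.log (Fintype.card U) * Real.log k} := by
  -- For `c ≤ 0` the hypotheses contradict each other, as they force `ℓ > 1`.
  rcases le_or_gt c 0 with hc | hc
  · refine ⟨1, one_pos, fun U _ _ f k ℓ ε hf0 hf hne hε0 hε1 hℓ hℓc hk => ?_⟩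
    have h1 := (parameters hε0 hℓ hk hε1).1
    have h2 := div_nonpos_of_nonpos_of_nonneg hc hε0.le
    linarith
  · have hC : 0 < complexityConst c := by
      unfold complexityConst
      positivity
    refine ⟨complexityConst c, hC, fun U _ _ f k ℓ ε hf0 hf hne hε0 hε1 hℓ hℓc hk => ?_⟩
    obtain ⟨hℓ1, -, -, hk1⟩ := parameters hε0 hℓ hk hε1
    have hℓ0 : 0 < ℓ := by
      have : (0 : ℝ) < ℓ := by linarith
      exact_mod_cast this
    exact ⟨(card_output_le hf0 hf hne hε0 hε1 hk1 hℓ0).support,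
      fun O hO => approximation hf0 hf hne hε0 hε1 hℓ hk hO,
      complexity hf0 hf hne hε0 hε1 hℓ hℓc hk hc⟩
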